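/- **Setting.** Let $H=L^2((0,1);\mathbb R)$ with norm $\|\cdot\|$, let $A$ be the Laplacian with homogeneous Dirichlet boundary conditions, $\mathrm{Dom}(A)=H^2\cap H^1_0$, with $-Ae_i=\lambda_ie_i$, $\lambda_i=\pi^2i^2$, $e_i(x)=\sqrt2\sin(i\pi x)$, $i\ge1$. Write $\|x\|_s=\|(-A)^{s/2}x\|$ and $\dot H^s=\mathrm{Dom}((-A)^{s/2})$. Assume: * *Drift.* $F:H\to H$ satisfies $\langle x-y,F(x)-F(y)\rangle\le K\|x-y\|^2$ for all $x,y\in H$, with $K<\lambda_1$, and $F$ is Gateaux differentiable with $\|DF(y)\|_{\mathcal L(H)}\le L_F$ for all $y\in H$, where $L_F>0$. * *Noise.* $W(t)=\sum_{j\ge1}Q^{1/2}e_j\beta_j(t)$ on a filtered probability space $(\Omega,\mathcal F,\{\mathcal F_t\}_{t\ge0},\mathbb P)$, with independent standard Brownian motions $\beta_j$ (adapted, the joint increments after time $s$ being independent of $\mathcal F_s$). The operator $Q\in\mathcal L(H)$ is self-adjoint and positive definite ($\langle Qx,x\rangle>0$ for $x\ne0$), commutes with $A$, and, for some $\beta\in(0,1]$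 and some $\varepsilon<1$, satisfies $\|(-A)^{\frac{\beta-1}2}Q^{\frac12}\|_{\mathcal L_2(H)}<\infty$ (Hilbert–Schmidt norm), $\|Q^{-\frac12}(-A)^{-\frac12}\|_{\mathcal L(H)}<\infty$ and $\mathrm{Range}((-A)^{-\varepsilon/2})\subset\mathrm{Range}(Q^{1/2})$. * *Initial datum.* $X_0$ is $\mathcal F_0$-measurable and $H$-valued, $\mathbb E e^{\vartheta\|X_0\|^2}<\infty$ for some $\vartheta>0$, and $X_0\in L^{\vartheta_1}(\Omega;\dot H^\beta)$ for some $\vartheta_1\ge2$. Let $P^N$ be the orthogonal projection of $H$ onto $H_N=\mathrm{span}\{e_1,\dots,e_N\}$, $F^N=P^NF$, $S^N(t)=e^{tAP^N}$ on $H_N$, $0<\tau<\frac12$, $t_k=k\tau$, $\lfloor t\rfloor_\tau=\max\{t_k:t_k\le t\}$, and $\Delta W_k=W(t_{k+1})-W(t_k)$. The full discretization is $$X^N_{k+1}=S^N(\tau)X^N_k+\tau S^N(\tau)F^N(X^N_k)+S^N(\tau)P^N\Delta W_k,\qquad X^N_0=P^NX_0,$$ and its continuous version is $$X^{N,\tau}_t=S^N(t)X^N_0+\int_0^tS^N(t-\lfloor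 s\rfloor_\tau)F^N(X^{N,\tau}_{\lfloor s\rfloor_\tau})\,ds+\int_0^tS^N(t-\lfloor s\rfloor_\tau)P^N\,dW(s).$$ **Proposition.** Let $\tau\le\frac{\lambda_1-K}{4L_F^2}$. There are constants $C_1(p)$, $C_2(r)$, $C_3$, which besides the displayed arguments depend only on $K$, $L_F$ and upper bounds for $\|F(0)\|$ and $\|(-A)^{\frac{\beta-1}2}Q^{\frac12}\|_{\mathcal L_2(H)}$ (in particular not on $N$, $\tau$, $t$, $k$, $X_0$, $\psi$), such that the following holds. 1. For all real $p\ge1$: $\displaystyle\sup_{t\ge0}\mathbb E\|X^{N,\tau}_t\|_\beta^{2p}\le C_1(p)\,(1+\mathbb E\|X^N_0\|_\beta^{2p})$. 2. If $\|X^N_0\|_{L^2(\Omega;\dot H^\beta)}\le r$, then $\mathbb E\|X^{N,\tau}_t-X^{N,\tau}_s\|^2\le C_2(r)\,(t-s)^\beta$ for all $0\le s\le t$. 3. If $X^N_k$ and $\bar X^N_k$ are the full discretizations for two initial data $X_0$, $\bar X_0$ as above and the same noise, then $\mathbb E\|X^N_k-\bar X^N_k\|^{2p}\le\mathbb E\|X^N_0-\bar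 X^N_0\|^{2p}\,e^{-(\lambda_1-K)pt_k}$ for all real $p\ge1$ and all $k\in\mathbb N$. 4. The full discretization, as a Markov chain on $H_N$, has a unique invariant probability measure $\pi^N_\tau$. It does not depend on $X_0$, it satisfies $\int\|x\|^p\,\pi^N_\tau(dx)<\infty$ for all $p\ge1$, and for all $\psi\in\mathcal C^1_b(H;\mathbb R)$ and $k\in\mathbb N$, $$|\mathbb E\psi(X^N_k)-\pi^N_\tau(\psi)|\le C_3\,\|\psi\|_{1,\infty}\,(1+\mathbb E\|X^N_0\|^2)\,e^{-\frac12(\lambda_1-K)t_k},$$ where $\pi^N_\tau(\psi)=\int\psi\,d\pi^N_\tau$ and $\|\psi\|_{1,\infty}=\max\{\sup_x|\psi(x)|,\sup_x\|D\psi(x)\|\}$. -/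

import Mathlib

open Set Filter Topology MeasureTheory ProbabilityTheory
open scoped NNReal ENNReal

noncomputable section

namespace SPDE

/-! ### The Hilbert space and the Dirichlet Laplacian -/

/-- The Hilbert space `H = L²((0,1); ℝ)`. -/
abbrev H : Type := Lp ℝ 2 (volume.restrict (Ioo (0 : ℝ) 1))

instance : MeasurableSpace H := borel H

instance : BorelSpace H := ⟨rfl⟩

lemma memLp_sine (i : ℕ) :
    MemLp (fun x : ℝ => √2 * Real.sin ((i + 1) * Real.pi * x)) 2
      (volume.restrict (Ioo (0 : ℝ) 1)) := by
  refine MemLp.of_bound (by fun_prop) (√2) (Eventually.of_forall fun x => ?_)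
  rw [norm_mul, Real.norm_of_nonneg (Real.sqrt_nonneg 2), Real.norm_eq_abs]
  exact mul_le_of_le_one_right (Real.sqrt_nonneg 2) (Real.abs_sin_le_one _)

/-- The eigenfunctions `√2 sin((i+1)πx)` of the Dirichlet Laplacian, numbered from `i = 0`. -/
def e (i : ℕ) : H := (memLp_sine i).toLp _

/-- The eigenvalues `π² (i+1)²` of `-A`, numbered from `i = 0`; in particular `eigval 0` is the
smallest eigenvalue `λ₁ = π²`. -/
def eigval (i : ℕ) : ℝ := Real.pi ^ 2 * (i + 1) ^ 2

/-- `u ∈ Dom(A) = H²(0,1) ∩ H¹₀(0,1)` and `A u = f`, for the Laplacian `A` with homogeneous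
Dirichlet boundary conditions. The function `g` is the weak derivative of `u`. That the first
identity holds for all smooth `φ` on the line, and not only for those supported in `(0,1)`, says
that `u` has zero boundary values, i.e. `u ∈ H¹₀(0,1)`. The second identity says that `f` is the
weak derivative of `g`, so `f = u''`. -/
def IsDirichletLaplacian (u f : H) : Prop :=
  ∃ g : H,
    (∀ φ : ℝ → ℝ, ContDiff ℝ (⊤ : ℕ∞) φ →
      ∫ x in Ioo (0 : ℝ) 1, u x * deriv φ x = -∫ x in Ioo (0 : ℝ) 1, g x * φ x) ∧
    (∀ φ : ℝ → ℝ, ContDiff ℝ (⊤ : ℕ∞) φ → φ 0 = 0 → φ 1 = 0 →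
      ∫ x in Ioo (0 : ℝ) 1, g x * deriv φ x = -∫ x in Ioo (0 : ℝ) 1, f x * φ x)

/-- The norm `‖x‖_s = ‖(-A)^{s/2} x‖` for `x ∈ H`, with the value `∞` if `x` is not
in `Dom((-A)^{s/2})`. -/
def hdotNorm (s : ℝ) (x : H) : ℝ≥0∞ :=
  (∑' i, ENNReal.ofReal (eigval i ^ s * inner ℝ (e i) x ^ 2)) ^ (1 / 2 : ℝ)

/-- The fractional power `(-A)^s x = ∑ᵢ λᵢ^s ⟨x, eᵢ⟩ eᵢ`. It is meaningful on
`Dom((-A)^s) = {x | hdotNorm (2 * s) x < ∞}`, which is all of `H` if `s ≤ 0`. -/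
def laplacePow (s : ℝ) (x : H) : H := ∑' i, (eigval i ^ s * inner ℝ (e i) x) • e i

/-- The Hilbert-Schmidt norm of `(-A)^{r/2} R`, for `r ≤ 0`, computed in the basis `(eⱼ)`. -/
def hsNorm (r : ℝ) (R : H →L[ℝ] H) : ℝ≥0∞ :=
  (∑' j, hdotNorm r (R (e j)) ^ 2) ^ (1 / 2 : ℝ)

/-- The space `H_N = span{e₁, …, e_N}`. -/
def galerkinSpace (N : ℕ) : Submodule ℝ H := Submodule.span ℝ (e '' Iio N)

/-- The spectral Galerkin projection `P^N` onto `H_N`. -/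
def galerkinProj (N : ℕ) (x : H) : H := ∑ i ∈ Finset.range N, inner ℝ (e i) x • e i

/-- The semigroup `S^N(t) = e^{t A^N}` on `H_N`, extended to `H` by `S^N(t) P^N`. -/
def galerkinSemigroup (N : ℕ) (t : ℝ) (x : H) : H :=
  ∑ i ∈ Finset.range N, (Real.exp (-eigval i * t) * inner ℝ (e i) x) • e i

/-! ### The assumptions -/

/-- The assumption on the drift coefficient: the one-sided Lipschitz condition with constant
`K < λ₁`, and a Gateaux derivative that is bounded by `L > 0` in operator norm. -/
structure DriftAssumption (F : H → H) (K L : ℝ) : Prop where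
  lt_eigval : K < eigval 0
  pos : 0 < L
  dissipative : ∀ x y : H, inner ℝ (x - y) (F x - F y) ≤ K * ‖x - y‖ ^ 2
  deriv_bounded : ∀ y : H, ∃ D : H →L[ℝ] H, (∀ h, HasLineDerivAt ℝ F (D h) y h) ∧ ‖D‖ ≤ L

/-- The assumption on the covariance operator `Q`, whose positive square root `Q^{1/2}` is `R`. -/
structure CovarianceAssumption (Q R : H →L[ℝ] H) (β : ℝ) : Prop where
  isPositive : Q.IsPositive
  posDef : ∀ x : H, x ≠ 0 → 0 < inner ℝ (Q x) x
  sqrt_isPositive : R.IsPositive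
  sqrt_sq : R ∘L R = Q
  commutes : ∀ u f : H, IsDirichletLaplacian u f → IsDirichletLaplacian (Q u) (Q f)
  pos : 0 < β
  le_one : β ≤ 1
  /-- `‖(-A)^{(β-1)/2} Q^{1/2}‖_{𝓛₂(H)} < ∞` -/
  hs_finite : hsNorm (β - 1) R < ∞
  /-- `Q^{-1/2} (-A)^{-1/2}` is a bounded operator `T` on `H` -/
  inv_bounded : ∃ T : H →L[ℝ] H, ∀ x, R (T x) = laplacePow (-(1 / 2)) x
  /-- the range of `(-A)^{-ε/2}` is contained in the range of `Q^{1/2}` -/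
  range_subset : ∃ ε : ℝ, ε < 1 ∧
    ∀ x : H, hdotNorm (-ε) x < ∞ → laplacePow (-ε / 2) x ∈ range R

/-- The `b j` are independent standard real Brownian motions with respect to the filtration `ℱ`:
they are adapted, and the increments after time `s` are independent of `ℱ s`. -/
structure IsBrownianFamily {Ω : Type*} [mΩ : MeasurableSpace Ω] (P : Measure Ω)
    (ℱ : Filtration ℝ≥0 mΩ) (b : ℕ → ℝ≥0 → Ω → ℝ) : Prop where
  isBrownian : ∀ j, IsBrownianReal (b j) P
  iIndep : iIndepFun (fun j ω t => b j t ω) P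
  adapted : ∀ j t, Measurable[ℱ t] (b j t)
  indep_increments : ∀ s t, s ≤ t →
    Indep (MeasurableSpace.comap (fun ω j => b j t ω - b j s ω) inferInstance) (ℱ s) P

/-- The assumption on the initial datum. -/
structure InitialAssumption {Ω : Type*} [mΩ : MeasurableSpace Ω] (P : Measure Ω)
    (ℱ : Filtration ℝ≥0 mΩ) (β : ℝ) (X₀ : Ω → H) : Prop where
  measurable : Measurable[ℱ 0] X₀
  exp_moment : ∃ θ : ℝ, 0 < θ ∧ Integrable (fun ω => Real.exp (θ * ‖X₀ ω‖ ^ 2)) P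
  hdot_moment : ∃ θ₁ : ℝ, 2 ≤ θ₁ ∧ ∫⁻ ω, hdotNorm β (X₀ ω) ^ θ₁ ∂P < ∞

/-! ### The full discretization -/

section Scheme

variable {Ω : Type*}

/-- `P^N W(t) = ∑ⱼ P^N Q^{1/2} eⱼ βⱼ(t)`, where `R = Q^{1/2}`. -/
def galerkinNoise (N : ℕ) (R : H →L[ℝ] H) (b : ℕ → ℝ≥0 → Ω → ℝ) (t : ℝ≥0) (ω : Ω) : H :=
  ∑' j, b j t ω • galerkinProj N (R (e j))

/-- `P^N ΔW_k = P^N (W(t_{k+1}) - W(t_k))` with `t_k = k τ`. -/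
def noiseIncrement (N : ℕ) (τ : ℝ≥0) (R : H →L[ℝ] H) (b : ℕ → ℝ≥0 → Ω → ℝ) (k : ℕ) (ω : Ω) : H :=
  galerkinNoise N R b ((k + 1 : ℕ) * τ) ω - galerkinNoise N R b (k * τ) ω

/-- One step of the exponential integrator, from the state `x` with noise increment `w`:
`S^N(τ) x + τ S^N(τ) F^N(x) + S^N(τ) w`, where `F^N = P^N F`. -/
def schemeStep (N : ℕ) (τ : ℝ≥0) (F : H → H) (x w : H) : H :=
  galerkinSemigroup N τ x + (τ : ℝ) • galerkinSemigroup N τ (galerkinProj N (F x)) +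
    galerkinSemigroup N τ w

/-- The full discretization `X^N_k`, with `X^N_0 = P^N X₀`. -/
def scheme (N : ℕ) (τ : ℝ≥0) (F : H → H) (R : H →L[ℝ] H) (b : ℕ → ℝ≥0 → Ω → ℝ) (X₀ : Ω → H) :
    ℕ → Ω → H
  | 0, ω => galerkinProj N (X₀ ω)
  | k + 1, ω => schemeStep N τ F (scheme N τ F R b X₀ k ω) (noiseIncrement N τ R b k ω)

/-- The continuous version of the full discretization,
`X_t = S^N(t) X^N_0 + ∫₀ᵗ S^N(t-⌊s⌋) F^N(X_⌊s⌋) ds + ∫₀ᵗ S^N(t-⌊s⌋) P^N dW(s)`,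
where `⌊s⌋ = ⌊s/τ⌋ τ` is the last grid point before `s`, and `X_⌊s⌋ = X^N_⌊s/τ⌋`. The integrand of
the stochastic integral is deterministic and constant on each `[t_k, t_{k+1})`, so this
integral is the sum of `S^N(t-t_k) P^N (W(t ∧ t_{k+1}) - W(t_k))` over all `k` with `t_k < t`. -/
def contScheme (N : ℕ) (τ : ℝ≥0) (F : H → H) (R : H →L[ℝ] H) (b : ℕ → ℝ≥0 → Ω → ℝ) (X₀ : Ω → H)
    (t : ℝ≥0) (ω : Ω) : H :=
  galerkinSemigroup N t (galerkinProj N (X₀ ω)) +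
    (∫ s in (0 : ℝ)..t, galerkinSemigroup N (t - ⌊s / τ⌋₊ * τ)
      (galerkinProj N (F (scheme N τ F R b X₀ ⌊s / τ⌋₊ ω)))) +
    ∑ k ∈ Finset.range ⌈t / τ⌉₊, galerkinSemigroup N (t - k * τ)
      (galerkinNoise N R b (min t ((k + 1 : ℕ) * τ)) ω - galerkinNoise N R b (k * τ) ω)

/-- The one-step transition kernel of the Markov chain `X^N_k`: `x` is sent to the law of
`schemeStep N τ F x (P^N ΔW)`. -/
def transitionKernel [MeasurableSpace Ω] (P : Measure Ω) (N : ℕ) (τ : ℝ≥0) (F : H → H)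
    (R : H →L[ℝ] H) (b : ℕ → ℝ≥0 → Ω → ℝ) : Kernel H H :=
  (Kernel.id ×ₖ Kernel.const H (P.map (noiseIncrement N τ R b 0))).map
    (fun z => schemeStep N τ F z.1 z.2)

/-- `π` is an invariant probability measure of the full discretization, as a Markov chain with
state space `H_N`. -/
structure IsInvariantMeasure [MeasurableSpace Ω] (P : Measure Ω) (N : ℕ) (τ : ℝ≥0) (F : H → H)
    (R : H →L[ℝ] H) (b : ℕ → ℝ≥0 → Ω → ℝ) (π : Measure H) : Prop where
  isProbability : IsProbabilityMeasure π
  carried : π (galerkinSpace N : Set H)ᶜ = 0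
  invariant : Kernel.Invariant (transitionKernel P N τ F R b) π

end Scheme

/-! ### Test functions -/

/-- `ψ ∈ C¹_b(H; ℝ)`. -/
structure IsCb1 (ψ : H → ℝ) : Prop where
  contDiff : ContDiff ℝ 1 ψ
  bounded : BddAbove (range fun x => |ψ x|)
  deriv_bounded : BddAbove (range fun x => ‖fderiv ℝ ψ x‖)

/-- `‖ψ‖_{1,∞} = max (sup |ψ|) (sup ‖Dψ‖)`. -/
def cb1Norm (ψ : H → ℝ) : ℝ := max (⨆ x, |ψ x|) (⨆ x, ‖fderiv ℝ ψ x‖)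

end SPDE

end

noncomputable section

namespace SPDE

/-! ### The sine basis -/

/-! Since `Q` respects the graph of `A` and the Dirichlet eigenvalues are simple, `Q` and its
positive root `R` are diagonal in the sine basis: `R (e i) = σ i • e i`. On `H_N` everything then
becomes a Fourier multiplier or a finite sum of scalar Gaussians. The integrands of the stochastic
integrals are step functions, so no stochastic integration theory is needed. Integrals against the
semigroup become sums over grid cells, bounded by telescoping primitives.

Write `γ = λ₁ - K`. The semigroup contracts by `e^{-λ₁τ}`, and one-sided monotonicity bounds the
expansion caused by an Euler step of the drift. The step-size condition makes the remaining
quadratic term cost only a fraction of `γ`. So two copies driven by the same noise approach each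
other pathwise at rate `γ/2` (`norm_schemeStep_sub_le`), which is the contraction claim. The same
computation, after subtracting the stochastic convolution `Z` from the chain `X`, gives a recursion
for `Y = X - Z` with factor `e^{-γτ}` and forcing `‖F Z‖²`. The moments of `Z` are bounded uniformly
in time by the Hilbert-Schmidt assumption, hence so are those of `X` (`eLpNorm_scheme_le`).

Regularity comes from the mild formulation. Smoothing costs at most `(t-u)^{-1/2}` with exponential
decay, a kernel integrable on the half line, so the drift contributes a bounded amount in
`Dom((-A)^{β/2})` (`eLpNorm_galerkinPow_contScheme_le`). On `[s,t]` the three mild terms are each of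
order `(t-s)^{β/2}` for `t-s ≤ 1`, and longer intervals follow from the uniform bound.

For the invariant measure, the scheme is an iterated random contraction. Composing the random maps
in reverse order gives almost surely Cauchy iterates. Their limit has an invariant law, because
prepending one more noise variable to an i.i.d. sequence does not change its law (`map_consSeq`).
Backward and forward iterates have the same law at each time, so Fatou transfers the moment bounds
to the limit. The transition operator multiplies Lipschitz constants by `ρ = e^{-γτ/2}`, which gives
both exponential mixing and uniqueness. -/

lemma inner_eq_setIntegral_of_ae {f : H} {g : ℝ → ℝ}
    (h : f =ᵐ[volume.restrict (Ioo (0 : ℝ) 1)] g) (u : H) :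
    inner ℝ f u = ∫ x in Ioo (0 : ℝ) 1, u x * g x := by
  rw [L2.inner_def]
  refine integral_congr_ae ?_
  filter_upwards [h] with x hx
  simp [hx]

lemma e_ae (i : ℕ) : e i =ᵐ[volume.restrict (Ioo (0 : ℝ) 1)]
    fun x => √2 * Real.sin ((i + 1) * Real.pi * x) := (memLp_sine i).coeFn_toLp

lemma inner_e (i : ℕ) (u : H) : inner ℝ (e i) u =
    ∫ x in Ioo (0 : ℝ) 1, u x * (√2 * Real.sin ((i + 1) * Real.pi * x)) :=
  inner_eq_setIntegral_of_ae (e_ae i) u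

lemma setIntegral_unit (f : ℝ → ℝ) : ∫ x in Ioo (0 : ℝ) 1, f x = ∫ x in (0 : ℝ)..1, f x := by
  rw [intervalIntegral.integral_of_le zero_le_one, integral_Ioc_eq_integral_Ioo]

lemma integral_cos_int_mul_pi {n : ℤ} (hn : n ≠ 0) :
    ∫ x in (0 : ℝ)..1, Real.cos (n * Real.pi * x) = 0 := by
  have hc : (n * Real.pi : ℝ) ≠ 0 := mul_ne_zero (by exact_mod_cast hn) Real.pi_ne_zero
  rw [intervalIntegral.integral_comp_mul_left (fun x => Real.cos x) hc]
  simp [Real.sin_int_mul_pi]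

lemma inner_e_e (i j : ℕ) : inner ℝ (e i) (e j) = if i = j then (1 : ℝ) else 0 := by
  rw [inner_e]
  have h1 : ∫ x in Ioo (0 : ℝ) 1, e j x * (√2 * Real.sin ((i + 1) * Real.pi * x)) =
      ∫ x in Ioo (0 : ℝ) 1, (Real.cos (((i : ℤ) - j : ℤ) * Real.pi * x) -
        Real.cos (((i : ℤ) + j + 2 : ℤ) * Real.pi * x)) := by
    refine integral_congr_ae ?_
    filter_upwards [e_ae j] with x hx
    rw [hx]
    have h2 : √2 * √2 = (2 : ℝ) := Real.mul_self_sqrt (by norm_num)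
    have h3 := Real.cos_sub ((i + 1) * Real.pi * x) ((j + 1) * Real.pi * x)
    have h4 := Real.cos_add ((i + 1) * Real.pi * x) ((j + 1) * Real.pi * x)
    have h5 : (((i : ℤ) - j : ℤ) : ℝ) * Real.pi * x =
      (i + 1) * Real.pi * x - (j + 1) * Real.pi * x := by push_cast; ring
    have h6 : (((i : ℤ) + j + 2 : ℤ) : ℝ) * Real.pi * x =
      (i + 1) * Real.pi * x + (j + 1) * Real.pi * x := by push_cast; ring
    rw [h5, h6, h3, h4]
    linear_combination
      (Real.sin ((i + 1) * Real.pi * x) * Real.sin ((j + 1) * Real.pi * x)) * h2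
  rw [h1, setIntegral_unit, intervalIntegral.integral_sub
    (Continuous.intervalIntegrable (by fun_prop) _ _)
    (Continuous.intervalIntegrable (by fun_prop) _ _),
    integral_cos_int_mul_pi (n := (i : ℤ) + j + 2) (by positivity)]
  split_ifs with h
  · subst h; simp
  · rw [integral_cos_int_mul_pi (by omega)]; simp

lemma orthonormal_e : Orthonormal ℝ e := by
  rw [orthonormal_iff_ite]
  exact inner_e_e

lemma memLp_cosine (a b : ℝ) : MemLp (fun x : ℝ => a * Real.cos (b * x)) 2
    (volume.restrict (Ioo (0 : ℝ) 1)) := by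
  refine MemLp.of_bound (by fun_prop) |a| (Eventually.of_forall fun x => ?_)
  rw [norm_mul, Real.norm_eq_abs, Real.norm_eq_abs]
  exact mul_le_of_le_one_right (abs_nonneg _) (Real.abs_cos_le_one _)

lemma sin_succ_mul_pi (i : ℕ) : Real.sin ((i + 1) * Real.pi) = 0 := by
  have := Real.sin_nat_mul_pi (i + 1)
  push_cast at this
  exact this

/-- Integrate by parts twice, with the cosine as weak derivative. The first boundary term vanishes
because the sine does at both endpoints, the second because the test function does. -/
lemma isDirichletLaplacian_e (i : ℕ) : IsDirichletLaplacian (e i) (-eigval i • e i) := by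
  set a : ℝ := (i + 1) * Real.pi with ha
  have hg := (memLp_cosine (√2 * a) a).coeFn_toLp
  refine ⟨(memLp_cosine (√2 * a) a).toLp _, fun φ hφ => ?_, fun φ hφ h0 h1 => ?_⟩
  · have hd : Continuous (deriv φ) := hφ.continuous_deriv (by simp)
    have e1 : ∫ x in Ioo (0 : ℝ) 1, e i x * deriv φ x =
        ∫ x in Ioo (0 : ℝ) 1, √2 * Real.sin (a * x) * deriv φ x := by
      refine integral_congr_ae ?_
      filter_upwards [e_ae i] with x hx
      rw [hx]
    have e2 : ∫ x in Ioo (0 : ℝ) 1, (memLp_cosine (√2 * a) a).toLp _ x * φ x =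
        ∫ x in Ioo (0 : ℝ) 1, √2 * a * Real.cos (a * x) * φ x := by
      refine integral_congr_ae ?_
      filter_upwards [hg] with x hx
      rw [hx]
    rw [e1, e2, setIntegral_unit, setIntegral_unit,
      intervalIntegral.integral_mul_deriv_eq_deriv_mul (u := fun x => √2 * Real.sin (a * x))
        (u' := fun x => √2 * a * Real.cos (a * x)) (v := φ)
        (fun x _ => by
          have := ((hasDerivAt_id' x).const_mul a).sin.const_mul (√2)
          convert this using 1
          ring)
        (fun x _ => (hφ.differentiable (by simp)).differentiableAt.hasDerivAt)
        (Continuous.intervalIntegrable (by fun_prop) _ _) (hd.intervalIntegrable _ _)]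
    simp [ha, sin_succ_mul_pi]
  · have hd : Continuous (deriv φ) := hφ.continuous_deriv (by simp)
    have e1 : ∫ x in Ioo (0 : ℝ) 1, (-eigval i • e i : H) x * φ x =
        ∫ x in Ioo (0 : ℝ) 1, -(√2 * a ^ 2 * Real.sin (a * x)) * φ x := by
      refine integral_congr_ae ?_
      filter_upwards [e_ae i, Lp.coeFn_smul (-eigval i) (e i)] with x hx hx2
      rw [hx2, Pi.smul_apply, hx, eigval, ha, smul_eq_mul]
      ring
    have e2 : ∫ x in Ioo (0 : ℝ) 1, (memLp_cosine (√2 * a) a).toLp _ x * deriv φ x =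
        ∫ x in Ioo (0 : ℝ) 1, √2 * a * Real.cos (a * x) * deriv φ x := by
      refine integral_congr_ae ?_
      filter_upwards [hg] with x hx
      rw [hx]
    rw [e1, e2, setIntegral_unit, setIntegral_unit,
      intervalIntegral.integral_mul_deriv_eq_deriv_mul (u := fun x => √2 * a * Real.cos (a * x))
        (u' := fun x => -(√2 * a ^ 2 * Real.sin (a * x))) (v := φ)
        (fun x _ => by
          have := ((hasDerivAt_id' x).const_mul a).cos.const_mul (√2 * a)
          convert this using 1
          ring)
        (fun x _ => (hφ.differentiable (by simp)).differentiableAt.hasDerivAt)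
        (Continuous.intervalIntegrable (by fun_prop) _ _) (hd.intervalIntegrable _ _)]
    simp [h0, h1]

/-- Symmetry of `A` against `e j`: the sine is an admissible test function in the second identity,
and its derivative, a cosine, in the first. The cosine does not vanish at the endpoints, so this is
where the zero boundary values of `u` enter. -/
lemma IsDirichletLaplacian.inner_e {u f : H} (h : IsDirichletLaplacian u f) (j : ℕ) :
    inner ℝ (e j) f = -eigval j * inner ℝ (e j) u := by
  obtain ⟨g, h1, h2⟩ := h
  set a : ℝ := (j + 1) * Real.pi with ha
  have h3 := h1 (fun x => √2 * a * Real.cos (a * x)) (by fun_prop)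
  have h4 := h2 (fun x => √2 * Real.sin (a * x)) (by fun_prop) (by simp)
    (by simp [ha, sin_succ_mul_pi])
  have d1 : deriv (fun x => √2 * a * Real.cos (a * x)) =
      fun x => -a ^ 2 * (√2 * Real.sin (a * x)) := by
    ext x
    have := ((hasDerivAt_id' x).const_mul a).cos.const_mul (√2 * a)
    rw [HasDerivAt.deriv (f := fun x => √2 * a * Real.cos (a * x)) this]
    simp; ring
  have d2 : deriv (fun x => √2 * Real.sin (a * x)) = fun x => √2 * a * Real.cos (a * x) := by
    ext x
    have := ((hasDerivAt_id' x).const_mul a).sin.const_mul (√2)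
    rw [HasDerivAt.deriv (f := fun x => √2 * Real.sin (a * x)) this]
    simp; ring
  rw [d1] at h3
  rw [d2] at h4
  rw [SPDE.inner_e, SPDE.inner_e]
  have h5 : ∫ x in Ioo (0 : ℝ) 1, u x * (-a ^ 2 * (√2 * Real.sin (a * x))) =
      -a ^ 2 * ∫ x in Ioo (0 : ℝ) 1, u x * (√2 * Real.sin (a * x)) := by
    rw [← integral_const_mul]
    congr 1; ext x; ring
  rw [h5] at h3
  rw [eigval]
  rw [ha] at h3 h4
  linear_combination h4 - h3

/-- The product `sin(πx) cos(jπx)` is half a difference of sines of frequencies `j+1` and `j-1`, so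
orthogonality to sines becomes orthogonality of `u sin(πx)` to all cosines. -/
lemma integral_mul_cos_eq_zero {u : H} (hu : ∀ i, inner ℝ (e i) u = 0) (j : ℕ) :
    ∫ x in Ioo (0 : ℝ) 1, u x * Real.sin (Real.pi * x) * Real.cos (j * Real.pi * x) = 0 := by
  have hs : ∀ n : ℕ, ∫ x in Ioo (0 : ℝ) 1, u x * Real.sin (n * Real.pi * x) = 0 := by
    intro n
    rcases n with _ | i
    · simp
    · have := hu i
      rw [inner_e] at this
      have h5 : ∫ x in Ioo (0 : ℝ) 1, u x * (√2 * Real.sin ((i + 1) * Real.pi * x)) =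
          √2 * ∫ x in Ioo (0 : ℝ) 1, u x * Real.sin ((i + 1) * Real.pi * x) := by
        rw [← integral_const_mul]
        congr 1; ext x; ring
      rw [h5] at this
      push_cast
      simpa using this
  have hi : ∀ c : ℝ, Integrable (fun x => u x * Real.sin (c * x))
      (volume.restrict (Ioo (0 : ℝ) 1)) := fun c => by
    refine Integrable.mul_bdd (c := 1) ((Lp.memLp u).integrable (by norm_num)) (by fun_prop) ?_
    exact Eventually.of_forall fun x => Real.abs_sin_le_one _
  have key : ∀ x, u x * Real.sin (Real.pi * x) * Real.cos (j * Real.pi * x) =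
      (1 / 2) * (u x * Real.sin ((j + 1 : ℕ) * Real.pi * x)) -
        (1 / 2) * (u x * Real.sin (((j : ℝ) - 1) * Real.pi * x)) := by
    intro x
    have h1 := Real.sin_add (j * Real.pi * x) (Real.pi * x)
    have h2 := Real.sin_sub (j * Real.pi * x) (Real.pi * x)
    have h3 : ((j + 1 : ℕ) : ℝ) * Real.pi * x = j * Real.pi * x + Real.pi * x := by
      push_cast; ring
    have h4 : ((j : ℝ) - 1) * Real.pi * x = j * Real.pi * x - Real.pi * x := by ring
    rw [h3, h4, h1, h2]; ring
  simp_rw [key]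
  rw [integral_sub ((hi _).const_mul _) ((hi _).const_mul _), integral_const_mul,
    integral_const_mul, hs]
  rcases j with _ | j
  · have := hs 1
    simp only [Nat.cast_one, one_mul] at this
    simp [integral_neg, this]
  · have := hs j
    push_cast
    rw [add_sub_cancel_right, this]
    simp

/-- The functions `e i` form a complete system in `L²(0,1)`. -/
lemma eq_zero_of_inner_e {u : H} (hu : ∀ i, inner ℝ (e i) u = 0) : u = 0 := by
  -- The weight `sin(πx)` trades sines for cosines, and the span of the cosines consists of the
  -- polynomials in `cos(πx)`. The substitution `y = cos(πx)` then makes Weierstrass approximation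
  -- on `[-1,1]` applicable.
  set w : ℝ → ℝ := fun x => u x * Real.sin (Real.pi * x) with hw
  have hui : Integrable u (volume.restrict (Ioo (0 : ℝ) 1)) :=
    (Lp.memLp u).integrable (by norm_num)
  have hwi : IntegrableOn w (Ioo (0 : ℝ) 1) :=
    Integrable.mul_bdd (c := 1) hui (by fun_prop)
      (Eventually.of_forall fun x => Real.abs_sin_le_one _)
  have hcos : ∀ n j : ℕ, ∫ x in Ioo (0 : ℝ) 1,
      w x * (Real.cos (Real.pi * x) ^ n * Real.cos (j * Real.pi * x)) = 0 := by
    intro n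
    induction n with
    | zero => intro j; simpa [hw] using integral_mul_cos_eq_zero hu j
    | succ n ih =>
      intro j
      have hint : ∀ m : ℕ, Integrable
          (fun x => w x * (Real.cos (Real.pi * x) ^ n * Real.cos (m * Real.pi * x)))
          (volume.restrict (Ioo (0 : ℝ) 1)) := fun m => by
        refine Integrable.mul_bdd (c := 1) hwi (by fun_prop) ?_
        refine Eventually.of_forall fun x => ?_
        rw [norm_mul, norm_pow]
        exact mul_le_one₀ (pow_le_one₀ (norm_nonneg _) (Real.abs_cos_le_one _)) (norm_nonneg _)
          (Real.abs_cos_le_one _)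
      rcases j with _ | j
      · have := ih 1
        simp only [Nat.cast_one, one_mul] at this
        refine Eq.trans ?_ this
        congr 1; ext x; simp [pow_succ]
      · have h1 := ih (j + 2)
        have h2 := ih j
        have : ∀ x, w x * (Real.cos (Real.pi * x) ^ (n + 1) *
            Real.cos ((j + 1 : ℕ) * Real.pi * x)) =
            (1 / 2) * (w x * (Real.cos (Real.pi * x) ^ n *
              Real.cos ((j + 2 : ℕ) * Real.pi * x))) +
            (1 / 2) * (w x * (Real.cos (Real.pi * x) ^ n * Real.cos (j * Real.pi * x))) := by
          intro x
          have h3 : ((j + 2 : ℕ) : ℝ) * Real.pi * x =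
            (j + 1 : ℕ) * Real.pi * x + Real.pi * x := by push_cast; ring
          have h4 : (j : ℝ) * Real.pi * x =
            (j + 1 : ℕ) * Real.pi * x - Real.pi * x := by push_cast; ring
          rw [h3, h4, Real.cos_add, Real.cos_sub]; ring
        simp_rw [this]
        rw [integral_add ((hint _).const_mul _) ((hint _).const_mul _), integral_const_mul,
          integral_const_mul, h1, h2]
        simp
  have hpow : ∀ n : ℕ, ∫ x in Ioo (0 : ℝ) 1, w x * Real.cos (Real.pi * x) ^ n = 0 := fun n => by
    simpa using hcos n 0
  have hpoly : ∀ p : Polynomial ℝ,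
      ∫ x in Ioo (0 : ℝ) 1, w x * p.eval (Real.cos (Real.pi * x)) = 0 := by
    intro p
    simp_rw [Polynomial.eval_eq_sum_range, Finset.mul_sum]
    rw [integral_finsetSum]
    · refine Finset.sum_eq_zero fun i _ => ?_
      simp_rw [mul_left_comm (w _)]
      rw [integral_const_mul, hpow, mul_zero]
    · intro i _
      simp_rw [mul_left_comm (w _)]
      refine Integrable.const_mul ?_ _
      refine Integrable.mul_bdd (c := 1) hwi (by fun_prop) ?_
      refine Eventually.of_forall fun x => ?_
      rw [norm_pow]
      exact pow_le_one₀ (norm_nonneg _) (Real.abs_cos_le_one _)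
  have hcont : ∀ g : ℝ → ℝ, Continuous g → ∫ x in Ioo (0 : ℝ) 1, w x * g x = 0 := by
    intro g hg
    rw [← norm_le_zero_iff]
    refine le_of_forall_pos_le_add fun ε hε => ?_
    rw [zero_add]
    set I : ℝ := ∫ x in Ioo (0 : ℝ) 1, ‖w x‖ with hI
    have hI0 : 0 ≤ I := integral_nonneg fun _ => norm_nonneg _
    -- On `[0,1]` one has `g x = g (arccos (cos (πx)) / π)`. The tolerance has `I + 1` in the
    -- denominator to allow `I = 0`.
    obtain ⟨p, hp⟩ := exists_polynomial_near_of_continuousOn (-1) 1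
      (fun y => g (Real.arccos y / Real.pi))
      (hg.comp (Real.continuous_arccos.div_const _)).continuousOn (ε / (I + 1)) (by positivity)
    have hpx : ∀ x ∈ Ioo (0 : ℝ) 1, ‖g x - p.eval (Real.cos (Real.pi * x))‖ ≤ ε / (I + 1) := by
      intro x hx
      have := hp (Real.cos (Real.pi * x)) (Real.cos_mem_Icc _)
      rw [Real.arccos_cos (by have := hx.1; positivity)
        (by nlinarith [hx.2, Real.pi_pos]), mul_div_cancel_left₀ _ Real.pi_ne_zero] at this
      rw [Real.norm_eq_abs, abs_sub_comm]
      exact this.le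
    have hpc : ∀ x, ‖p.eval (Real.cos (Real.pi * x))‖ ≤
        ∑ i ∈ Finset.range (p.natDegree + 1), |p.coeff i| := by
      intro x
      rw [Polynomial.eval_eq_sum_range]
      refine (norm_sum_le _ _).trans (Finset.sum_le_sum fun i _ => ?_)
      rw [norm_mul, norm_pow]
      exact mul_le_of_le_one_right (abs_nonneg _)
        (pow_le_one₀ (norm_nonneg _) (Real.abs_cos_le_one _))
    have hip : Integrable (fun x => w x * p.eval (Real.cos (Real.pi * x)))
        (volume.restrict (Ioo (0 : ℝ) 1)) :=
      Integrable.mul_bdd hwi (p.continuous.comp (by fun_prop)).aestronglyMeasurable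
        (Eventually.of_forall hpc)
    have hid : Integrable (fun x => w x * (g x - p.eval (Real.cos (Real.pi * x))))
        (volume.restrict (Ioo (0 : ℝ) 1)) := by
      refine Integrable.mul_bdd (c := ε / (I + 1)) hwi
        (hg.sub (p.continuous.comp (by fun_prop))).aestronglyMeasurable ?_
      exact (ae_restrict_iff' measurableSet_Ioo).2 (Eventually.of_forall hpx)
    have hsplit : ∫ x in Ioo (0 : ℝ) 1, w x * g x =
        ∫ x in Ioo (0 : ℝ) 1, w x * (g x - p.eval (Real.cos (Real.pi * x))) := by
      have h1 := integral_add hid hip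
      rw [hpoly p, add_zero] at h1
      rw [← h1]
      congr 1; ext x; ring
    rw [hsplit]
    calc ‖∫ x in Ioo (0 : ℝ) 1, w x * (g x - p.eval (Real.cos (Real.pi * x)))‖
        ≤ ∫ x in Ioo (0 : ℝ) 1, ‖w x‖ * (ε / (I + 1)) := by
          refine norm_integral_le_of_norm_le (hwi.norm.mul_const _) ?_
          refine (ae_restrict_iff' measurableSet_Ioo).2 (Eventually.of_forall fun x hx => ?_)
          rw [norm_mul]
          exact mul_le_mul_of_nonneg_left (hpx x hx) (norm_nonneg _)
      _ = I * (ε / (I + 1)) := by rw [integral_mul_const]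
      _ ≤ ε := by
          rw [mul_div_assoc', div_le_iff₀ (by positivity)]
          nlinarith
  have hw0 : ∀ᵐ x ∂volume, x ∈ Ioo (0 : ℝ) 1 → w x = 0 := by
    refine isOpen_Ioo.ae_eq_zero_of_integral_contDiff_smul_eq_zero hwi.locallyIntegrableOn ?_
    intro g hg _ hsupp
    have h1 : ∫ x, g x • w x = ∫ x in Ioo (0 : ℝ) 1, g x • w x := by
      symm
      refine setIntegral_eq_integral_of_forall_compl_eq_zero fun x hx => ?_
      rw [image_eq_zero_of_notMem_tsupport fun h => hx (hsupp h), zero_smul]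
    refine h1.trans (Eq.trans ?_ (hcont g hg.continuous))
    congr 1; ext x; simp [mul_comm]
  refine Lp.eq_zero_iff_ae_eq_zero.2 ?_
  rw [Filter.EventuallyEq, ae_restrict_iff' measurableSet_Ioo]
  filter_upwards [hw0] with x hx hx1
  -- The weight has no zero inside the interval, so it can be divided out.
  have hs : 0 < Real.sin (Real.pi * x) :=
    Real.sin_pos_of_pos_of_lt_pi (by have := hx1.1; positivity) (by nlinarith [hx1.2, Real.pi_pos])
  simpa [hw, hs.ne'] using hx hx1

/-! ### Diagonalization of the covariance -/

lemma eigval_strictMono : StrictMono eigval := by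
  intro i j hij
  have h : ((i : ℝ) + 1) < j + 1 := by exact_mod_cast Nat.succ_lt_succ hij
  exact mul_lt_mul_of_pos_left (by gcongr) (by positivity)

lemma one_le_eigval_zero_div_two : 1 ≤ eigval 0 / 2 := by
  have := Real.pi_gt_three
  simp only [eigval]; norm_num; nlinarith

lemma eigval_zero_le (i : ℕ) : eigval 0 ≤ eigval i := eigval_strictMono.monotone (Nat.zero_le i)

lemma one_le_eigval (i : ℕ) : 1 ≤ eigval i := by
  have := eigval_zero_le i
  have := one_le_eigval_zero_div_two
  linarith

lemma eigval_pos (i : ℕ) : 0 < eigval i := one_pos.trans_le (one_le_eigval i)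

namespace CovarianceAssumption

variable {Q R : H →L[ℝ] H} {β : ℝ}

/-- Commutation gives `(λⱼ - λᵢ) ⟨eⱼ, Q eᵢ⟩ = 0`. The eigenvalues are distinct, so only the
coefficient `j = i` survives, and completeness of the sines identifies `Q eᵢ`. -/
lemma apply_e (h : CovarianceAssumption Q R β) (i : ℕ) :
    Q (e i) = (inner ℝ (e i) (Q (e i)) : ℝ) • e i := by
  rw [← sub_eq_zero]
  refine eq_zero_of_inner_e fun j => ?_
  rw [inner_sub_right, inner_smul_right, inner_e_e]
  split_ifs with hij
  · subst hij; simp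
  · have h1 := (h.commutes _ _ (isDirichletLaplacian_e i)).inner_e j
    rw [map_smul, inner_smul_right] at h1
    have h2 : eigval j - eigval i ≠ 0 := sub_ne_zero.2 (eigval_strictMono.injective.ne hij)
    have h3 : (eigval j - eigval i) * inner ℝ (e j) (Q (e i)) = 0 := by linear_combination h1
    rcases mul_eq_zero.1 h3 with h4 | h4
    · exact absurd h4 h2
    · rw [h4]; simp

lemma norm_e (i : ℕ) : ‖e i‖ = 1 := orthonormal_e.1 i

lemma e_ne_zero (i : ℕ) : e i ≠ 0 := by
  intro h
  have := norm_e i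
  simp [h] at this

/-- From `R² eᵢ = q eᵢ`, the defect `v = R eᵢ - √q eᵢ` satisfies `R v = -√q v`. A positive operator
has no negative eigenvalue, so `v = 0`. -/
lemma sqrt_apply_e (h : CovarianceAssumption Q R β) (i : ℕ) :
    R (e i) = √(inner ℝ (e i) (Q (e i))) • e i := by
  set q : ℝ := inner ℝ (e i) (Q (e i)) with hq
  have hq0 : 0 < q := by
    rw [hq, real_inner_comm]
    exact h.posDef _ (e_ne_zero i)
  set v : H := R (e i) - √q • e i with hv
  have hRR : R (R (e i)) = q • e i := by
    rw [← ContinuousLinearMap.comp_apply, h.sqrt_sq]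
    exact h.apply_e i
  have h1 : R v + √q • v = 0 := by
    rw [hv, map_sub, map_smul, hRR, smul_sub, smul_smul, Real.mul_self_sqrt hq0.le]
    abel
  have h2 : 0 ≤ inner ℝ (R v) v := h.sqrt_isPositive.inner_nonneg_left v
  have h3 : inner ℝ (R v) v + √q * ‖v‖ ^ 2 = 0 := by
    have := congrArg (fun z : H => (inner ℝ z v : ℝ)) h1
    simpa [inner_add_left, inner_smul_left, real_inner_self_eq_norm_sq] using this
  have h4 : 0 < √q := Real.sqrt_pos.2 hq0
  have h5 : ‖v‖ ^ 2 = 0 := by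
    have := mul_nonneg h4.le (sq_nonneg ‖v‖)
    have h6 : √q * ‖v‖ ^ 2 = 0 := by linarith
    rcases mul_eq_zero.1 h6 with h | h
    · exact absurd h h4.ne'
    · exact h
  have h6 : v = 0 := by simpa using h5
  exact sub_eq_zero.1 h6

/-- The standard deviation of the noise in the direction `e i`. -/
lemma exists_sqrt_apply_e (h : CovarianceAssumption Q R β) :
    ∃ σ : ℕ → ℝ, ∀ i, R (e i) = σ i • e i :=
  ⟨_, h.sqrt_apply_e⟩

end CovarianceAssumption

/-- For diagonal `R` the squared Hilbert-Schmidt norm is the full series of these terms. This is the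
only form in which the noise bound is used later. -/
lemma sum_le_of_hsNorm_le {R : H →L[ℝ] H} {r M : ℝ} {σ : ℕ → ℝ} (hσ : ∀ i, R (e i) = σ i • e i)
    (hM : hsNorm r R ≤ ENNReal.ofReal M) (N : ℕ) :
    ∑ i ∈ Finset.range N, eigval i ^ r * σ i ^ 2 ≤ M ^ 2 := by
  have h1 : ∀ j, hdotNorm r (R (e j)) ^ 2 = ENNReal.ofReal (eigval j ^ r * σ j ^ 2) := by
    intro j
    rw [hdotNorm, ← ENNReal.rpow_natCast, ← ENNReal.rpow_mul]
    norm_num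
    rw [tsum_eq_single j]
    · rw [hσ, inner_smul_right, inner_e_e]; simp
    · intro i hi
      rw [hσ, inner_smul_right, inner_e_e]; simp [hi]
  have h2 : ∑' j, hdotNorm r (R (e j)) ^ 2 ≤ ENNReal.ofReal M ^ 2 := by
    have := ENNReal.rpow_le_rpow hM (z := 2) (by norm_num)
    rw [hsNorm, ← ENNReal.rpow_mul] at this
    norm_num at this
    exact this
  have h3 : ENNReal.ofReal (∑ i ∈ Finset.range N, eigval i ^ r * σ i ^ 2) ≤
      ENNReal.ofReal (|M| ^ 2) := by
    rw [ENNReal.ofReal_sum_of_nonneg fun i _ =>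
      mul_nonneg (Real.rpow_nonneg (eigval_pos i).le _) (sq_nonneg _)]
    calc _ = ∑ i ∈ Finset.range N, hdotNorm r (R (e i)) ^ 2 :=
          Finset.sum_congr rfl fun i _ => (h1 i).symm
      _ ≤ _ := ENNReal.sum_le_tsum _
      _ ≤ _ := h2
      _ ≤ ENNReal.ofReal |M| ^ 2 := by gcongr; exact le_abs_self M
      _ = _ := (ENNReal.ofReal_pow (abs_nonneg M) 2).symm
  rw [ENNReal.ofReal_le_ofReal_iff (sq_nonneg _), sq_abs] at h3
  exact h3

/-! ### Fourier multipliers on the Galerkin spaces -/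

/-- The operator `x ↦ ∑_{i < N} cᵢ ⟨eᵢ, x⟩ eᵢ`. -/
def multiplier (N : ℕ) (c : ℕ → ℝ) : H →L[ℝ] H :=
  ∑ i ∈ Finset.range N, (c i • innerSL ℝ (e i)).smulRight (e i)

lemma multiplier_apply (N : ℕ) (c : ℕ → ℝ) (x : H) :
    multiplier N c x = ∑ i ∈ Finset.range N, (c i * inner ℝ (e i) x) • e i := by
  simp [multiplier]

lemma galerkinProj_eq (N : ℕ) (x : H) : galerkinProj N x = multiplier N 1 x := by
  simp [multiplier_apply, galerkinProj]

lemma galerkinSemigroup_eq (N : ℕ) (t : ℝ) (x : H) :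
    galerkinSemigroup N t x = multiplier N (fun i => Real.exp (-eigval i * t)) x := by
  simp [multiplier_apply, galerkinSemigroup]

lemma inner_e_sum (N j : ℕ) (a : ℕ → ℝ) :
    inner ℝ (e j) (∑ i ∈ Finset.range N, a i • e i) = if j < N then a j else 0 := by
  simp [inner_sum, inner_smul_right, inner_e_e]

lemma inner_e_multiplier (N j : ℕ) (c : ℕ → ℝ) (x : H) :
    inner ℝ (e j) (multiplier N c x) = if j < N then c j * inner ℝ (e j) x else 0 := by
  rw [multiplier_apply, inner_e_sum]

lemma multiplier_sum (N : ℕ) (c a : ℕ → ℝ) :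
    multiplier N c (∑ i ∈ Finset.range N, a i • e i) =
      ∑ i ∈ Finset.range N, (c i * a i) • e i := by
  rw [multiplier_apply]
  refine Finset.sum_congr rfl fun i hi => ?_
  rw [inner_e_sum, if_pos (Finset.mem_range.1 hi)]

lemma multiplier_multiplier (N : ℕ) (c d : ℕ → ℝ) (x : H) :
    multiplier N c (multiplier N d x) = multiplier N (fun i => c i * d i) x := by
  rw [multiplier_apply N d, multiplier_sum, multiplier_apply]
  simp_rw [mul_assoc]

lemma norm_sum_sq (N : ℕ) (a : ℕ → ℝ) :
    ‖∑ i ∈ Finset.range N, a i • e i‖ ^ 2 = ∑ i ∈ Finset.range N, a i ^ 2 := by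
  rw [← real_inner_self_eq_norm_sq, sum_inner]
  refine Finset.sum_congr rfl fun i hi => ?_
  rw [real_inner_smul_left, inner_e_sum, if_pos (Finset.mem_range.1 hi), sq]

lemma norm_multiplier_sq (N : ℕ) (c : ℕ → ℝ) (x : H) :
    ‖multiplier N c x‖ ^ 2 = ∑ i ∈ Finset.range N, (c i * inner ℝ (e i) x) ^ 2 := by
  rw [multiplier_apply, norm_sum_sq]

/-- By Parseval, operator estimates on `H_N` reduce to pointwise comparison of the symbols. -/
lemma norm_multiplier_le_multiplier {N : ℕ} {c d : ℕ → ℝ} {C : ℝ} (hC : 0 ≤ C)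
    (h : ∀ i < N, |c i| ≤ C * |d i|) (x : H) :
    ‖multiplier N c x‖ ≤ C * ‖multiplier N d x‖ := by
  refine le_of_sq_le_sq ?_ (by positivity)
  rw [mul_pow, norm_multiplier_sq, norm_multiplier_sq, Finset.mul_sum]
  refine Finset.sum_le_sum fun i hi => ?_
  have h1 := pow_le_pow_left₀ (abs_nonneg _) (h i (Finset.mem_range.1 hi)) 2
  rw [mul_pow, sq_abs, sq_abs] at h1
  rw [mul_pow, mul_pow, ← mul_assoc]
  exact mul_le_mul_of_nonneg_right h1 (sq_nonneg _)

lemma norm_multiplier_one_le (N : ℕ) (x : H) : ‖multiplier N 1 x‖ ≤ ‖x‖ := by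
  refine le_of_sq_le_sq ?_ (norm_nonneg _)
  rw [norm_multiplier_sq]
  have := orthonormal_e.sum_inner_products_le x (s := Finset.range N)
  simpa using this

lemma norm_multiplier_le {N : ℕ} {c : ℕ → ℝ} {C : ℝ} (hC : 0 ≤ C)
    (h : ∀ i < N, |c i| ≤ C) (x : H) : ‖multiplier N c x‖ ≤ C * ‖x‖ :=
  (norm_multiplier_le_multiplier (d := 1) hC (by simpa using h) x).trans
    (mul_le_mul_of_nonneg_left (norm_multiplier_one_le N x) hC)

/-- The fractional power `(-A)^{s/2} P^N`. -/
def galerkinPow (N : ℕ) (s : ℝ) : H →L[ℝ] H := multiplier N fun i => eigval i ^ (s / 2)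

/-- On the range of a multiplier the extended-valued norm is a finite Hilbert norm, so the `L^p`
calculus of `eLpNorm` applies to it. -/
lemma hdotNorm_multiplier (N : ℕ) (s : ℝ) (c : ℕ → ℝ) (x : H) :
    hdotNorm s (multiplier N c x) = ‖galerkinPow N s (multiplier N c x)‖ₑ := by
  have h1 : ∀ i, eigval i ^ s * inner ℝ (e i) (multiplier N c x) ^ 2 =
      if i ∈ Finset.range N then (eigval i ^ (s / 2) * (c i * inner ℝ (e i) x)) ^ 2 else 0 := by
    intro i
    rw [inner_e_multiplier]
    simp only [Finset.mem_range]
    split_ifs with h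
    · rw [mul_pow (eigval i ^ (s / 2)), ← Real.rpow_natCast (eigval i ^ (s / 2)),
        ← Real.rpow_mul (eigval_pos i).le]
      norm_num
    · simp
  have h2 : ∑' i, ENNReal.ofReal (eigval i ^ s * inner ℝ (e i) (multiplier N c x) ^ 2) =
      ENNReal.ofReal (‖galerkinPow N s (multiplier N c x)‖ ^ 2) := by
    rw [galerkinPow, multiplier_multiplier, norm_multiplier_sq,
      ENNReal.ofReal_sum_of_nonneg fun i _ => sq_nonneg _,
      tsum_eq_sum (s := Finset.range N) fun i hi => by rw [h1, if_neg hi, ENNReal.ofReal_zero]]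
    refine Finset.sum_congr rfl fun i hi => ?_
    rw [h1, if_pos hi, mul_assoc]
  rw [hdotNorm, h2, ENNReal.ofReal_rpow_of_nonneg (by positivity) (by norm_num),
    ← ofReal_norm]
  rw [← Real.sqrt_eq_rpow, Real.sqrt_sq (norm_nonneg _)]

lemma norm_multiplier_le_norm_galerkinPow {N : ℕ} {s : ℝ} (hs : 0 ≤ s) (c : ℕ → ℝ) (x : H) :
    ‖multiplier N c x‖ ≤ ‖galerkinPow N s (multiplier N c x)‖ := by
  have := norm_multiplier_le_multiplier (N := N) (c := c)
    (d := fun i => eigval i ^ (s / 2) * c i) zero_le_one (fun i _ => ?_) x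
  · rwa [one_mul, ← multiplier_multiplier] at this
  · rw [one_mul, abs_mul, abs_of_nonneg (Real.rpow_nonneg (eigval_pos i).le _)]
    exact le_mul_of_one_le_left (abs_nonneg _)
      (Real.one_le_rpow (one_le_eigval i) (by positivity))

/-! ### The drift -/

namespace DriftAssumption

variable {F : H → H} {K L : ℝ}

/-- Mean value inequality along the segment from `y` to `x`: only the directional derivative in the
direction `x - y` is needed, so Gateaux differentiability suffices. -/
lemma norm_sub_le (hF : DriftAssumption F K L) (x y : H) : ‖F x - F y‖ ≤ L * ‖x - y‖ := by
  choose D hD hDL using hF.deriv_bounded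
  have h1 : ∀ t ∈ Icc (0 : ℝ) 1, HasDerivWithinAt (fun t : ℝ => F (y + t • (x - y)))
      (D (y + t • (x - y)) (x - y)) (Icc 0 1) t := by
    intro t _
    have h2 := hD (y + t • (x - y)) (x - y)
    rw [HasLineDerivAt] at h2
    have h3 : HasDerivAt (fun s : ℝ => F (y + t • (x - y) + (s - t) • (x - y)))
        (D (y + t • (x - y)) (x - y)) t := by
      have h4 : HasDerivAt (fun s : ℝ => F (y + t • (x - y) + s • (x - y)))
        (D (y + t • (x - y)) (x - y)) (t - t) := by rwa [sub_self]
      exact h4.comp_sub_const t t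
    refine (h3.congr_of_eventuallyEq (Eventually.of_forall fun s => ?_)).hasDerivWithinAt
    simp only [sub_smul, add_assoc, add_sub_cancel]
  have h2 := norm_image_sub_le_of_norm_deriv_le_segment_01' h1 (C := L * ‖x - y‖)
    fun t _ => ((D _).le_opNorm _).trans (mul_le_mul_of_nonneg_right (hDL _) (norm_nonneg _))
  simpa using h2

lemma lipschitzWith (hF : DriftAssumption F K L) : LipschitzWith L.toNNReal F :=
  LipschitzWith.of_dist_le_mul fun x y => by
    rw [dist_eq_norm, dist_eq_norm, Real.coe_toNNReal _ hF.pos.le]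
    exact hF.norm_sub_le x y

lemma continuous (hF : DriftAssumption F K L) : Continuous F := hF.lipschitzWith.continuous

lemma norm_le (hF : DriftAssumption F K L) {B : ℝ} (hB : ‖F 0‖ ≤ B) (x : H) :
    ‖F x‖ ≤ B + L * ‖x‖ := by
  have h1 := hF.norm_sub_le x 0
  rw [sub_zero] at h1
  have h2 := norm_sub_norm_le (F x) (F 0)
  linarith

lemma gap_pos (hF : DriftAssumption F K L) : 0 < eigval 0 - K := sub_pos.2 hF.lt_eigval

/-- The form in which the step-size restriction is used: it makes the quadratic Euler term `τ² ‖F x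
- F y‖²` at most a quarter of `τ γ ‖x - y‖²`. -/
lemma mul_sq_le (hF : DriftAssumption F K L) {τ : ℝ} (hτ : τ ≤ (eigval 0 - K) / (4 * L ^ 2)) :
    τ * L ^ 2 ≤ (eigval 0 - K) / 4 := by
  have hL := hF.pos
  rw [le_div_iff₀ (by positivity)] at hτ
  linarith

end DriftAssumption

lemma abs_exp_neg_eigval_mul_le {τ : ℝ} (hτ : 0 ≤ τ) (i : ℕ) :
    |Real.exp (-eigval i * τ)| ≤ Real.exp (-eigval 0 * τ) := by
  rw [abs_of_pos (Real.exp_pos _), Real.exp_le_exp]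
  have := mul_le_mul_of_nonneg_right (eigval_zero_le i) hτ
  linarith

lemma norm_galerkinSemigroup_le (N : ℕ) {τ : ℝ} (hτ : 0 ≤ τ) (x : H) :
    ‖galerkinSemigroup N τ x‖ ≤ Real.exp (-eigval 0 * τ) * ‖x‖ := by
  rw [galerkinSemigroup_eq]
  exact norm_multiplier_le (Real.exp_pos _).le (fun i _ => abs_exp_neg_eigval_mul_le hτ i) x

lemma galerkinSemigroup_galerkinProj (N : ℕ) (t : ℝ) (x : H) :
    galerkinSemigroup N t (galerkinProj N x) = galerkinSemigroup N t x := by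
  simp only [galerkinSemigroup_eq, galerkinProj_eq, multiplier_multiplier, Pi.one_apply, mul_one]

lemma galerkinProj_galerkinSemigroup (N : ℕ) (t : ℝ) (x : H) :
    galerkinProj N (galerkinSemigroup N t x) = galerkinSemigroup N t x := by
  simp only [galerkinSemigroup_eq, galerkinProj_eq, multiplier_multiplier, Pi.one_apply, one_mul]

lemma galerkinSemigroup_galerkinSemigroup (N : ℕ) (s t : ℝ) (x : H) :
    galerkinSemigroup N s (galerkinSemigroup N t x) = galerkinSemigroup N (s + t) x := by
  simp only [galerkinSemigroup_eq, multiplier_multiplier, ← Real.exp_add, mul_add]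

lemma schemeStep_eq (N : ℕ) (τ : ℝ≥0) (F : H → H) (x w : H) :
    schemeStep N τ F x w = galerkinSemigroup N τ (x + (τ : ℝ) • F x + w) := by
  rw [schemeStep, galerkinSemigroup_galerkinProj]
  simp only [galerkinSemigroup_eq, map_add, map_smul]

/-- One step of the scheme contracts distances. -/
lemma norm_schemeStep_sub_le {F : H → H} {K L : ℝ} (hF : DriftAssumption F K L) (N : ℕ) {τ : ℝ≥0}
    (hτ : (τ : ℝ) ≤ (eigval 0 - K) / (4 * L ^ 2)) (x y w : H) :
    ‖schemeStep N τ F x w - schemeStep N τ F y w‖ ≤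
      Real.exp (-(1 / 2) * (eigval 0 - K) * τ) * ‖x - y‖ := by
  have h1 : schemeStep N τ F x w - schemeStep N τ F y w =
      galerkinSemigroup N τ ((x - y) + (τ : ℝ) • (F x - F y)) := by
    rw [schemeStep_eq, schemeStep_eq]
    simp only [galerkinSemigroup_eq, map_add, map_smul, map_sub, smul_sub]
    abel
  rw [h1]
  refine (norm_galerkinSemigroup_le N τ.coe_nonneg _).trans ?_
  have hτ0 : (0 : ℝ) ≤ τ := τ.coe_nonneg
  have hγ := hF.gap_pos
  -- The cross term contributes `2Kτ` and the quadratic term at most `γτ/4`, within the allowance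
  -- `γτ`. Multiplied by `e^{-2λ₁τ}` from the semigroup, the exponent `2K + γ` becomes `-γ`, hence
  -- the rate `γ/2` after taking roots.
  have h2 : ‖(x - y) + (τ : ℝ) • (F x - F y)‖ ^ 2 ≤
      Real.exp (2 * K * τ + (eigval 0 - K) * τ) * ‖x - y‖ ^ 2 := by
    rw [norm_add_sq_real, norm_smul, real_inner_smul_right, Real.norm_of_nonneg hτ0, mul_pow]
    have h3 := hF.dissipative x y
    have h4 : ‖F x - F y‖ ^ 2 ≤ L ^ 2 * ‖x - y‖ ^ 2 := by
      rw [← mul_pow]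
      exact pow_le_pow_left₀ (norm_nonneg _) (hF.norm_sub_le x y) 2
    have h5 := hF.mul_sq_le hτ
    have h6 := Real.add_one_le_exp (2 * K * τ + (eigval 0 - K) * τ)
    have h7 := mul_le_mul_of_nonneg_left h3 hτ0
    have h8 := mul_le_mul_of_nonneg_left h4 (sq_nonneg (τ : ℝ))
    have h9 : (τ : ℝ) * (τ * L ^ 2) * ‖x - y‖ ^ 2 ≤
      τ * ((eigval 0 - K) / 4) * ‖x - y‖ ^ 2 := by gcongr
    have h10 := mul_le_mul_of_nonneg_right h6 (sq_nonneg ‖x - y‖)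
    have h11 : 0 ≤ (τ : ℝ) * (eigval 0 - K) * ‖x - y‖ ^ 2 := by positivity
    nlinarith
  refine le_of_sq_le_sq ?_ (by positivity)
  rw [mul_pow, mul_pow]
  refine (mul_le_mul_of_nonneg_left h2 (sq_nonneg _)).trans (le_of_eq ?_)
  rw [← mul_assoc, sq (Real.exp _), sq (Real.exp _), ← Real.exp_add, ← Real.exp_add,
    ← Real.exp_add]
  congr 2
  ring

/-- The one-step estimate for the scheme after subtraction of the stochastic convolution `z`. -/
lemma norm_galerkinSemigroup_add_drift_sq_le {F : H → H} {K L : ℝ} (hF : DriftAssumption F K L)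
    (N : ℕ) {τ : ℝ≥0} (hτ2 : (τ : ℝ) < 1 / 2)
    (hτ : (τ : ℝ) ≤ (eigval 0 - K) / (4 * L ^ 2)) (y z : H) :
    ‖galerkinSemigroup N τ (y + (τ : ℝ) • F (y + z))‖ ^ 2 ≤
      Real.exp (-(eigval 0 - K) * τ) * ‖y‖ ^ 2 +
        τ * (1 + 4 / (eigval 0 - K)) * ‖F z‖ ^ 2 := by
  have hτ0 : (0 : ℝ) ≤ τ := τ.coe_nonneg
  have hγ := hF.gap_pos
  set γ := eigval 0 - K with hγdef
  have h2 : ‖y + (τ : ℝ) • F (y + z)‖ ^ 2 ≤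
      Real.exp (2 * K * τ + γ * τ) * ‖y‖ ^ 2 + τ * (1 + 4 / γ) * ‖F z‖ ^ 2 := by
    rw [norm_add_sq_real, norm_smul, real_inner_smul_right, Real.norm_of_nonneg hτ0, mul_pow]
    have h3 := hF.dissipative (y + z) z
    rw [add_sub_cancel_right, inner_sub_right] at h3
    -- Young's inequality, weighted to leave room: the doubled cross term costs `γτ/4` and the
    -- quadratic term `γτ/2`, together below `γτ`. The forcing collects `4τ/γ + 2τ²`, and `τ < 1/2`
    -- turns `2τ²` into `τ`.
    have h3' : inner ℝ y (F z) ≤ γ / 8 * ‖y‖ ^ 2 + 2 / γ * ‖F z‖ ^ 2 := by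
      have h := real_inner_le_norm y (F z)
      have h' : 0 ≤ γ / 8 * (‖y‖ - 4 / γ * ‖F z‖) ^ 2 := by positivity
      have h'' : γ / 8 * (‖y‖ - 4 / γ * ‖F z‖) ^ 2 =
        γ / 8 * ‖y‖ ^ 2 + 2 / γ * ‖F z‖ ^ 2 - ‖y‖ * ‖F z‖ := by field_simp; ring
      linarith
    have h4 : ‖F (y + z)‖ ^ 2 ≤ 2 * (L ^ 2 * ‖y‖ ^ 2) + 2 * ‖F z‖ ^ 2 := by
      have h := hF.norm_sub_le (y + z) z
      rw [add_sub_cancel_right] at h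
      have h' := norm_sub_norm_le (F (y + z)) (F z)
      have h'' : ‖F (y + z)‖ ≤ L * ‖y‖ + ‖F z‖ := by linarith
      have := pow_le_pow_left₀ (norm_nonneg _) h'' 2
      nlinarith [sq_nonneg (L * ‖y‖ - ‖F z‖)]
    have h5 := hF.mul_sq_le hτ
    have h6 := Real.add_one_le_exp (2 * K * τ + γ * τ)
    have h7 := mul_le_mul_of_nonneg_left (add_le_add h3 h3') hτ0
    have h8 := mul_le_mul_of_nonneg_left h4 (sq_nonneg (τ : ℝ))
    have h9 : (τ : ℝ) * (τ * L ^ 2) * ‖y‖ ^ 2 ≤ τ * (γ / 4) * ‖y‖ ^ 2 := by gcongr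
    have h10 := mul_le_mul_of_nonneg_right h6 (sq_nonneg ‖y‖)
    have h11 : 0 ≤ (τ : ℝ) * γ * ‖y‖ ^ 2 := by positivity
    have h12 : (τ : ℝ) * τ * ‖F z‖ ^ 2 ≤ τ * (1 / 2) * ‖F z‖ ^ 2 := by gcongr
    have h13 : τ * (1 + 4 / γ) * ‖F z‖ ^ 2 = τ * ‖F z‖ ^ 2 + 2 * (τ * (2 / γ * ‖F z‖ ^ 2)) := by
      ring
    rw [h13]
    linarith
  have h14 := pow_le_pow_left₀ (norm_nonneg _)
    (norm_galerkinSemigroup_le N hτ0 (y + (τ : ℝ) • F (y + z))) 2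
  rw [mul_pow] at h14
  refine h14.trans ((mul_le_mul_of_nonneg_left h2 (sq_nonneg _)).trans ?_)
  rw [mul_add, ← mul_assoc, sq (Real.exp _), ← Real.exp_add, ← Real.exp_add]
  refine add_le_add (le_of_eq ?_) ?_
  · congr 2
    rw [hγdef]; ring
  · refine mul_le_of_le_one_left (by positivity) ?_
    rw [Real.exp_le_one_iff]
    have := mul_nonneg (eigval_pos 0).le hτ0
    linarith

/-! ### Moments of Gaussian sums -/

lemma eLpNorm_norm_sq {α E : Type*} {mα : MeasurableSpace α} [NormedAddCommGroup E]
    (f : α → E) (p : ℝ≥0∞) (μ : Measure α) :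
    eLpNorm (fun x => ‖f x‖ ^ 2) p μ = eLpNorm f (2 * p) μ ^ 2 := by
  have := eLpNorm_norm_rpow (p := p) (μ := μ) f (q := 2) two_pos
  simpa [mul_comm] using this

/-- The `L^p` norm of a standard real Gaussian variable. -/
def gaussianNorm (p : ℝ≥0∞) : ℝ≥0∞ := eLpNorm id p (gaussianReal 0 1)

lemma gaussianNorm_lt_top {p : ℝ≥0∞} (hp : p ≠ ∞) : gaussianNorm p < ∞ :=
  (memLp_id_gaussianReal' p hp).2

section Gaussian

variable {Ω : Type*} {mΩ : MeasurableSpace Ω} {P : Measure Ω}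

lemma eLpNorm_eq_of_hasLaw_gaussianReal {X : Ω → ℝ} {v : ℝ≥0} (hX : HasLaw X (gaussianReal 0 v) P)
    (p : ℝ≥0∞) : eLpNorm X p P = ENNReal.ofReal √v * gaussianNorm p := by
  have h1 : gaussianReal 0 v = (gaussianReal 0 1).map (fun x => √v * x) := by
    rw [gaussianReal_map_const_mul]
    congr 1
    · simp
    · ext; simp
  have h2 : eLpNorm X p P = eLpNorm id p (P.map X) :=
    (eLpNorm_map_measure aestronglyMeasurable_id hX.aemeasurable).symm
  rw [h2, hX.map_eq, h1, eLpNorm_map_measure aestronglyMeasurable_id (by fun_prop)]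
  have h3 : (id ∘ fun x : ℝ => √v * x) = √(v : ℝ) • (id : ℝ → ℝ) := by ext; simp
  rw [h3, eLpNorm_const_smul, gaussianNorm, Real.enorm_of_nonneg (Real.sqrt_nonneg _)]

/-- A substitute for the Itô isometry: for a deterministic step integrand the Wiener integral is a
sum of independent centred Gaussians, whose variances add. -/
lemma exists_hasLaw_sum_increments {B : ℝ≥0 → Ω → ℝ} (hB : IsPreBrownianReal B P) {a : ℕ → ℝ≥0}
    (ha : Monotone a) (c : ℕ → ℝ) (n : ℕ) :
    ∃ v : ℝ≥0, (v : ℝ) = ∑ k ∈ Finset.range n, c k ^ 2 * ((a (k + 1) : ℝ) - a k) ∧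
      HasLaw (fun ω => ∑ k ∈ Finset.range n, c k * (B (a (k + 1)) ω - B (a k) ω))
        (gaussianReal 0 v) P := by
  have hP : IsProbabilityMeasure P := hB.isGaussianProcess.isProbabilityMeasure
  have hae : ∀ k, AEMeasurable (fun ω => c k * (B (a (k + 1)) ω - B (a k) ω)) P := fun k =>
    ((hB.aemeasurable _).sub (hB.aemeasurable _)).const_mul _
  have hind : iIndepFun (fun k ω => c k * (B (a (k + 1)) ω - B (a k) ω)) P :=
    (hB.hasIndepIncrements.nat ha).comp (fun k x => c k * x) fun k => by fun_prop
  induction n with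
  | zero =>
    refine ⟨0, by simp, ?_⟩
    simp only [Finset.range_zero, Finset.sum_empty, gaussianReal_zero_var]
    exact hasLaw_dirac_of_ae_eq (Eventually.of_forall fun _ => rfl)
  | succ n ih =>
    obtain ⟨v, hv, hlaw⟩ := ih
    have h1 := gaussianReal_const_mul (hB.hasLaw_sub (a (n + 1)) (a n)) (c n)
    rw [mul_zero] at h1
    have hfun : (fun ω => ∑ k ∈ Finset.range n, c k * (B (a (k + 1)) ω - B (a k) ω)) =
        ∑ k ∈ Finset.range n, fun ω => c k * (B (a (k + 1)) ω - B (a k) ω) := by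
      ext ω; simp
    have h2 := gaussianReal_add_gaussianReal_of_indepFun
      (hfun ▸ hind.indepFun_finsetSum_of_notMem₀ hae Finset.notMem_range_self) hlaw.map_eq h1.map_eq
    rw [add_zero] at h2
    refine ⟨_, ?_, ?_, Eq.trans (congrArg P.map ?_) h2⟩
    · rw [Finset.sum_range_succ, ← hv]
      push_cast
      have h3 : (a n : ℝ) ≤ a (n + 1) := ha n.le_succ
      congr 2
      rw [Real.dist_eq]
      exact abs_of_nonneg (sub_nonneg.2 h3)
    · exact Finset.aemeasurable_fun_sum _ fun k _ => hae k
    · ext ω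
      simp [Finset.sum_range_succ]

/-- Moments of a Hilbert space valued sum of Gaussian variables. -/
lemma eLpNorm_sum_gaussian_le [IsProbabilityMeasure P] {N : ℕ} {ζ : ℕ → Ω → ℝ} {v : ℕ → ℝ≥0}
    (hζ : ∀ i < N, HasLaw (ζ i) (gaussianReal 0 (v i)) P) (c : ℕ → ℝ) {V : ℝ}
    (hV : ∑ i ∈ Finset.range N, c i ^ 2 * v i ≤ V ^ 2) (hV0 : 0 ≤ V) {p : ℝ≥0∞} (hp : 1 ≤ p) :
    eLpNorm (fun ω => ∑ i ∈ Finset.range N, (c i * ζ i ω) • e i) (2 * p) P ≤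
      ENNReal.ofReal V * gaussianNorm (2 * p) := by
  have h1 : eLpNorm (fun ω => ∑ i ∈ Finset.range N, (c i * ζ i ω) • e i) (2 * p) P ^ 2 ≤
      (ENNReal.ofReal V * gaussianNorm (2 * p)) ^ 2 := by
    rw [← eLpNorm_norm_sq]
    have h2 : (fun ω => ‖∑ i ∈ Finset.range N, (c i * ζ i ω) • e i‖ ^ 2) =
        ∑ i ∈ Finset.range N, (c i ^ 2) • fun ω => ‖ζ i ω‖ ^ 2 := by
      ext ω
      simp [norm_sum_sq, mul_pow]
    rw [h2]
    have hae : ∀ i ∈ Finset.range N,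
        AEStronglyMeasurable ((c i ^ 2) • fun ω => ‖ζ i ω‖ ^ 2) P := fun i hi => by
      have := (hζ i (Finset.mem_range.1 hi)).aemeasurable
      exact ((this.norm.pow_const 2).aestronglyMeasurable).const_smul _
    -- Minkowski is applied to the squared coordinates, so no independence between coordinates is
    -- required and the bound depends only on the total variance, not on `N`.
    calc eLpNorm (∑ i ∈ Finset.range N, (c i ^ 2) • fun ω => ‖ζ i ω‖ ^ 2) p P
        ≤ ∑ i ∈ Finset.range N, eLpNorm ((c i ^ 2) • fun ω => ‖ζ i ω‖ ^ 2) p P :=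
          eLpNorm_sum_le hae hp
      _ = ∑ i ∈ Finset.range N, ENNReal.ofReal (c i ^ 2 * v i) * gaussianNorm (2 * p) ^ 2 := by
          refine Finset.sum_congr rfl fun i hi => ?_
          rw [eLpNorm_const_smul, eLpNorm_norm_sq,
            eLpNorm_eq_of_hasLaw_gaussianReal (hζ i (Finset.mem_range.1 hi)),
            Real.enorm_of_nonneg (sq_nonneg _), mul_pow, ← ENNReal.ofReal_pow (Real.sqrt_nonneg _),
            Real.sq_sqrt (v i).coe_nonneg, ENNReal.ofReal_mul (sq_nonneg _), mul_assoc]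
      _ = ENNReal.ofReal (∑ i ∈ Finset.range N, c i ^ 2 * v i) * gaussianNorm (2 * p) ^ 2 := by
          rw [← Finset.sum_mul, ENNReal.ofReal_sum_of_nonneg fun i _ => by positivity]
      _ ≤ (ENNReal.ofReal V * gaussianNorm (2 * p)) ^ 2 := by
          rw [mul_pow, ← ENNReal.ofReal_pow hV0]
          gcongr
  exact (ENNReal.pow_le_pow_left_iff two_ne_zero).1 h1

end Gaussian

/-! ### The time grid -/

/-- The grid point `kτ`, moved to the interval `[s, t]`. -/
def gridTime (τ s t : ℝ≥0) (k : ℕ) : ℝ≥0 := max s (min t (k * τ))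

section Grid

variable {τ s t : ℝ≥0}

lemma gridTime_mono (τ s t : ℝ≥0) : Monotone (gridTime τ s t) := fun i j hij => by
  unfold gridTime
  gcongr

lemma gridTime_zero (τ s t : ℝ≥0) : gridTime τ s t 0 = s := by simp [gridTime]

lemma gridTime_le (hst : s ≤ t) (k : ℕ) : gridTime τ s t k ≤ t :=
  max_le hst (min_le_left _ _)

lemma gridTime_eq_of_lt {k : ℕ} (hst : s ≤ t) (h : t < k * τ) : gridTime τ s t k = t := by
  rw [gridTime, min_eq_left h.le, max_eq_right hst]

/-- Cells outside `[s,t]` collapse to a point, so a cell of positive length starts at or after its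
grid point `kτ`. Hence the frozen semigroup time `t - kτ` is at least the true remaining time. -/
lemma mul_le_gridTime {k : ℕ} (hst : s ≤ t) (h : gridTime τ s t k < gridTime τ s t (k + 1)) :
    k * τ ≤ gridTime τ s t k := by
  by_contra! h1
  rcases le_or_gt (k * τ) t with h2 | h2
  · rw [gridTime, min_eq_right h2] at h1
    exact absurd (le_max_right _ _) (not_le.2 h1)
  · rw [gridTime_eq_of_lt hst h2] at h
    exact absurd (gridTime_le hst _) (not_le.2 h)

lemma gridTime_step_nonneg (k : ℕ) :
    0 ≤ (gridTime τ s t (k + 1) : ℝ) - gridTime τ s t k :=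
  sub_nonneg.2 (gridTime_mono τ s t k.le_succ)

lemma sum_gridTime_step_le (hst : s ≤ t) (n : ℕ) :
    ∑ k ∈ Finset.range n, ((gridTime τ s t (k + 1) : ℝ) - gridTime τ s t k) ≤ t - s := by
  rw [Finset.sum_range_sub fun k => (gridTime τ s t k : ℝ), gridTime_zero]
  have : (gridTime τ s t n : ℝ) ≤ t := gridTime_le hst n
  linarith

/-- Comparison with `∫ₛᵗ e^{-2l(t-u)} du`: freezing the exponent at the left grid point only
decreases the integrand, so each term is below an increment of the primitive `Φ`, and the sum
telescopes. -/
lemma sum_exp_sq_gridTime_le (hst : s ≤ t) {l : ℝ} (hl : 0 < l) (n : ℕ) :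
    ∑ k ∈ Finset.range n, Real.exp (-l * (t - k * τ)) ^ 2 *
      ((gridTime τ s t (k + 1) : ℝ) - gridTime τ s t k) ≤
      (1 - Real.exp (-(2 * l * (t - s)))) / (2 * l) := by
  set Φ : ℕ → ℝ := fun k => Real.exp (-(2 * l * (t - gridTime τ s t k))) / (2 * l) with hΦ
  have h1 : ∀ k ∈ Finset.range n, Real.exp (-l * (t - k * τ)) ^ 2 *
      ((gridTime τ s t (k + 1) : ℝ) - gridTime τ s t k) ≤ Φ (k + 1) - Φ k := by
    intro k _
    rcases (gridTime_mono τ s t k.le_succ).eq_or_lt with h | h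
    · simp only [Nat.succ_eq_add_one] at h
      simp [hΦ, h]
    · have h2 : (k : ℝ) * τ ≤ gridTime τ s t k := by exact_mod_cast mul_le_gridTime hst h
      simp only [hΦ]
      rw [← sub_div, le_div_iff₀ (by positivity), sq, ← Real.exp_add]
      set u : ℝ := (gridTime τ s t k : ℝ)
      set w : ℝ := (gridTime τ s t (k + 1) : ℝ)
      have h3 : Real.exp (-(2 * l * (t - w))) =
          Real.exp (-(2 * l * (t - u))) * Real.exp (2 * l * (w - u)) := by
        rw [← Real.exp_add]; congr 1; ring
      have h4 := Real.add_one_le_exp (2 * l * (w - u))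
      have h5 : Real.exp (-l * (t - k * τ) + -l * (t - k * τ)) ≤
          Real.exp (-(2 * l * (t - u))) := by
        rw [Real.exp_le_exp]
        nlinarith
      have h6 : 0 ≤ w - u := gridTime_step_nonneg k
      calc _ ≤ Real.exp (-(2 * l * (t - u))) * (w - u) * (2 * l) := by gcongr
        _ ≤ Real.exp (-(2 * l * (t - u))) * (Real.exp (2 * l * (w - u)) - 1) := by
            rw [mul_assoc]
            gcongr
            linarith
        _ = _ := by rw [h3]; ring
  refine (Finset.sum_le_sum h1).trans ?_
  rw [Finset.sum_range_sub Φ, ← sub_div]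
  simp only [gridTime_zero]
  gcongr
  rw [Real.exp_le_one_iff]
  have : (gridTime τ s t n : ℝ) ≤ t := gridTime_le hst n
  have := mul_nonneg (mul_nonneg two_pos.le hl.le) (sub_nonneg.2 this)
  linarith

/-! ### Smoothing of the semigroup and its integrable singularity. -/

lemma exp_neg_mul_one_add_sq_le (a : ℝ) : Real.exp (-a ^ 2) * (1 + a) ^ 2 ≤ 2 := by
  have h1 := Real.add_one_le_exp (a ^ 2)
  rw [Real.exp_neg, inv_mul_le_iff₀ (Real.exp_pos _)]
  nlinarith [sq_nonneg (1 - a)]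

/-- Half of the exponent absorbs `√(lv)`; the other half still decays at least like `e^{-v}` because
`l/2 ≥ 1`. Keeping this decay makes later bounds uniform in time. -/
lemma sqrt_mul_exp_le {l v : ℝ} (hl : 1 ≤ l / 2) (hv : 0 < v) :
    √l * Real.exp (-l * v) ≤ Real.exp (-v) / √v := by
  have hl0 : 0 ≤ l := by linarith
  rw [le_div_iff₀ (Real.sqrt_pos.2 hv), mul_right_comm, ← Real.sqrt_mul hl0]
  have h1 : √(l * v) ≤ Real.exp (l * v / 2) := by
    have h2 := Real.add_one_le_exp (l * v / 2)
    have h3 := Real.sq_sqrt (mul_nonneg hl0 hv.le)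
    nlinarith [sq_nonneg (√(l * v) - 1)]
  calc √(l * v) * Real.exp (-l * v) ≤ Real.exp (l * v / 2) * Real.exp (-l * v) := by gcongr
    _ = Real.exp (-(l / 2 * v)) := by rw [← Real.exp_add]; congr 1; ring
    _ ≤ Real.exp (-v) := by
        rw [Real.exp_le_exp]
        nlinarith

/-- A bounded increasing function whose derivative dominates `u ↦ u^{-1/2} e^{-u} / 4`. -/
def smoothingPotential (u : ℝ) : ℝ := √u / (1 + √u)

/-- With `a = √v` and `b = √(v-h)`, both sides carry the factor `a - b`, since `h = a² - b²`. What
remains is the boundedness of `e^{-a²}(1+a)²`. This integrates the singular kernel without any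
integral. -/
lemma mul_exp_div_sqrt_le {v h : ℝ} (hv : 0 < v) (h0 : 0 ≤ h) (hh : h ≤ v) :
    h * (Real.exp (-v) / √v) ≤ 4 * (smoothingPotential v - smoothingPotential (v - h)) := by
  have ha : 0 < √v := Real.sqrt_pos.2 hv
  have hb : 0 ≤ √(v - h) := Real.sqrt_nonneg _
  have hab : √(v - h) ≤ √v := Real.sqrt_le_sqrt (by linarith)
  have ha2 := Real.sq_sqrt hv.le
  have hb2 := Real.sq_sqrt (sub_nonneg.2 hh)
  have h1 := exp_neg_mul_one_add_sq_le √v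
  rw [ha2] at h1
  set a := √v
  set b := √(v - h)
  have h2 : smoothingPotential v - smoothingPotential (v - h) = (a - b) / ((1 + a) * (1 + b)) := by
    rw [smoothingPotential, smoothingPotential]
    change a / (1 + a) - b / (1 + b) = _
    field_simp
    ring
  have h3 : h = (a - b) * (a + b) := by linear_combination hb2 - ha2
  rw [h2, mul_div_assoc', mul_div_assoc', div_le_div_iff₀ ha (by positivity)]
  have h4 : 0 ≤ a - b := sub_nonneg.2 hab
  have h5 : Real.exp (-v) * ((1 + a) * (1 + b)) ≤ 2 := by
    refine le_trans ?_ h1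
    rw [sq]
    gcongr
  calc h * Real.exp (-v) * ((1 + a) * (1 + b))
      = (a - b) * (a + b) * (Real.exp (-v) * ((1 + a) * (1 + b))) := by rw [h3]; ring
    _ ≤ (a - b) * (a + a) * 2 := by gcongr
    _ = 4 * (a - b) * a := by ring

/-- One cell of the drift integral in `Dom((-A)^{β/2})`. Since `β ≤ 1`, the smoothing cost is at
most the square-root singularity, and the bound telescopes over the cells. -/
lemma gridTime_step_mul_norm_le (hst : s ≤ t) {β : ℝ} (hβ1 : β ≤ 1) (N k : ℕ) (x : H) :
    ((gridTime τ s t (k + 1) : ℝ) - gridTime τ s t k) *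
        ‖galerkinPow N β (galerkinSemigroup N (t - k * τ) x)‖ ≤
      4 * (smoothingPotential (t - gridTime τ s t k) -
        smoothingPotential (t - gridTime τ s t (k + 1))) * ‖x‖ := by
  rcases (gridTime_mono τ s t k.le_succ).eq_or_lt with h | h
  · simp only [Nat.succ_eq_add_one] at h
    simp [h]
  · have h2 : (k : ℝ) * τ ≤ gridTime τ s t k := by exact_mod_cast mul_le_gridTime hst h
    have h3 : (gridTime τ s t k : ℝ) < gridTime τ s t (k + 1) := by exact_mod_cast h
    have h4 : (gridTime τ s t (k + 1) : ℝ) ≤ t := gridTime_le hst _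
    have hv : 0 < (t : ℝ) - gridTime τ s t k := by linarith
    have h5 := mul_exp_div_sqrt_le (h := (gridTime τ s t (k + 1) : ℝ) - gridTime τ s t k) hv
      (by linarith) (by linarith)
    rw [sub_sub_sub_cancel_right] at h5
    refine le_trans ?_ (mul_le_mul_of_nonneg_right h5 (norm_nonneg x))
    rw [mul_assoc]
    refine mul_le_mul_of_nonneg_left ?_ (by linarith)
    rw [galerkinPow, galerkinSemigroup_eq, multiplier_multiplier]
    refine norm_multiplier_le (by positivity) (fun i _ => ?_) x
    have hp : 0 ≤ eigval i ^ (β / 2) := Real.rpow_nonneg (eigval_pos i).le _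
    rw [abs_of_nonneg (by positivity)]
    refine le_trans ?_ (sqrt_mul_exp_le (l := eigval i) ?_ hv)
    · refine mul_le_mul ?_ ?_ (Real.exp_pos _).le (Real.sqrt_nonneg _)
      · rw [Real.sqrt_eq_rpow]
        exact Real.rpow_le_rpow_of_exponent_le (one_le_eigval i) (by linarith)
      · rw [Real.exp_le_exp]
        nlinarith [eigval_pos i]
    · have := eigval_zero_le i
      have := one_le_eigval_zero_div_two
      linarith

/-- The potential takes values in `[0,1]`, so the total smoothing cost is independent of the time
horizon. -/
lemma sum_smoothingPotential_le (τ s t : ℝ≥0) (n : ℕ) :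
    ∑ k ∈ Finset.range n, 4 * (smoothingPotential (t - gridTime τ s t k) -
        smoothingPotential (t - gridTime τ s t (k + 1))) ≤ 4 := by
  rw [← Finset.mul_sum, Finset.sum_range_sub' fun k => smoothingPotential (t - gridTime τ s t k)]
  have h1 : ∀ u, smoothingPotential u ≤ 1 := fun u => by
    rw [smoothingPotential, div_le_one (by positivity)]
    linarith
  have h2 : ∀ u, 0 ≤ smoothingPotential u := fun u => by
    rw [smoothingPotential]
    positivity
  have := h1 (t - gridTime τ s t 0)
  have := h2 (t - gridTime τ s t n)
  linarith

lemma smoothingPotential_mono : Monotone smoothingPotential := fun u v huv => by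
  have := Real.sqrt_le_sqrt huv
  have := Real.sqrt_nonneg u
  rw [smoothingPotential, smoothingPotential, div_le_div_iff₀ (by positivity) (by positivity)]
  nlinarith

end Grid

/-! ### The noise in coordinates and the mild formulation -/

section Mild

variable {Ω : Type*}

lemma galerkinNoise_eq {R : H →L[ℝ] H} {σ : ℕ → ℝ} (hσ : ∀ i, R (e i) = σ i • e i) (N : ℕ)
    (b : ℕ → ℝ≥0 → Ω → ℝ) (t : ℝ≥0) (ω : Ω) :
    galerkinNoise N R b t ω = ∑ i ∈ Finset.range N, (σ i * b i t ω) • e i := by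
  have h1 : ∀ j, galerkinProj N (R (e j)) = if j ∈ Finset.range N then σ j • e j else 0 := by
    intro j
    simp [galerkinProj, hσ, inner_smul_right, inner_e_e]
  rw [galerkinNoise, tsum_eq_sum (s := Finset.range N) fun j hj => by
    rw [h1, if_neg hj, smul_zero]]
  refine Finset.sum_congr rfl fun j hj => ?_
  rw [h1, if_pos hj, smul_smul, mul_comm]

/-- The stochastic convolution `∫ₛᵗ S^N(t-⌊u⌋) P^N dW(u)`, for `t ≤ n τ`. -/
def stochConv (N : ℕ) (τ : ℝ≥0) (R : H →L[ℝ] H) (b : ℕ → ℝ≥0 → Ω → ℝ) (s t : ℝ≥0) (n : ℕ)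
    (ω : Ω) : H :=
  ∑ k ∈ Finset.range n, galerkinSemigroup N (t - k * τ)
    (galerkinNoise N R b (gridTime τ s t (k + 1)) ω - galerkinNoise N R b (gridTime τ s t k) ω)

/-- The drift convolution `∫ₛᵗ S^N(t-⌊u⌋) F^N(X_⌊u⌋) du`, for `t ≤ n τ`. -/
def driftConv (N : ℕ) (τ : ℝ≥0) (F : H → H) (X : ℕ → Ω → H) (s t : ℝ≥0) (n : ℕ) (ω : Ω) : H :=
  ∑ k ∈ Finset.range n, ((gridTime τ s t (k + 1) : ℝ) - gridTime τ s t k) •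
    galerkinSemigroup N (t - k * τ) (F (X k ω))

lemma stochConv_eq {R : H →L[ℝ] H} {σ : ℕ → ℝ} (hσ : ∀ i, R (e i) = σ i • e i) (N : ℕ) (τ : ℝ≥0)
    (b : ℕ → ℝ≥0 → Ω → ℝ) (s t : ℝ≥0) (n : ℕ) (ω : Ω) :
    stochConv N τ R b s t n ω = ∑ i ∈ Finset.range N, (σ i * ∑ k ∈ Finset.range n,
      Real.exp (-eigval i * (t - k * τ)) *
        (b i (gridTime τ s t (k + 1)) ω - b i (gridTime τ s t k) ω)) • e i := by
  simp_rw [Finset.mul_sum, Finset.sum_smul]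
  rw [Finset.sum_comm, stochConv]
  refine Finset.sum_congr rfl fun k _ => ?_
  rw [galerkinNoise_eq hσ, galerkinNoise_eq hσ, ← Finset.sum_sub_distrib]
  simp_rw [← sub_smul]
  rw [galerkinSemigroup_eq, multiplier_sum]
  refine Finset.sum_congr rfl fun i _ => ?_
  congr 1
  ring

/-- The integrand is constant on the interior of each grid cell. Any `n` with `t ≤ nτ` is allowed,
as surplus cells have length zero; this permits the same `n` for two different times. -/
lemma integral_step {τ t : ℝ≥0} (hτ : 0 < τ) {n : ℕ} (hn : t ≤ n * τ) (f : ℕ → H) :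
    ∫ s in (0 : ℝ)..t, galerkinSemigroup N (t - ⌊s / τ⌋₊ * τ) (f ⌊s / τ⌋₊) =
      ∑ k ∈ Finset.range n, ((gridTime τ 0 t (k + 1) : ℝ) - gridTime τ 0 t k) •
        galerkinSemigroup N (t - k * τ) (f k) := by
  have hτ' : (0 : ℝ) < τ := hτ
  have hcongr : ∀ k : ℕ, EqOn
      (fun s : ℝ => galerkinSemigroup N (t - ⌊s / τ⌋₊ * τ) (f ⌊s / τ⌋₊))
      (fun _ => galerkinSemigroup N (t - k * τ) (f k))
      (uIoo (gridTime τ 0 t k : ℝ) (gridTime τ 0 t (k + 1))) := by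
    intro k s hs
    have hmono : (gridTime τ 0 t k : ℝ) ≤ gridTime τ 0 t (k + 1) := gridTime_mono τ 0 t k.le_succ
    rw [uIoo_of_le hmono] at hs
    have h1 : (k : ℝ) * τ ≤ gridTime τ 0 t k := by
      exact_mod_cast mul_le_gridTime (zero_le) (by exact_mod_cast hs.1.trans hs.2)
    have h2 : (gridTime τ 0 t (k + 1) : ℝ) ≤ (k + 1 : ℕ) * τ := by
      have : gridTime τ 0 t (k + 1) ≤ (k + 1 : ℕ) * τ :=
        max_le (zero_le) (min_le_right _ _)
      exact_mod_cast this
    have h3 : ⌊s / τ⌋₊ = k := by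
      have hk : (k : ℝ) * τ < s := h1.trans_lt hs.1
      have hs0 : 0 ≤ s := le_trans (by positivity) hk.le
      rw [Nat.floor_eq_iff (by positivity), le_div_iff₀ hτ', div_lt_iff₀ hτ']
      refine ⟨hk.le, hs.2.trans_le (h2.trans (le_of_eq ?_))⟩
      push_cast; ring
    simp only [h3]
  have hsum := intervalIntegral.sum_integral_adjacent_intervals (μ := volume)
    (f := fun s : ℝ => galerkinSemigroup N (t - ⌊s / τ⌋₊ * τ) (f ⌊s / τ⌋₊))
    (a := fun k => (gridTime τ 0 t k : ℝ)) (n := n)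
    fun k _ => (intervalIntegrable_congr_uIoo (hcongr k)).2 intervalIntegrable_const
  have hn' : gridTime τ 0 t n = t := by
    rw [gridTime, min_eq_left hn, max_eq_right (zero_le)]
  rw [gridTime_zero, hn', NNReal.coe_zero] at hsum
  rw [← hsum]
  refine Finset.sum_congr rfl fun k _ => ?_
  rw [intervalIntegral.integral_congr_uIoo (hcongr k), intervalIntegral.integral_const]

lemma contScheme_eq {τ t : ℝ≥0} (hτ : 0 < τ) {n : ℕ} (hn : t ≤ n * τ) (N : ℕ) (F : H → H)
    (R : H →L[ℝ] H) (b : ℕ → ℝ≥0 → Ω → ℝ) (X₀ : Ω → H) (ω : Ω) :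
    contScheme N τ F R b X₀ t ω = galerkinSemigroup N t (galerkinProj N (X₀ ω)) +
      driftConv N τ F (scheme N τ F R b X₀) 0 t n ω + stochConv N τ R b 0 t n ω := by
  rw [contScheme, integral_step hτ hn fun k => galerkinProj N (F (scheme N τ F R b X₀ k ω))]
  simp_rw [galerkinSemigroup_galerkinProj N _ (F _)]
  congr 1
  -- The cells between `⌈t/τ⌉₊` and `n` have both endpoints equal to `t` and contribute nothing.
  have hceil : ⌈t / τ⌉₊ ≤ n := Nat.ceil_le.2 ((div_le_iff₀ hτ).2 hn)
  rw [stochConv, ← Finset.sum_subset (Finset.range_mono hceil)]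
  · refine Finset.sum_congr rfl fun k hk => ?_
    have hk' : k * τ ≤ t := by
      have := Nat.lt_ceil.1 (Finset.mem_range.1 hk)
      exact ((lt_div_iff₀ hτ).1 this).le
    rw [gridTime, gridTime, max_eq_right (zero_le), max_eq_right (zero_le),
      min_eq_right hk']
  · intro k _ hk
    have hk' : t ≤ k * τ := by
      rw [Finset.mem_range, not_lt] at hk
      exact (div_le_iff₀ hτ).1 (Nat.ceil_le.1 hk)
    have hk'' : t ≤ (k + 1 : ℕ) * τ := hk'.trans (by gcongr; simp)
    rw [gridTime, gridTime, min_eq_left hk', min_eq_left hk'', sub_self]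
    simp [galerkinSemigroup]

lemma apply_max_min {E : Type*} [AddCommGroup E] (f : ℝ≥0 → E) {s t : ℝ≥0} (hst : s ≤ t)
    (x : ℝ≥0) : f (max s (min t x)) = f (min t x) - f (min s x) + f s := by
  rcases le_total x s with h | h
  · rw [min_eq_right (h.trans hst), min_eq_right h, max_eq_left h]; abel
  · rw [min_eq_left h, max_eq_right (le_min hst h)]; abel

/-- Clipping a cell to `[s,t]` is clipping to `[0,t]` minus clipping to `[0,s]`. Applied to time and
to the noise, it yields the mild formulation started at `s` by subtraction, even when `s` is not a
grid point. -/
lemma apply_gridTime_sub {E : Type*} [AddCommGroup E] (f : ℝ≥0 → E) (τ : ℝ≥0) {s t : ℝ≥0}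
    (hst : s ≤ t) (k : ℕ) : f (gridTime τ s t (k + 1)) - f (gridTime τ s t k) =
      (f (gridTime τ 0 t (k + 1)) - f (gridTime τ 0 t k)) -
        (f (gridTime τ 0 s (k + 1)) - f (gridTime τ 0 s k)) := by
  simp only [gridTime, max_eq_right (zero_le : (0 : ℝ≥0) ≤ _)]
  rw [apply_max_min f hst, apply_max_min f hst]
  abel

/-- The mild formulation on the interval `[s, t]`. -/
lemma contScheme_sub_eq {τ s t : ℝ≥0} (hτ : 0 < τ) (hst : s ≤ t) {n : ℕ} (hn : t ≤ n * τ) (N : ℕ)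
    (F : H → H) (R : H →L[ℝ] H) (b : ℕ → ℝ≥0 → Ω → ℝ) (X₀ : Ω → H) (ω : Ω) :
    contScheme N τ F R b X₀ t ω = galerkinSemigroup N (t - s) (contScheme N τ F R b X₀ s ω) +
      driftConv N τ F (scheme N τ F R b X₀) s t n ω + stochConv N τ R b s t n ω := by
  have hadd : ∀ (r : ℝ) x y, galerkinSemigroup N r (x + y) =
      galerkinSemigroup N r x + galerkinSemigroup N r y := fun r x y => by
    simp only [galerkinSemigroup_eq, map_add]
  have hsub : ∀ (r : ℝ) x y, galerkinSemigroup N r (x - y) =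
      galerkinSemigroup N r x - galerkinSemigroup N r y := fun r x y => by
    simp only [galerkinSemigroup_eq, map_sub]
  have hD : driftConv N τ F (scheme N τ F R b X₀) s t n ω =
      driftConv N τ F (scheme N τ F R b X₀) 0 t n ω -
        galerkinSemigroup N (t - s) (driftConv N τ F (scheme N τ F R b X₀) 0 s n ω) := by
    simp only [driftConv]
    rw [galerkinSemigroup_eq, map_sum, ← Finset.sum_sub_distrib]
    refine Finset.sum_congr rfl fun k _ => ?_
    rw [map_smul, ← galerkinSemigroup_eq, galerkinSemigroup_galerkinSemigroup, sub_add_sub_cancel,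
      ← sub_smul, apply_gridTime_sub (fun r => (r : ℝ)) τ hst k]
  have hZ : stochConv N τ R b s t n ω = stochConv N τ R b 0 t n ω -
        galerkinSemigroup N (t - s) (stochConv N τ R b 0 s n ω) := by
    simp only [stochConv]
    rw [galerkinSemigroup_eq, map_sum, ← Finset.sum_sub_distrib]
    refine Finset.sum_congr rfl fun k _ => ?_
    rw [← galerkinSemigroup_eq, galerkinSemigroup_galerkinSemigroup, sub_add_sub_cancel,
      ← hsub, apply_gridTime_sub (fun r => galerkinNoise N R b r ω) τ hst k]
  rw [contScheme_eq hτ hn, contScheme_eq hτ (hst.trans hn), hD, hZ, hadd, hadd,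
    galerkinSemigroup_galerkinSemigroup, sub_add_cancel]
  abel

lemma galerkinProj_contScheme {τ : ℝ≥0} (hτ : 0 < τ) (N : ℕ) (F : H → H)
    (R : H →L[ℝ] H) (b : ℕ → ℝ≥0 → Ω → ℝ) (X₀ : Ω → H) (t : ℝ≥0) (ω : Ω) :
    galerkinProj N (contScheme N τ F R b X₀ t ω) = contScheme N τ F R b X₀ t ω := by
  obtain ⟨n, hn⟩ := exists_nat_ge (t / τ)
  rw [contScheme_eq hτ ((div_le_iff₀ hτ).1 hn), driftConv, stochConv, galerkinProj_eq, map_add,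
    map_add, map_sum, map_sum]
  simp only [map_smul, ← galerkinProj_eq, galerkinProj_galerkinSemigroup]

/-! ### The stochastic convolution on the grid -/

lemma gridTime_grid (τ : ℝ≥0) {j k : ℕ} (h : j ≤ k) : gridTime τ 0 (k * τ) j = j * τ := by
  rw [gridTime, max_eq_right (zero_le), min_eq_right]
  gcongr

/-- The stochastic convolution at the grid point `kτ`. -/
abbrev gridStochConv (N : ℕ) (τ : ℝ≥0) (R : H →L[ℝ] H) (b : ℕ → ℝ≥0 → Ω → ℝ) (k : ℕ) : Ω → H :=
  stochConv N τ R b 0 (k * τ) k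

lemma gridStochConv_eq (N : ℕ) (τ : ℝ≥0) (R : H →L[ℝ] H) (b : ℕ → ℝ≥0 → Ω → ℝ) (k : ℕ) (ω : Ω) :
    gridStochConv N τ R b k ω = ∑ j ∈ Finset.range k, galerkinSemigroup N (k * τ - j * τ)
      (noiseIncrement N τ R b j ω) := by
  rw [gridStochConv, stochConv]
  refine Finset.sum_congr rfl fun j hj => ?_
  rw [gridTime_grid τ (Finset.mem_range.1 hj), gridTime_grid τ (Finset.mem_range.1 hj).le,
    noiseIncrement]
  push_cast
  rfl

lemma gridStochConv_succ (N : ℕ) (τ : ℝ≥0) (R : H →L[ℝ] H) (b : ℕ → ℝ≥0 → Ω → ℝ) (k : ℕ) (ω : Ω) :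
    gridStochConv N τ R b (k + 1) ω =
      galerkinSemigroup N τ (gridStochConv N τ R b k ω + noiseIncrement N τ R b k ω) := by
  rw [gridStochConv_eq, gridStochConv_eq, Finset.sum_range_succ, galerkinSemigroup_eq N τ, map_add,
    map_sum]
  simp only [← galerkinSemigroup_eq, galerkinSemigroup_galerkinSemigroup]
  congr 1
  · refine Finset.sum_congr rfl fun j _ => ?_
    congr 1
    push_cast; ring
  · congr 1
    push_cast; ring

/-- The noise increment enters chain and convolution identically and cancels, leaving a pathwise
recursion without a noise increment. -/
lemma scheme_sub_gridStochConv_succ (N : ℕ) (τ : ℝ≥0) (F : H → H) (R : H →L[ℝ] H)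
    (b : ℕ → ℝ≥0 → Ω → ℝ) (X₀ : Ω → H) (k : ℕ) (ω : Ω) :
    scheme N τ F R b X₀ (k + 1) ω - gridStochConv N τ R b (k + 1) ω =
      galerkinSemigroup N τ ((scheme N τ F R b X₀ k ω - gridStochConv N τ R b k ω) +
        (τ : ℝ) • F ((scheme N τ F R b X₀ k ω - gridStochConv N τ R b k ω) +
          gridStochConv N τ R b k ω)) := by
  rw [scheme, gridStochConv_succ, schemeStep_eq, sub_add_cancel]
  simp only [galerkinSemigroup_eq, ← map_sub]
  congr 1
  abel

end Mild

/-! ### Moment estimates -/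

lemma one_sub_exp_neg_le_rpow {x r : ℝ} (hx : 0 ≤ x) (hr0 : 0 ≤ r) (hr1 : r ≤ 1) :
    1 - Real.exp (-x) ≤ x ^ r := by
  rcases le_or_gt x 1 with h | h
  · have h1 := Real.add_one_le_exp (-x)
    have h2 : x ^ (1 : ℝ) ≤ x ^ r := by
      rcases hx.eq_or_lt with rfl | h0
      · rw [Real.zero_rpow one_ne_zero]
        exact Real.rpow_nonneg le_rfl _
      · exact Real.rpow_le_rpow_of_exponent_ge h0 h hr1
    rw [Real.rpow_one] at h2
    linarith
  · have := Real.exp_pos (-x)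
    have := Real.one_le_rpow h.le hr0
    linarith

/-- The noise has the diagonal covariance operator `R² = diag(σᵢ²)`, with a quantitative bound, and
all assumptions on drift, noise, and step size hold. -/
structure Setting {Ω : Type*} [mΩ : MeasurableSpace Ω] (K L B M β : ℝ) (F : H → H)
    (R : H →L[ℝ] H) (σ : ℕ → ℝ) (P : Measure Ω) (ℱ : Filtration ℝ≥0 mΩ) (b : ℕ → ℝ≥0 → Ω → ℝ)
    (N : ℕ) (τ : ℝ≥0) : Prop where
  drift : DriftAssumption F K L
  drift_zero : ‖F 0‖ ≤ B
  beta_pos : 0 < β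
  beta_le_one : β ≤ 1
  diagonal : ∀ i, R (e i) = σ i • e i
  noise_le : ∑ i ∈ Finset.range N, eigval i ^ (β - 1) * σ i ^ 2 ≤ M ^ 2
  brownian : IsBrownianFamily P ℱ b
  step_pos : 0 < τ
  step_lt : (τ : ℝ) < 1 / 2
  step_le : (τ : ℝ) ≤ (eigval 0 - K) / (4 * L ^ 2)

/-- Bound for the moments of the stochastic convolution in `Dom((-A)^{β/2})`. -/
def noiseBound (M : ℝ) (p : ℝ≥0∞) : ℝ≥0∞ := ENNReal.ofReal |M| * gaussianNorm (2 * p)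

/-- Bound for the moments of `F` along the stochastic convolution. -/
def driftBound (L B M : ℝ) (p : ℝ≥0∞) : ℝ≥0∞ :=
  ENNReal.ofReal B + ENNReal.ofReal L * noiseBound M p

/-- Bound for the moments of the scheme with vanishing initial value. -/
def schemeBound (K L B M : ℝ) (p : ℝ≥0∞) : ℝ≥0∞ :=
  ENNReal.ofReal √((1 + 4 / (eigval 0 - K)) * ((1 + (eigval 0 - K)) / (eigval 0 - K))) *
    driftBound L B M p + noiseBound M p

lemma noiseBound_ne_top (M : ℝ) {p : ℝ≥0∞} (hp : p ≠ ∞) : noiseBound M p ≠ ∞ :=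
  ENNReal.mul_ne_top ENNReal.ofReal_ne_top
    (gaussianNorm_lt_top (ENNReal.mul_ne_top (by norm_num) hp)).ne

lemma driftBound_ne_top (L B M : ℝ) {p : ℝ≥0∞} (hp : p ≠ ∞) : driftBound L B M p ≠ ∞ :=
  ENNReal.add_ne_top.2 ⟨ENNReal.ofReal_ne_top,
    ENNReal.mul_ne_top ENNReal.ofReal_ne_top (noiseBound_ne_top M hp)⟩

lemma schemeBound_ne_top (K L B M : ℝ) {p : ℝ≥0∞} (hp : p ≠ ∞) : schemeBound K L B M p ≠ ∞ :=
  ENNReal.add_ne_top.2 ⟨ENNReal.mul_ne_top ENNReal.ofReal_ne_top (driftBound_ne_top L B M hp),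
    noiseBound_ne_top M hp⟩

instance : SecondCountableTopology H :=
  haveI : Fact ((2 : ℝ≥0∞) ≠ ∞) := ⟨by norm_num⟩
  inferInstanceAs (SecondCountableTopology (Lp ℝ 2 (volume.restrict (Ioo (0 : ℝ) 1))))

lemma measurable_schemeStep (N : ℕ) (τ : ℝ≥0) {F : H → H} (hF : Continuous F) :
    Measurable fun z : H × H => schemeStep N τ F z.1 z.2 := by
  refine Continuous.measurable ?_
  simp only [schemeStep_eq, galerkinSemigroup_eq]
  fun_prop

lemma measurable_galerkinProj (N : ℕ) : Measurable (galerkinProj N) := by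
  have : galerkinProj N = multiplier N 1 := funext (galerkinProj_eq N)
  rw [this]
  exact (multiplier N 1).continuous.measurable

lemma measurable_galerkinSemigroup (N : ℕ) (t : ℝ) : Measurable (galerkinSemigroup N t) := by
  have : galerkinSemigroup N t = multiplier N fun i => Real.exp (-eigval i * t) :=
    funext (galerkinSemigroup_eq N t)
  rw [this]
  exact ContinuousLinearMap.measurable _

namespace Setting

variable {Ω : Type*} {mΩ : MeasurableSpace Ω} {K L B M β : ℝ} {F : H → H} {R : H →L[ℝ] H}
  {σ : ℕ → ℝ} {P : Measure Ω} {ℱ : Filtration ℝ≥0 mΩ} {b : ℕ → ℝ≥0 → Ω → ℝ} {N : ℕ} {τ : ℝ≥0}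

lemma measurable_galerkinNoise_filtration (h : Setting K L B M β F R σ P ℱ b N τ) (t : ℝ≥0) :
    Measurable[ℱ t] (galerkinNoise N R b t) := by
  have : galerkinNoise N R b t =
      fun ω => ∑ i ∈ Finset.range N, (σ i * b i t ω) • e i :=
    funext fun ω => galerkinNoise_eq h.diagonal N b t ω
  rw [this]
  refine Finset.measurable_fun_sum _ fun i _ => ?_
  exact (((h.brownian.adapted i t).const_mul _).smul_const _)

lemma measurable_galerkinNoise (h : Setting K L B M β F R σ P ℱ b N τ) (t : ℝ≥0) :
    Measurable (galerkinNoise N R b t) :=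
  (h.measurable_galerkinNoise_filtration t).mono (ℱ.le t) le_rfl

lemma measurable_noiseIncrement (h : Setting K L B M β F R σ P ℱ b N τ) (k : ℕ) :
    Measurable (noiseIncrement N τ R b k) := by
  have h1 := h.measurable_galerkinNoise ((k + 1 : ℕ) * τ)
  have h2 := h.measurable_galerkinNoise (k * τ)
  exact h1.sub h2

lemma measurable_stochConv (h : Setting K L B M β F R σ P ℱ b N τ) (s t : ℝ≥0) (n : ℕ) :
    Measurable (stochConv N τ R b s t n) := by
  unfold stochConv
  refine Finset.measurable_fun_sum _ fun k _ => ?_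
  exact (measurable_galerkinSemigroup N _).comp
    ((h.measurable_galerkinNoise _).sub (h.measurable_galerkinNoise _))

lemma measurable_scheme (h : Setting K L B M β F R σ P ℱ b N τ) {X₀ : Ω → H} (hX : Measurable X₀)
    (k : ℕ) : Measurable (scheme N τ F R b X₀ k) := by
  induction k with
  | zero => exact (measurable_galerkinProj N).comp hX
  | succ k ih =>
    have h1 := ih.prodMk (h.measurable_noiseIncrement k)
    have h2 : scheme N τ F R b X₀ (k + 1) = (fun z : H × H => schemeStep N τ F z.1 z.2) ∘
        fun ω => (scheme N τ F R b X₀ k ω, noiseIncrement N τ R b k ω) := by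
      ext1 ω
      rw [scheme, Function.comp_apply]
    rw [h2]
    exact (measurable_schemeStep N τ h.drift.continuous).comp h1

lemma measurable_contScheme (h : Setting K L B M β F R σ P ℱ b N τ) {X₀ : Ω → H}
    (hX : Measurable X₀) (t : ℝ≥0) : Measurable (contScheme N τ F R b X₀ t) := by
  obtain ⟨n, hn⟩ := exists_nat_ge (t / τ)
  have : contScheme N τ F R b X₀ t = _ :=
    funext (contScheme_eq h.step_pos ((div_le_iff₀ h.step_pos).1 hn) N F R b X₀)
  rw [this]
  refine Measurable.add (Measurable.add ?_ ?_) (h.measurable_stochConv _ _ _)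
  · exact (measurable_galerkinSemigroup N _).comp ((measurable_galerkinProj N).comp hX)
  · unfold driftConv
    refine Finset.measurable_fun_sum _ fun k _ => ?_
    exact (((measurable_galerkinSemigroup N _).comp
      (h.drift.continuous.measurable.comp (h.measurable_scheme hX k))).const_smul
        ((gridTime τ 0 t (k + 1) : ℝ) - gridTime τ 0 t k))

lemma noise_nonneg_bound (h : Setting K L B M β F R σ P ℱ b N τ) : 0 ≤ B :=
  (norm_nonneg _).trans h.drift_zero

lemma exists_hasLaw_convolution (h : Setting K L B M β F R σ P ℱ b N τ) {s t : ℝ≥0} (hst : s ≤ t)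
    (n i : ℕ) : ∃ v : ℝ≥0,
      (v : ℝ) ≤ (1 - Real.exp (-(2 * eigval i * (t - s)))) / (2 * eigval i) ∧
      HasLaw (fun ω => ∑ k ∈ Finset.range n, Real.exp (-eigval i * (t - k * τ)) *
        (b i (gridTime τ s t (k + 1)) ω - b i (gridTime τ s t k) ω)) (gaussianReal 0 v) P := by
  obtain ⟨v, hv, hlaw⟩ := exists_hasLaw_sum_increments
    (h.brownian.isBrownian i).toIsPreBrownianReal (gridTime_mono τ s t)
    (fun k => Real.exp (-eigval i * (t - k * τ))) n
  exact ⟨v, hv.trans_le (sum_exp_sq_gridTime_le hst (eigval_pos i) n), hlaw⟩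

/-- Exponential damping keeps the variance of each mode below `1/λᵢ` at all times, which supplies
one full power of `-A` and reduces the sum to the Hilbert-Schmidt bound. -/
lemma eLpNorm_galerkinPow_stochConv_le [IsProbabilityMeasure P]
    (h : Setting K L B M β F R σ P ℱ b N τ) {s t : ℝ≥0} (hst : s ≤ t) (n : ℕ) {p : ℝ≥0∞}
    (hp : 1 ≤ p) :
    eLpNorm (fun ω => galerkinPow N β (stochConv N τ R b s t n ω)) (2 * p) P ≤
      noiseBound M p := by
  choose v hv hlaw using h.exists_hasLaw_convolution hst n
  simp only [stochConv_eq h.diagonal, galerkinPow, multiplier_sum, ← mul_assoc]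
  refine eLpNorm_sum_gaussian_le (fun i _ => hlaw i) (fun i => eigval i ^ (β / 2) * σ i)
    ?_ (abs_nonneg M) hp
  rw [sq_abs]
  refine le_trans (Finset.sum_le_sum fun i _ => ?_) h.noise_le
  have hl := eigval_pos i
  have h1 : (v i : ℝ) ≤ (eigval i)⁻¹ := by
    refine (hv i).trans ?_
    rw [div_le_iff₀ (by positivity), ← div_eq_inv_mul, mul_div_assoc, div_self hl.ne']
    have := Real.exp_pos (-(2 * eigval i * (t - s)))
    linarith
  have h2 : (eigval i ^ (β / 2)) ^ 2 = eigval i ^ β := by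
    rw [← Real.rpow_natCast, ← Real.rpow_mul hl.le]; norm_num
  have h3 : eigval i ^ (β - 1) = eigval i ^ β * (eigval i)⁻¹ := by
    rw [Real.rpow_sub hl, Real.rpow_one, div_eq_mul_inv]
  rw [mul_pow, h2, h3]
  have h4 : 0 ≤ eigval i ^ β * σ i ^ 2 := mul_nonneg (Real.rpow_nonneg hl.le _) (sq_nonneg _)
  nlinarith [mul_le_mul_of_nonneg_left h1 h4]

/-- The variance of a mode is controlled both by `1/λᵢ` and by `t - s`. Interpolating with exponent
`β` gives `λᵢ^{β-1}(t-s)^β`, exactly the weight of the noise assumption. -/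
lemma eLpNorm_stochConv_increment_le [IsProbabilityMeasure P]
    (h : Setting K L B M β F R σ P ℱ b N τ) {s t : ℝ≥0} (hst : s ≤ t) (n : ℕ) {p : ℝ≥0∞}
    (hp : 1 ≤ p) :
    eLpNorm (stochConv N τ R b s t n) (2 * p) P ≤
      ENNReal.ofReal (((t : ℝ) - s) ^ (β / 2)) * noiseBound M p := by
  choose v hv hlaw using h.exists_hasLaw_convolution hst n
  have hts : 0 ≤ (t : ℝ) - s := sub_nonneg.2 hst
  have hfun : stochConv N τ R b s t n = _ := funext (stochConv_eq h.diagonal N τ b s t n)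
  rw [hfun, noiseBound, ← mul_assoc, ← ENNReal.ofReal_mul (Real.rpow_nonneg hts _)]
  refine eLpNorm_sum_gaussian_le (fun i _ => hlaw i) σ ?_ (by positivity) hp
  have h0 : (((t : ℝ) - s) ^ (β / 2)) ^ 2 = ((t : ℝ) - s) ^ β := by
    rw [← Real.rpow_natCast, ← Real.rpow_mul hts]; norm_num
  rw [mul_pow, sq_abs, h0]
  refine le_trans ?_ (mul_le_mul_of_nonneg_left h.noise_le (Real.rpow_nonneg hts _))
  rw [Finset.mul_sum]
  refine Finset.sum_le_sum fun i _ => ?_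
  have hl := eigval_pos i
  have h1 : (v i : ℝ) ≤ eigval i ^ (β - 1) * ((t : ℝ) - s) ^ β := by
    refine (hv i).trans ?_
    rw [div_le_iff₀ (by positivity)]
    refine (one_sub_exp_neg_le_rpow (by positivity) h.beta_pos.le h.beta_le_one).trans ?_
    rw [Real.mul_rpow (by positivity) hts, Real.mul_rpow two_pos.le hl.le, Real.rpow_sub hl,
      Real.rpow_one]
    have h2 : (2 : ℝ) ^ β ≤ 2 := by
      have := Real.rpow_le_rpow_of_exponent_le one_le_two h.beta_le_one
      rwa [Real.rpow_one] at this
    have h3 : eigval i ^ β / eigval i * ((t : ℝ) - s) ^ β * (2 * eigval i) =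
      2 * eigval i ^ β * ((t : ℝ) - s) ^ β := by field_simp
    rw [h3]
    gcongr
  nlinarith [mul_le_mul_of_nonneg_left h1 (sq_nonneg (σ i))]

lemma stochConv_eq_multiplier (h : Setting K L B M β F R σ P ℱ b N τ) (s t : ℝ≥0) (n : ℕ) (ω : Ω) :
    stochConv N τ R b s t n ω = multiplier N 1 (stochConv N τ R b s t n ω) := by
  simp only [stochConv_eq h.diagonal, multiplier_sum, Pi.one_apply, one_mul]

lemma eLpNorm_stochConv_le [IsProbabilityMeasure P]
    (h : Setting K L B M β F R σ P ℱ b N τ) {s t : ℝ≥0} (hst : s ≤ t) (n : ℕ) {p : ℝ≥0∞}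
    (hp : 1 ≤ p) : eLpNorm (stochConv N τ R b s t n) (2 * p) P ≤ noiseBound M p := by
  refine (eLpNorm_mono fun ω => ?_).trans (h.eLpNorm_galerkinPow_stochConv_le hst n hp)
  rw [h.stochConv_eq_multiplier]
  exact norm_multiplier_le_norm_galerkinPow h.beta_pos.le _ _

/-- Linear growth of the drift, in `L^q`. -/
lemma eLpNorm_drift_le [IsProbabilityMeasure P] (h : Setting K L B M β F R σ P ℱ b N τ)
    {X : Ω → H} (hX : Measurable X) {q : ℝ≥0∞} (hq : 1 ≤ q) :
    eLpNorm (fun ω => F (X ω)) q P ≤ ENNReal.ofReal B + ENNReal.ofReal L * eLpNorm X q P := by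
  have hL := h.drift.pos
  calc eLpNorm (fun ω => F (X ω)) q P ≤ eLpNorm ((fun _ => B) + L • fun ω => ‖X ω‖) q P := by
        refine eLpNorm_mono_real fun ω => ?_
        simpa using h.drift.norm_le h.drift_zero (X ω)
    _ ≤ eLpNorm (fun _ => B) q P + eLpNorm (L • fun ω => ‖X ω‖) q P :=
        eLpNorm_add_le aestronglyMeasurable_const
          (hX.norm.const_smul L).aestronglyMeasurable hq
    _ = ENNReal.ofReal B + ENNReal.ofReal L * eLpNorm X q P := by
        rw [eLpNorm_const_smul, eLpNorm_norm, eLpNorm_const _ (by positivity)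
          (IsProbabilityMeasure.ne_zero P), Real.enorm_of_nonneg h.noise_nonneg_bound,
          Real.enorm_of_nonneg hL.le]
        simp

/-- Uniform moment bounds for the full discretization. -/
lemma eLpNorm_scheme_le [IsProbabilityMeasure P] (h : Setting K L B M β F R σ P ℱ b N τ)
    {X₀ : Ω → H} (hX : Measurable X₀) {p : ℝ≥0∞} (hp : 1 ≤ p) (k : ℕ) :
    eLpNorm (scheme N τ F R b X₀ k) (2 * p) P ≤
      eLpNorm (fun ω => galerkinProj N (X₀ ω)) (2 * p) P + schemeBound K L B M p := by
  have h2p : 1 ≤ 2 * p := hp.trans (le_mul_of_one_le_left (zero_le) one_le_two)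
  set Y : ℕ → Ω → H := fun k ω => scheme N τ F R b X₀ k ω - gridStochConv N τ R b k ω with hY
  have hYm : ∀ k, Measurable (Y k) := fun k =>
    (h.measurable_scheme hX k).sub (h.measurable_stochConv _ _ _)
  set γ := eigval 0 - K with hγdef
  have hγ : 0 < γ := h.drift.gap_pos
  have hτ0 : (0 : ℝ) < τ := h.step_pos
  -- Chosen so that the forcing coefficient per step is at most `(1 - E) d²`; then `(dG)²` is a
  -- supersolution of the affine recursion for the squared norms.
  set d : ℝ := √((1 + 4 / γ) * ((1 + γ) / γ)) with hd
  set x₀ := eLpNorm (fun ω => galerkinProj N (X₀ ω)) (2 * p) P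
  set G := driftBound L B M p with hG
  have hFZ : ∀ k, eLpNorm (fun ω => F (gridStochConv N τ R b k ω)) (2 * p) P ≤ G := fun k => by
    refine (h.eLpNorm_drift_le (h.measurable_stochConv _ _ _) h2p).trans ?_
    rw [hG, driftBound]
    gcongr
    exact h.eLpNorm_stochConv_le (zero_le) k hp
  set E := Real.exp (-γ * τ) with hE
  have hE0 : 0 ≤ E := (Real.exp_pos _).le
  have hE1 : E ≤ 1 := by
    rw [hE, Real.exp_le_one_iff]
    nlinarith
  have hdE : τ * (1 + 4 / γ) ≤ (1 - E) * d ^ 2 := by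
    rw [hd, Real.sq_sqrt (by positivity)]
    have h1 := Real.add_one_le_exp (γ * τ)
    have h2 : E = (Real.exp (γ * τ))⁻¹ := by rw [hE, ← Real.exp_neg]; congr 1; ring
    have h3 : E ≤ (γ * τ + 1)⁻¹ := by
      rw [h2]
      exact inv_anti₀ (by positivity) h1
    have h4 : τ ≤ (1 - E) * ((1 + γ) / γ) := by
      -- From `e^{γτ} ≥ 1 + γτ`; replacing `γτ` by `γ` in the denominator uses `τ < 1`.
      have h5 : γ * τ / (1 + γ) ≤ 1 - E := by
        have h6 : γ * τ / (1 + γ) ≤ 1 - (γ * τ + 1)⁻¹ := by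
          rw [show 1 - (γ * τ + 1)⁻¹ = γ * τ / (γ * τ + 1) by field_simp; ring]
          have := h.step_lt
          refine div_le_div_of_nonneg_left (by positivity) (by positivity) ?_
          nlinarith
        linarith
      rw [div_le_iff₀ (by positivity)] at h5
      rw [mul_div_assoc', le_div_iff₀ hγ]
      linarith
    have h7 : 0 ≤ 1 + 4 / γ := by positivity
    calc τ * (1 + 4 / γ) ≤ (1 - E) * ((1 + γ) / γ) * (1 + 4 / γ) := by gcongr
      _ = _ := by ring
  -- The bound dominates both the initial value and the forcing level. Each step is bounded by a
  -- convex combination with weights `E` and `1 - E`, so the bound is preserved.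
  have key : ∀ k, eLpNorm (Y k) (2 * p) P ^ 2 ≤ (x₀ + ENNReal.ofReal d * G) ^ 2 := by
    intro k
    induction k with
    | zero =>
      have : Y 0 = fun ω => galerkinProj N (X₀ ω) := by
        ext1 ω
        simp [hY, scheme, gridStochConv, stochConv]
      rw [this]
      gcongr
      exact le_self_add
    | succ k ih =>
      have hstep : ∀ ω, ‖Y (k + 1) ω‖ ^ 2 ≤ E * ‖Y k ω‖ ^ 2 +
          τ * (1 + 4 / γ) * ‖F (gridStochConv N τ R b k ω)‖ ^ 2 := fun ω => by
        simp only [hY]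
        rw [scheme_sub_gridStochConv_succ]
        exact norm_galerkinSemigroup_add_drift_sq_le h.drift N h.step_lt h.step_le _ _
      calc eLpNorm (Y (k + 1)) (2 * p) P ^ 2 = eLpNorm (fun ω => ‖Y (k + 1) ω‖ ^ 2) p P :=
            (eLpNorm_norm_sq _ _ _).symm
        _ ≤ eLpNorm ((E • fun ω => ‖Y k ω‖ ^ 2) +
            (τ * (1 + 4 / γ)) • fun ω => ‖F (gridStochConv N τ R b k ω)‖ ^ 2) p P := by
            refine eLpNorm_mono_real fun ω => ?_
            rw [norm_pow, norm_norm]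
            exact hstep ω
        _ ≤ eLpNorm (E • fun ω => ‖Y k ω‖ ^ 2) p P +
            eLpNorm ((τ * (1 + 4 / γ)) • fun ω => ‖F (gridStochConv N τ R b k ω)‖ ^ 2) p P := by
            refine eLpNorm_add_le ?_ ?_ hp
            · exact (((hYm k).norm.pow_const 2).const_smul E).aestronglyMeasurable
            · exact (((h.drift.continuous.measurable.comp
                (h.measurable_stochConv _ _ _)).norm.pow_const 2).const_smul _).aestronglyMeasurable
        _ = ENNReal.ofReal E * eLpNorm (Y k) (2 * p) P ^ 2 + ENNReal.ofReal (τ * (1 + 4 / γ)) *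
            eLpNorm (fun ω => F (gridStochConv N τ R b k ω)) (2 * p) P ^ 2 := by
            rw [eLpNorm_const_smul, eLpNorm_const_smul, eLpNorm_norm_sq, eLpNorm_norm_sq,
              Real.enorm_of_nonneg hE0, Real.enorm_of_nonneg (by positivity)]
        _ ≤ ENNReal.ofReal E * (x₀ + ENNReal.ofReal d * G) ^ 2 +
            ENNReal.ofReal ((1 - E) * d ^ 2) * G ^ 2 := by
            gcongr
            exact hFZ k
        _ = ENNReal.ofReal E * (x₀ + ENNReal.ofReal d * G) ^ 2 +
            ENNReal.ofReal (1 - E) * (ENNReal.ofReal d * G) ^ 2 := by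
            rw [ENNReal.ofReal_mul (by linarith), ENNReal.ofReal_pow (Real.sqrt_nonneg _), mul_pow,
              mul_assoc]
        _ ≤ ENNReal.ofReal E * (x₀ + ENNReal.ofReal d * G) ^ 2 +
            ENNReal.ofReal (1 - E) * (x₀ + ENNReal.ofReal d * G) ^ 2 := by
            gcongr
            exact le_add_self
        _ = (x₀ + ENNReal.ofReal d * G) ^ 2 := by
            rw [← add_mul, ← ENNReal.ofReal_add hE0 (by linarith), add_sub_cancel,
              ENNReal.ofReal_one, one_mul]
  have hYk := (ENNReal.pow_le_pow_left_iff two_ne_zero).1 (key k)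
  have hsum : scheme N τ F R b X₀ k = Y k + gridStochConv N τ R b k := by
    ext1 ω
    simp [hY]
  rw [hsum]
  refine (eLpNorm_add_le (hYm k).aestronglyMeasurable
    (h.measurable_stochConv _ _ _).aestronglyMeasurable h2p).trans ?_
  rw [schemeBound, ← add_assoc]
  exact add_le_add hYk (h.eLpNorm_stochConv_le (zero_le) k hp)

end Setting

/-! ### Regularity of the continuous version and contraction -/

lemma eLpNorm_sum_le_of_norm_le {α : Type*} {mα : MeasurableSpace α} {μ : Measure α} {n : ℕ}
    {f g : ℕ → α → H} {C : ℕ → ℝ} {D : ℝ≥0∞} {c : ℝ} {q : ℝ≥0∞} (hq : 1 ≤ q)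
    (hf : ∀ k, Measurable (f k)) (hC : ∀ k, 0 ≤ C k) (hfg : ∀ k x, ‖f k x‖ ≤ C k * ‖g k x‖)
    (hg : ∀ k, eLpNorm (g k) q μ ≤ D) (hc : ∑ k ∈ Finset.range n, C k ≤ c) :
    eLpNorm (fun x => ∑ k ∈ Finset.range n, f k x) q μ ≤ ENNReal.ofReal c * D := by
  have h1 : (fun x => ∑ k ∈ Finset.range n, f k x) = ∑ k ∈ Finset.range n, f k := by
    ext1 x; simp
  rw [h1]
  calc eLpNorm (∑ k ∈ Finset.range n, f k) q μ ≤ ∑ k ∈ Finset.range n, eLpNorm (f k) q μ :=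
        eLpNorm_sum_le (fun k _ => (hf k).aestronglyMeasurable) hq
    _ ≤ ∑ k ∈ Finset.range n, ENNReal.ofReal (C k) * D := by
        refine Finset.sum_le_sum fun k _ => ?_
        refine (eLpNorm_le_mul_eLpNorm_of_ae_le_mul (Eventually.of_forall (hfg k)) q).trans ?_
        gcongr
        exact hg k
    _ = ENNReal.ofReal (∑ k ∈ Finset.range n, C k) * D := by
        rw [← Finset.sum_mul, ENNReal.ofReal_sum_of_nonneg fun k _ => hC k]
    _ ≤ _ := by gcongr

lemma lintegral_enorm_rpow_eq {α : Type*} {mα : MeasurableSpace α} {μ : Measure α}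
    (f : α → H) {p : ℝ} (hp : 1 ≤ p) :
    ∫⁻ x, ‖f x‖ₑ ^ (2 * p) ∂μ = eLpNorm f (2 * ENNReal.ofReal p) μ ^ (2 * p) := by
  have hp0 : 0 < p := by linarith
  have h1 : (2 * ENNReal.ofReal p).toReal = 2 * p := by
    rw [ENNReal.toReal_mul, ENNReal.toReal_ofReal hp0.le]; simp
  rw [eLpNorm_eq_lintegral_rpow_enorm_toReal
    (mul_ne_zero two_ne_zero (ENNReal.ofReal_pos.2 hp0).ne')
    (ENNReal.mul_ne_top (by norm_num) ENNReal.ofReal_ne_top), h1, ← ENNReal.rpow_mul,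
    one_div, inv_mul_cancel₀ (by positivity), ENNReal.rpow_one]

lemma lintegral_enorm_sq_eq {α : Type*} {mα : MeasurableSpace α} {μ : Measure α} (f : α → H) :
    ∫⁻ x, ‖f x‖ₑ ^ 2 ∂μ = eLpNorm f 2 μ ^ 2 := by
  have := lintegral_enorm_rpow_eq (μ := μ) f le_rfl
  simpa using this

/-- Bound for the moments in `Dom((-A)^{β/2})` of the continuous version of the scheme. -/
def contBound (K L B M : ℝ) (p : ℝ≥0∞) : ℝ≥0∞ :=
  ENNReal.ofReal 4 * (ENNReal.ofReal B + ENNReal.ofReal L * schemeBound K L B M p) + noiseBound M p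

lemma contBound_ne_top (K L B M : ℝ) {p : ℝ≥0∞} (hp : p ≠ ∞) : contBound K L B M p ≠ ∞ :=
  ENNReal.add_ne_top.2 ⟨ENNReal.mul_ne_top ENNReal.ofReal_ne_top (ENNReal.add_ne_top.2
    ⟨ENNReal.ofReal_ne_top, ENNReal.mul_ne_top ENNReal.ofReal_ne_top
      (schemeBound_ne_top K L B M hp)⟩), noiseBound_ne_top M hp⟩

/-- Turns a bound affine in the norm of the initial value into one of the form `C (1 + moment)`. -/
lemma mul_add_rpow_le (a c x : ℝ≥0∞) {q : ℝ} (hq : 0 ≤ q) :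
    (a * x + c) ^ q ≤ (a + c) ^ q * (1 + x ^ q) := by
  calc (a * x + c) ^ q ≤ ((a + c) * max 1 x) ^ q := by
        gcongr
        rw [add_mul]
        gcongr
        · exact le_max_right _ _
        · exact le_mul_of_one_le_right (zero_le) (le_max_left _ _)
    _ = (a + c) ^ q * (max 1 x) ^ q := ENNReal.mul_rpow_of_nonneg _ _ hq
    _ ≤ (a + c) ^ q * (1 + x ^ q) := by
        gcongr
        rcases le_total x 1 with h | h
        · rw [max_eq_left h, ENNReal.one_rpow]
          exact le_self_add
        · rw [max_eq_right h]
          exact le_add_self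

namespace Setting

variable {Ω : Type*} {mΩ : MeasurableSpace Ω} {K L B M β : ℝ} {F : H → H} {R : H →L[ℝ] H}
  {σ : ℕ → ℝ} {P : Measure Ω} {ℱ : Filtration ℝ≥0 mΩ} {b : ℕ → ℝ≥0 → Ω → ℝ} {N : ℕ} {τ : ℝ≥0}

lemma eLpNorm_drift_scheme_le [IsProbabilityMeasure P] (h : Setting K L B M β F R σ P ℱ b N τ)
    {X₀ : Ω → H} (hX : Measurable X₀) {p : ℝ≥0∞} (hp : 1 ≤ p) (k : ℕ) :
    eLpNorm (fun ω => F (scheme N τ F R b X₀ k ω)) (2 * p) P ≤ ENNReal.ofReal B + ENNReal.ofReal L *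
      (eLpNorm (fun ω => galerkinPow N β (galerkinProj N (X₀ ω))) (2 * p) P +
        schemeBound K L B M p) := by
  have h2p : 1 ≤ 2 * p := hp.trans (le_mul_of_one_le_left (zero_le) one_le_two)
  refine (h.eLpNorm_drift_le (h.measurable_scheme hX k) h2p).trans ?_
  gcongr
  refine (h.eLpNorm_scheme_le hX hp k).trans ?_
  gcongr
  refine eLpNorm_mono fun ω => ?_
  rw [galerkinProj_eq]
  exact norm_multiplier_le_norm_galerkinPow h.beta_pos.le _ _

lemma measurable_drift_term (h : Setting K L B M β F R σ P ℱ b N τ) {X₀ : Ω → H}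
    (hX : Measurable X₀) (c r : ℝ) (k : ℕ) :
    Measurable fun ω => c • galerkinSemigroup N r (F (scheme N τ F R b X₀ k ω)) :=
  ((measurable_galerkinSemigroup N r).comp
    (h.drift.continuous.measurable.comp (h.measurable_scheme hX k))).const_smul c

/-- The semigroup does not increase the initial term, the drift integral costs total smoothing mass
`4` times the moments of `F` along the chain, and the convolution is bounded by the noise
assumption. -/
lemma eLpNorm_galerkinPow_contScheme_le [IsProbabilityMeasure P]
    (h : Setting K L B M β F R σ P ℱ b N τ) {X₀ : Ω → H} (hX : Measurable X₀) {p : ℝ≥0∞}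
    (hp : 1 ≤ p) (t : ℝ≥0) :
    eLpNorm (fun ω => galerkinPow N β (contScheme N τ F R b X₀ t ω)) (2 * p) P ≤
      ENNReal.ofReal (1 + 4 * L) *
        eLpNorm (fun ω => galerkinPow N β (galerkinProj N (X₀ ω))) (2 * p) P +
        contBound K L B M p := by
  have h2p : 1 ≤ 2 * p := hp.trans (le_mul_of_one_le_left (zero_le) one_le_two)
  obtain ⟨n, hn⟩ := exists_nat_ge (t / τ)
  set x := eLpNorm (fun ω => galerkinPow N β (galerkinProj N (X₀ ω))) (2 * p) P with hx
  set f₁ : Ω → H := fun ω => galerkinPow N β (galerkinSemigroup N t (galerkinProj N (X₀ ω)))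
  set f₂ : ℕ → Ω → H := fun k ω => galerkinPow N β
    (((gridTime τ 0 t (k + 1) : ℝ) - gridTime τ 0 t k) •
      galerkinSemigroup N (t - k * τ) (F (scheme N τ F R b X₀ k ω))) with hf₂
  set f₃ : Ω → H := fun ω => galerkinPow N β (stochConv N τ R b 0 t n ω)
  have hm : Measurable (galerkinPow N β) := (galerkinPow N β).continuous.measurable
  have hm₁ : Measurable f₁ :=
    hm.comp ((measurable_galerkinSemigroup N t).comp ((measurable_galerkinProj N).comp hX))
  have hm₂ : ∀ k, Measurable (f₂ k) := fun k => hm.comp (h.measurable_drift_term hX _ _ k)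
  have hm₃ : Measurable f₃ := hm.comp (h.measurable_stochConv 0 t n)
  have hsum : (fun ω => galerkinPow N β (contScheme N τ F R b X₀ t ω)) =
      f₁ + (fun ω => ∑ k ∈ Finset.range n, f₂ k ω) + f₃ := by
    ext1 ω
    rw [contScheme_eq h.step_pos ((div_le_iff₀ h.step_pos).1 hn), map_add, map_add, driftConv,
      map_sum]
    rfl
  have h₁ : eLpNorm f₁ (2 * p) P ≤ x := by
    refine eLpNorm_mono fun ω => ?_
    simp only [f₁, galerkinPow, galerkinSemigroup_eq, multiplier_multiplier, galerkinProj_eq]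
    have := norm_multiplier_le_multiplier (N := N)
      (c := fun i => eigval i ^ (β / 2) * Real.exp (-eigval i * t) * (1 : ℕ → ℝ) i)
      (d := fun i => eigval i ^ (β / 2) * (1 : ℕ → ℝ) i) zero_le_one (fun i _ => ?_) (X₀ ω)
    · rw [one_mul] at this
      simpa only [mul_assoc] using this
    · rw [one_mul, Pi.one_apply, mul_one, mul_one, abs_mul]
      refine mul_le_of_le_one_right (abs_nonneg _) ?_
      rw [abs_of_pos (Real.exp_pos _), Real.exp_le_one_iff]
      have := mul_nonneg (eigval_pos i).le t.coe_nonneg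
      linarith
  have h₂ : eLpNorm (fun ω => ∑ k ∈ Finset.range n, f₂ k ω) (2 * p) P ≤
      ENNReal.ofReal 4 * (ENNReal.ofReal B + ENNReal.ofReal L * (x + schemeBound K L B M p)) := by
    refine eLpNorm_sum_le_of_norm_le h2p hm₂ (fun k => ?_) (fun k ω => ?_)
      (fun k => h.eLpNorm_drift_scheme_le hX hp k) (sum_smoothingPotential_le τ 0 t n)
    · have h4 : (gridTime τ 0 t k : ℝ) ≤ gridTime τ 0 t (k + 1) := gridTime_mono τ 0 t k.le_succ
      have := smoothingPotential_mono
        (show (t : ℝ) - gridTime τ 0 t (k + 1) ≤ t - gridTime τ 0 t k by linarith)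
      linarith
    · simp only [hf₂]
      rw [map_smul, norm_smul, Real.norm_of_nonneg (gridTime_step_nonneg k)]
      exact gridTime_step_mul_norm_le (zero_le) h.beta_le_one N k _
  have h₃ : eLpNorm f₃ (2 * p) P ≤ noiseBound M p :=
    h.eLpNorm_galerkinPow_stochConv_le (zero_le) n hp
  rw [hsum]
  have hm₂' : Measurable fun ω => ∑ k ∈ Finset.range n, f₂ k ω :=
    Finset.measurable_fun_sum _ fun k _ => hm₂ k
  calc eLpNorm (f₁ + (fun ω => ∑ k ∈ Finset.range n, f₂ k ω) + f₃) (2 * p) P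
      ≤ eLpNorm f₁ (2 * p) P + eLpNorm (fun ω => ∑ k ∈ Finset.range n, f₂ k ω) (2 * p) P +
        eLpNorm f₃ (2 * p) P := by
        refine (eLpNorm_add_le (hm₁.add hm₂').aestronglyMeasurable
          hm₃.aestronglyMeasurable h2p).trans ?_
        gcongr
        exact eLpNorm_add_le hm₁.aestronglyMeasurable hm₂'.aestronglyMeasurable h2p
    _ ≤ x + ENNReal.ofReal 4 *
        (ENNReal.ofReal B + ENNReal.ofReal L * (x + schemeBound K L B M p)) + noiseBound M p := by
        gcongr
    _ = _ := by
        have := h.drift.pos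
        rw [contBound, ENNReal.ofReal_add (by norm_num) (by positivity),
          ENNReal.ofReal_mul (by norm_num), ENNReal.ofReal_one]
        ring

lemma hdotNorm_contScheme (h : Setting K L B M β F R σ P ℱ b N τ) (X₀ : Ω → H) (t : ℝ≥0) (ω : Ω) :
    hdotNorm β (contScheme N τ F R b X₀ t ω) =
      ‖galerkinPow N β (contScheme N τ F R b X₀ t ω)‖ₑ := by
  have h1 := galerkinProj_contScheme h.step_pos N F R b X₀ t ω
  rw [galerkinProj_eq] at h1
  conv_lhs => rw [← h1]
  rw [hdotNorm_multiplier, h1]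

lemma hdotNorm_galerkinProj (N : ℕ) (β : ℝ) (x : H) :
    hdotNorm β (galerkinProj N x) = ‖galerkinPow N β (galerkinProj N x)‖ₑ := by
  rw [galerkinProj_eq, hdotNorm_multiplier]

lemma lintegral_hdotNorm_contScheme_le [IsProbabilityMeasure P]
    (h : Setting K L B M β F R σ P ℱ b N τ) {X₀ : Ω → H} (hX : Measurable X₀) {p : ℝ}
    (hp : 1 ≤ p) (t : ℝ≥0) :
    ∫⁻ ω, hdotNorm β (contScheme N τ F R b X₀ t ω) ^ (2 * p) ∂P ≤
      (ENNReal.ofReal (1 + 4 * L) + contBound K L B M (ENNReal.ofReal p)) ^ (2 * p) *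
        (1 + ∫⁻ ω, hdotNorm β (galerkinProj N (X₀ ω)) ^ (2 * p) ∂P) := by
  simp only [h.hdotNorm_contScheme, hdotNorm_galerkinProj]
  rw [lintegral_enorm_rpow_eq _ hp, lintegral_enorm_rpow_eq _ hp]
  refine le_trans ?_ (mul_add_rpow_le _ _ _ (by linarith))
  gcongr
  exact h.eLpNorm_galerkinPow_contScheme_le hX (by simpa using hp) t

lemma eLpNorm_contScheme_le [IsProbabilityMeasure P]
    (h : Setting K L B M β F R σ P ℱ b N τ) {X₀ : Ω → H} (hX : Measurable X₀) {p : ℝ≥0∞}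
    (hp : 1 ≤ p) (t : ℝ≥0) :
    eLpNorm (contScheme N τ F R b X₀ t) (2 * p) P ≤
      ENNReal.ofReal (1 + 4 * L) *
        eLpNorm (fun ω => galerkinPow N β (galerkinProj N (X₀ ω))) (2 * p) P +
        contBound K L B M p := by
  refine (eLpNorm_mono fun ω => ?_).trans (h.eLpNorm_galerkinPow_contScheme_le hX hp t)
  rw [← galerkinProj_contScheme h.step_pos, galerkinProj_eq]
  exact norm_multiplier_le_norm_galerkinPow h.beta_pos.le _ _

/-! ### Hölder continuity in time. -/

lemma norm_galerkinSemigroup_sub_le (N : ℕ) {β r : ℝ} (hβ0 : 0 < β) (hβ1 : β ≤ 1) (hr : 0 ≤ r)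
    {x : H} (hx : galerkinProj N x = x) :
    ‖galerkinSemigroup N r x - x‖ ≤ r ^ (β / 2) * ‖galerkinPow N β x‖ := by
  have h1 : galerkinSemigroup N r x - x =
      multiplier N (fun i => Real.exp (-eigval i * r) - 1) x := by
    conv_lhs => rw [← hx]
    rw [galerkinSemigroup_galerkinProj, galerkinSemigroup_eq, galerkinProj_eq, multiplier_apply,
      multiplier_apply, multiplier_apply, ← Finset.sum_sub_distrib]
    refine Finset.sum_congr rfl fun i _ => ?_
    rw [← sub_smul, Pi.one_apply, sub_mul]
  rw [h1, galerkinPow]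
  refine norm_multiplier_le_multiplier (Real.rpow_nonneg hr _) (fun i _ => ?_) x
  have hl := eigval_pos i
  rw [abs_of_nonneg (Real.rpow_nonneg hl.le _), ← Real.mul_rpow hr hl.le, abs_sub_comm,
    abs_of_nonneg (sub_nonneg.2 (Real.exp_le_one_iff.2 (by nlinarith))), mul_comm r, neg_mul]
  exact one_sub_exp_neg_le_rpow (by positivity) (by linarith) (by linarith)

lemma eLpNorm_driftConv_le [IsProbabilityMeasure P]
    (h : Setting K L B M β F R σ P ℱ b N τ) {X₀ : Ω → H} (hX : Measurable X₀) {p : ℝ≥0∞}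
    (hp : 1 ≤ p) {s t : ℝ≥0} (hst : s ≤ t) (n : ℕ) :
    eLpNorm (driftConv N τ F (scheme N τ F R b X₀) s t n) (2 * p) P ≤
      ENNReal.ofReal (t - s) * (ENNReal.ofReal B + ENNReal.ofReal L *
      (eLpNorm (fun ω => galerkinPow N β (galerkinProj N (X₀ ω))) (2 * p) P +
        schemeBound K L B M p)) := by
  have h2p : 1 ≤ 2 * p := hp.trans (le_mul_of_one_le_left (zero_le) one_le_two)
  refine eLpNorm_sum_le_of_norm_le h2p (fun k => h.measurable_drift_term hX _ _ k)
    (fun k => gridTime_step_nonneg (τ := τ) k) (fun k ω => ?_)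
    (fun k => h.eLpNorm_drift_scheme_le hX hp k) (sum_gridTime_step_le hst n)
  rw [norm_smul, Real.norm_of_nonneg (gridTime_step_nonneg k)]
  rcases (gridTime_mono τ s t k.le_succ).eq_or_lt with h1 | h1
  · simp only [Nat.succ_eq_add_one] at h1
    simp [h1]
  · have h2 : (k : ℝ) * τ ≤ gridTime τ s t k := by exact_mod_cast mul_le_gridTime hst h1
    have h3 : (gridTime τ s t k : ℝ) ≤ t := gridTime_le hst k
    have h4 : 0 ≤ (t : ℝ) - k * τ := by linarith
    refine mul_le_mul_of_nonneg_left ?_ (gridTime_step_nonneg k)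
    refine (norm_galerkinSemigroup_le N h4 _).trans (mul_le_of_le_one_left (norm_nonneg _) ?_)
    rw [Real.exp_le_one_iff]
    have := mul_nonneg (eigval_pos 0).le h4
    linarith

/-- Hölder continuity in time, in mean square. -/
lemma eLpNorm_contScheme_sub_le [IsProbabilityMeasure P]
    (h : Setting K L B M β F R σ P ℱ b N τ) {X₀ : Ω → H} (hX : Measurable X₀) {p : ℝ≥0∞}
    (hp : 1 ≤ p) {s t : ℝ≥0} (hst : s ≤ t) {r : ℝ≥0∞}
    (hr : eLpNorm (fun ω => galerkinPow N β (galerkinProj N (X₀ ω))) (2 * p) P ≤ r) :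
    eLpNorm (fun ω => contScheme N τ F R b X₀ t ω - contScheme N τ F R b X₀ s ω) (2 * p) P ≤
      ENNReal.ofReal (((t : ℝ) - s) ^ (β / 2)) *
        (2 * (ENNReal.ofReal (1 + 4 * L) * r + contBound K L B M p) + (ENNReal.ofReal B +
          ENNReal.ofReal L * (r + schemeBound K L B M p)) + noiseBound M p) := by
  have h2p : 1 ≤ 2 * p := hp.trans (le_mul_of_one_le_left (zero_le) one_le_two)
  have hts : 0 ≤ (t : ℝ) - s := sub_nonneg.2 hst
  have hβ := h.beta_pos
  have hβ1 := h.beta_le_one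
  set c := ENNReal.ofReal (1 + 4 * L) * r + contBound K L B M p with hc
  -- On short intervals the mild formulation applies and the linear drift rate `t - s` is below
  -- `(t-s)^{β/2}`. On long ones `(t-s)^{β/2} ≥ 1` and the uniform moment bound suffices; the factor
  -- `2` in the constant serves this case.
  rcases le_or_gt ((t : ℝ) - s) 1 with h1 | h1
  · obtain ⟨n, hn⟩ := exists_nat_ge (t / τ)
    have hXs := h.measurable_contScheme hX s
    set f₁ : Ω → H := fun ω => galerkinSemigroup N (t - s) (contScheme N τ F R b X₀ s ω) -
      contScheme N τ F R b X₀ s ω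
    have hm₁ : Measurable f₁ := ((measurable_galerkinSemigroup N _).comp hXs).sub hXs
    have hm₂ : Measurable (driftConv N τ F (scheme N τ F R b X₀) s t n) :=
      Finset.measurable_fun_sum _ fun k _ => h.measurable_drift_term hX _ _ k
    have hm₃ := h.measurable_stochConv s t n
    have hsum : (fun ω => contScheme N τ F R b X₀ t ω - contScheme N τ F R b X₀ s ω) =
        f₁ + driftConv N τ F (scheme N τ F R b X₀) s t n + stochConv N τ R b s t n := by
      ext1 ω
      rw [contScheme_sub_eq h.step_pos hst ((div_le_iff₀ h.step_pos).1 hn)]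
      simp only [f₁, Pi.add_apply]
      abel
    have h₁ : eLpNorm f₁ (2 * p) P ≤ ENNReal.ofReal (((t : ℝ) - s) ^ (β / 2)) * c := by
      refine (eLpNorm_le_mul_eLpNorm_of_ae_le_mul (Eventually.of_forall fun ω =>
        norm_galerkinSemigroup_sub_le N hβ hβ1 hts
          (galerkinProj_contScheme h.step_pos N F R b X₀ s ω)) _).trans ?_
      gcongr
      refine (h.eLpNorm_galerkinPow_contScheme_le hX hp s).trans ?_
      rw [hc]
      gcongr
    have h₂ : eLpNorm (driftConv N τ F (scheme N τ F R b X₀) s t n) (2 * p) P ≤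
        ENNReal.ofReal (((t : ℝ) - s) ^ (β / 2)) *
          (ENNReal.ofReal B + ENNReal.ofReal L * (r + schemeBound K L B M p)) := by
      refine (h.eLpNorm_driftConv_le hX hp hst n).trans ?_
      gcongr
      rcases hts.eq_or_lt with h0 | h0
      · rw [← h0]; exact Real.rpow_nonneg le_rfl _
      · have := Real.rpow_le_rpow_of_exponent_ge h0 h1 (show β / 2 ≤ 1 by linarith)
        rwa [Real.rpow_one] at this
    have h₃ := h.eLpNorm_stochConv_increment_le hst n hp
    rw [hsum]
    refine (eLpNorm_add_le (hm₁.add hm₂).aestronglyMeasurable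
      hm₃.aestronglyMeasurable h2p).trans ?_
    rw [mul_add, mul_add]
    refine add_le_add ((eLpNorm_add_le hm₁.aestronglyMeasurable hm₂.aestronglyMeasurable
      h2p).trans (add_le_add (h₁.trans ?_) h₂)) h₃
    gcongr
    exact le_mul_of_one_le_left (zero_le) one_le_two
  · have hle : ∀ u, eLpNorm (contScheme N τ F R b X₀ u) (2 * p) P ≤ c := fun u => by
      refine (h.eLpNorm_contScheme_le hX hp u).trans ?_
      rw [hc]
      gcongr
    have h2 : 1 ≤ ENNReal.ofReal (((t : ℝ) - s) ^ (β / 2)) := by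
      rw [ENNReal.one_le_ofReal]
      exact Real.one_le_rpow h1.le (by positivity)
    calc eLpNorm (fun ω => contScheme N τ F R b X₀ t ω - contScheme N τ F R b X₀ s ω) (2 * p) P
        ≤ c + c := (eLpNorm_sub_le (h.measurable_contScheme hX t).aestronglyMeasurable
          (h.measurable_contScheme hX s).aestronglyMeasurable h2p).trans
            (add_le_add (hle t) (hle s))
      _ = 1 * (2 * c) := by rw [one_mul, two_mul]
      _ ≤ _ := by
        gcongr
        rw [add_assoc]
        exact le_self_add

lemma lintegral_contScheme_sub_le [IsProbabilityMeasure P]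
    (h : Setting K L B M β F R σ P ℱ b N τ) {X₀ : Ω → H} (hX : Measurable X₀)
    {s t : ℝ≥0} (hst : s ≤ t) {r : ℝ≥0∞}
    (hr : ∫⁻ ω, hdotNorm β (galerkinProj N (X₀ ω)) ^ 2 ∂P ≤ r ^ 2) :
    ∫⁻ ω, ‖contScheme N τ F R b X₀ t ω - contScheme N τ F R b X₀ s ω‖ₑ ^ 2 ∂P ≤
      (2 * (ENNReal.ofReal (1 + 4 * L) * r + contBound K L B M 1) + (ENNReal.ofReal B +
          ENNReal.ofReal L * (r + schemeBound K L B M 1)) + noiseBound M 1) ^ 2 *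
        ENNReal.ofReal (((t : ℝ) - s) ^ β) := by
  have hts : 0 ≤ (t : ℝ) - s := sub_nonneg.2 hst
  have hr' : eLpNorm (fun ω => galerkinPow N β (galerkinProj N (X₀ ω))) (2 * 1) P ≤ r := by
    simp only [hdotNorm_galerkinProj] at hr
    rw [lintegral_enorm_sq_eq] at hr
    rw [mul_one]
    exact (ENNReal.pow_le_pow_left_iff two_ne_zero).1 hr
  have h1 := h.eLpNorm_contScheme_sub_le hX le_rfl hst hr'
  rw [mul_one] at h1
  rw [lintegral_enorm_sq_eq]
  refine (pow_le_pow_left₀ (zero_le) h1 2).trans (le_of_eq ?_)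
  rw [mul_pow, ← ENNReal.ofReal_pow (Real.rpow_nonneg hts _), ← Real.rpow_natCast,
    ← Real.rpow_mul hts, mul_comm]
  norm_num

/-- The scheme contracts distances along every path of the noise. -/
lemma norm_scheme_sub_le (h : Setting K L B M β F R σ P ℱ b N τ) (X₀ X₀' : Ω → H) (k : ℕ) (ω : Ω) :
    ‖scheme N τ F R b X₀ k ω - scheme N τ F R b X₀' k ω‖ ≤
      Real.exp (-(1 / 2) * (eigval 0 - K) * (k * τ)) *
        ‖galerkinProj N (X₀ ω) - galerkinProj N (X₀' ω)‖ := by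
  induction k with
  | zero => simp [scheme]
  | succ k ih =>
    rw [scheme, scheme]
    refine (norm_schemeStep_sub_le h.drift N h.step_le _ _ _).trans ?_
    refine (mul_le_mul_of_nonneg_left ih (Real.exp_pos _).le).trans (le_of_eq ?_)
    rw [← mul_assoc, ← Real.exp_add]
    congr 2
    push_cast; ring

/-- The pathwise estimate raised to the power `2p`, which turns the rate `γ/2` into `γ p`. -/
lemma lintegral_scheme_sub_le (h : Setting K L B M β F R σ P ℱ b N τ) (X₀ X₀' : Ω → H) {p : ℝ}
    (hp : 1 ≤ p) (k : ℕ) :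
    ∫⁻ ω, ‖scheme N τ F R b X₀ k ω - scheme N τ F R b X₀' k ω‖ₑ ^ (2 * p) ∂P ≤
      (∫⁻ ω, ‖galerkinProj N (X₀ ω) - galerkinProj N (X₀' ω)‖ₑ ^ (2 * p) ∂P) *
        ENNReal.ofReal (Real.exp (-(eigval 0 - K) * p * (k * τ))) := by
  rw [← lintegral_mul_const' _ _ ENNReal.ofReal_ne_top]
  refine lintegral_mono fun ω => ?_
  have hp0 : 0 ≤ 2 * p := by linarith
  have h1 : ‖scheme N τ F R b X₀ k ω - scheme N τ F R b X₀' k ω‖ₑ ≤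
      ENNReal.ofReal (Real.exp (-(1 / 2) * (eigval 0 - K) * (k * τ))) *
        ‖galerkinProj N (X₀ ω) - galerkinProj N (X₀' ω)‖ₑ := by
    rw [← ofReal_norm, ← ofReal_norm, ← ENNReal.ofReal_mul (Real.exp_pos _).le]
    exact ENNReal.ofReal_le_ofReal (h.norm_scheme_sub_le X₀ X₀' k ω)
  refine (ENNReal.rpow_le_rpow h1 hp0).trans (le_of_eq ?_)
  rw [ENNReal.mul_rpow_of_nonneg _ _ hp0, ENNReal.ofReal_rpow_of_nonneg (Real.exp_pos _).le hp0,
    ← Real.exp_mul, mul_comm]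
  congr 3
  ring

end Setting

/-! ### Iterated random contractions -/

section Iter

variable {E W : Type*} [NormedAddCommGroup E]

/-- The iterates `Φ(⋅, ξ₀) ∘ ⋯ ∘ Φ(⋅, ξₙ₋₁)` at the point `0`. -/
def backwardIter (Φ : E → W → E) : ℕ → (ℕ → W) → E
  | 0, _ => 0
  | n + 1, ξ => Φ (backwardIter Φ n fun i => ξ (i + 1)) (ξ 0)

lemma backwardIter_succ (Φ : E → W → E) (n : ℕ) (ξ : ℕ → W) :
    backwardIter Φ (n + 1) ξ = Φ (backwardIter Φ n fun i => ξ (i + 1)) (ξ 0) := by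
  rw [backwardIter]

/-- `ψ` is bounded by `C` and Lipschitz with constant `l`. -/
structure IsBoundedLip (C l : ℝ) (ψ : E → ℝ) : Prop where
  bound : ∀ x, |ψ x| ≤ C
  lip : ∀ x y, |ψ x - ψ y| ≤ l * ‖x - y‖

lemma IsBoundedLip.continuous {C l : ℝ} {ψ : E → ℝ} (hψ : IsBoundedLip C l ψ) :
    Continuous ψ := by
  refine (LipschitzWith.of_dist_le_mul (K := l.toNNReal) fun x y => ?_).continuous
  rw [dist_eq_norm, dist_eq_norm]
  exact (hψ.lip x y).trans (mul_le_mul_of_nonneg_right (le_max_left _ _) (norm_nonneg _))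

end Iter

lemma map_prod_eq_map_swap {α γ δ : Type*} {mα : MeasurableSpace α} {mγ : MeasurableSpace γ}
    {mδ : MeasurableSpace δ} {I : Measure α} {ν : Measure γ}
    [SFinite I] [SFinite ν] {X : α → δ} (hX : Measurable X) :
    (I.map X).prod ν = (ν.prod I).map fun z => (X z.2, z.1) := by
  have h : ν = ν.map id := Measure.map_id.symm
  conv_lhs => rw [h]
  rw [Measure.map_prod_map _ _ hX measurable_id, ← Measure.prod_swap,
    Measure.map_map (hX.prodMap measurable_id) measurable_swap]
  rfl

section RandomContraction

variable {E W : Type*} [NormedAddCommGroup E] [MeasurableSpace E] [MeasurableSpace W]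

/-- The random map `Φ` with noise law `ν` contracts distances by `ρ < 1`. -/
structure RandomContraction (Φ : E → W → E) (ν : Measure W) (ρ : ℝ) : Prop where
  measurable : Measurable fun z : E × W => Φ z.1 z.2
  nonneg : 0 ≤ ρ
  lt_one : ρ < 1
  contraction : ∀ x y w, ‖Φ x w - Φ y w‖ ≤ ρ * ‖x - y‖
  integrable : ∫⁻ w, ‖Φ 0 w‖ₑ ∂ν < ∞

/-- The law of `Φ x w` if `x` has law `μ` and `w` is independent with law `ν`. -/
def pushLaw (Φ : E → W → E) (ν : Measure W) (μ : Measure E) : Measure E :=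
  (μ.prod ν).map fun z => Φ z.1 z.2

/-- The sequence `w, ξ₀, ξ₁, …`. -/
def consSeq (w : W) (ξ : ℕ → W) : ℕ → W
  | 0 => w
  | n + 1 => ξ n

lemma measurable_consSeq : Measurable fun z : W × (ℕ → W) => consSeq z.1 z.2 := by
  refine measurable_pi_iff.2 fun n => ?_
  cases n with
  | zero => exact measurable_fst
  | succ n => exact (measurable_pi_apply n).comp measurable_snd

/-- Prepending an independent copy leaves the i.i.d. law unchanged; this is the stationarity that
produces the invariant measure. -/
lemma map_consSeq (ν : Measure W) [IsProbabilityMeasure ν] :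
    (ν.prod (Measure.infinitePi fun _ : ℕ => ν)).map (fun z => consSeq z.1 z.2) =
      Measure.infinitePi fun _ : ℕ => ν := by
  refine Measure.eq_infinitePi (fun _ : ℕ => ν) fun s t ht => ?_
  -- Cylinders are extended to an initial segment of indices, with the whole space in the new
  -- coordinates, so that index `0` can be split off and the rest shifted.
  obtain ⟨m, hm⟩ : ∃ m, s ⊆ Finset.range (m + 1) :=
    ⟨s.sup id, fun i hi => Finset.mem_range.2 (Nat.lt_succ_of_le (Finset.le_sup (f := id) hi))⟩
  classical
  set t' : ℕ → Set W := fun i => if i ∈ s then t i else univ with ht'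
  have hmt : ∀ i, MeasurableSet (t' i) := fun i => by
    simp only [ht']
    split_ifs
    · exact ht i
    · exact MeasurableSet.univ
  have hset : (s : Set ℕ).pi t = ((Finset.range (m + 1) : Finset ℕ) : Set ℕ).pi t' := by
    ext ξ
    simp only [Set.mem_pi, Finset.mem_coe, ht']
    constructor
    · intro h i _
      split_ifs with hi
      · exact h i hi
      · exact mem_univ _
    · intro h i hi
      have := h i (hm hi)
      rwa [if_pos hi] at this
  have hprod : ∏ i ∈ s, ν (t i) = ∏ i ∈ Finset.range (m + 1), ν (t' i) := by
    rw [← Finset.prod_subset hm]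
    · exact Finset.prod_congr rfl fun i hi => by simp [ht', hi]
    · intro i _ hi
      simp [ht', hi]
  have hpre : (fun z : W × (ℕ → W) => consSeq z.1 z.2) ⁻¹' ((s : Set ℕ).pi t) =
      t' 0 ×ˢ ((Finset.range m : Finset ℕ) : Set ℕ).pi fun i => t' (i + 1) := by
    rw [hset]
    ext ⟨w, ξ⟩
    simp only [mem_preimage, Set.mem_pi, Finset.mem_coe, Finset.mem_range, mem_prod]
    constructor
    · intro h
      exact ⟨h 0 m.succ_pos, fun i hi => h (i + 1) (Nat.succ_lt_succ hi)⟩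
    · rintro ⟨h0, h1⟩ i hi
      cases i with
      | zero => exact h0
      | succ i => exact h1 i (Nat.lt_of_succ_lt_succ hi)
  rw [Measure.map_apply measurable_consSeq
    (MeasurableSet.pi s.countable_toSet fun i _ => ht i), hpre, Measure.prod_prod,
    Measure.infinitePi_pi _ fun i _ => hmt (i + 1), hprod, Finset.prod_range_succ', mul_comm]

namespace RandomContraction

variable {Φ : E → W → E} {ν : Measure W} {ρ : ℝ}

lemma measurable_backwardIter (h : RandomContraction Φ ν ρ) (n : ℕ) :
    Measurable (backwardIter Φ n) := by
  induction n with
  | zero =>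
    have : backwardIter Φ 0 = fun _ => 0 := by ext1 ξ; rw [backwardIter]
    rw [this]
    exact measurable_const
  | succ n ih =>
    have h1 : Measurable fun ξ : ℕ → W => (backwardIter Φ n fun i => ξ (i + 1), ξ 0) := by
      refine Measurable.prodMk (ih.comp ?_) (measurable_pi_apply 0)
      exact measurable_pi_iff.2 fun i => measurable_pi_apply (i + 1)
    have h2 : backwardIter Φ (n + 1) = (fun z : E × W => Φ z.1 z.2) ∘
        fun ξ : ℕ → W => (backwardIter Φ n fun i => ξ (i + 1), ξ 0) := by
      ext1 ξ
      rw [backwardIter_succ, Function.comp_apply]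
    rw [h2]
    exact h.measurable.comp h1

/-- One more iteration changes only the innermost map, and the `n` outer contractions damp the
change. For the forward chain the newest map would be the outermost and no pathwise convergence
could be expected. -/
lemma norm_backwardIter_sub_le (h : RandomContraction Φ ν ρ) (n : ℕ) (ξ : ℕ → W) :
    ‖backwardIter Φ (n + 1) ξ - backwardIter Φ n ξ‖ ≤ ρ ^ n * ‖Φ 0 (ξ n)‖ := by
  induction n generalizing ξ with
  | zero => simp [backwardIter]
  | succ n ih =>
    rw [backwardIter_succ, backwardIter_succ Φ n, pow_succ', mul_assoc]
    exact (h.contraction _ _ _).trans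
      (mul_le_mul_of_nonneg_left (ih fun i => ξ (i + 1)) h.nonneg)

lemma measurable_right (h : RandomContraction Φ ν ρ) (x : E) : Measurable (Φ x) :=
  h.measurable.comp measurable_prodMk_left

lemma continuous_left (h : RandomContraction Φ ν ρ) (w : W) : Continuous fun x => Φ x w := by
  refine (LipschitzWith.of_dist_le_mul (K := ⟨ρ, h.nonneg⟩) fun x y => ?_).continuous
  rw [dist_eq_norm, dist_eq_norm]
  exact h.contraction x y w

/-- The expected total length of the increments is at most a geometric series times the mean of `‖Φ
0 w‖`, hence the sequence is almost surely Cauchy. -/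
lemma ae_exists_tendsto_backwardIter [BorelSpace E] [CompleteSpace E] [IsProbabilityMeasure ν]
    (h : RandomContraction Φ ν ρ) : ∀ᵐ ξ ∂Measure.infinitePi fun _ : ℕ => ν,
      ∃ l, Tendsto (fun n => backwardIter Φ n ξ) atTop (𝓝 l) := by
  have hmeas : ∀ n : ℕ, Measurable fun ξ : ℕ → W => ENNReal.ofReal ρ ^ n * ‖Φ 0 (ξ n)‖ₑ :=
    fun n => (((h.measurable_right 0).comp (measurable_pi_apply n)).enorm).const_mul _
  have h1 : ∫⁻ ξ, ∑' n : ℕ, ENNReal.ofReal ρ ^ n * ‖Φ 0 (ξ n)‖ₑ ∂Measure.infinitePi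
      (fun _ : ℕ => ν) < ∞ := by
    rw [lintegral_tsum fun n => (hmeas n).aemeasurable]
    have h2 : ∀ n : ℕ, ∫⁻ ξ, ENNReal.ofReal ρ ^ n * ‖Φ 0 (ξ n)‖ₑ ∂Measure.infinitePi
        (fun _ : ℕ => ν) = ENNReal.ofReal ρ ^ n * ∫⁻ w, ‖Φ 0 w‖ₑ ∂ν := fun n => by
      have h3 : Measurable fun ξ : ℕ → W => ‖Φ 0 (ξ n)‖ₑ :=
        ((h.measurable_right 0).comp (measurable_pi_apply n)).enorm
      rw [lintegral_const_mul _ h3]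
      congr 1
      exact (measurePreserving_eval_infinitePi (fun _ : ℕ => ν) n).lintegral_comp
        (h.measurable_right 0).enorm
    simp_rw [h2]
    rw [ENNReal.tsum_mul_right, ENNReal.tsum_geometric]
    refine ENNReal.mul_lt_top ?_ h.integrable
    rw [ENNReal.inv_lt_top, tsub_pos_iff_lt, ENNReal.ofReal_lt_one]
    exact h.lt_one
  filter_upwards [ae_lt_top (Measurable.tsum hmeas) h1.ne] with ξ hξ
  refine cauchySeq_tendsto_of_complete (cauchySeq_of_edist_le_of_tsum_ne_top
    (fun n : ℕ => ENNReal.ofReal ρ ^ n * ‖Φ 0 (ξ n)‖ₑ) (fun n => ?_) hξ.ne)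
  rw [edist_comm, edist_eq_enorm_sub, ← ofReal_norm, ← ofReal_norm,
    ← ENNReal.ofReal_pow h.nonneg, ← ENNReal.ofReal_mul (pow_nonneg h.nonneg _)]
  exact ENNReal.ofReal_le_ofReal (h.norm_backwardIter_sub_le n ξ)

/-- Existence of an invariant law, as the law of an almost sure limit. -/
lemma exists_invariant [BorelSpace E] [SecondCountableTopology E] [CompleteSpace E]
    [IsProbabilityMeasure ν] (h : RandomContraction Φ ν ρ) :
    ∃ X : (ℕ → W) → E, Measurable X ∧
      (∀ᵐ ξ ∂Measure.infinitePi fun _ : ℕ => ν,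
        Tendsto (fun n => backwardIter Φ n ξ) atTop (𝓝 (X ξ))) ∧
      pushLaw Φ ν ((Measure.infinitePi fun _ : ℕ => ν).map X) =
        (Measure.infinitePi fun _ : ℕ => ν).map X := by
  set I := Measure.infinitePi fun _ : ℕ => ν with hI
  obtain ⟨X, hX, hlim⟩ := measurable_limit_of_tendsto_metrizable_ae
    (fun n => (h.measurable_backwardIter n).aemeasurable) h.ae_exists_tendsto_backwardIter
  refine ⟨X, hX, hlim, ?_⟩
  -- Passing to the limit in the recursion of the backward iterates. The left side has the law of
  -- `X`, the right side the law after one step, which is invariance.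
  have h1 : ∀ᵐ z ∂ν.prod I, X (consSeq z.1 z.2) = Φ (X z.2) z.1 := by
    have h2 : ∀ᵐ z ∂ν.prod I, Tendsto (fun n => backwardIter Φ n (consSeq z.1 z.2)) atTop
        (𝓝 (X (consSeq z.1 z.2))) := by
      refine ae_of_ae_map (f := fun z : W × (ℕ → W) => consSeq z.1 z.2)
        (p := fun ζ => Tendsto (fun n => backwardIter Φ n ζ) atTop (𝓝 (X ζ)))
        measurable_consSeq.aemeasurable ?_
      rw [hI, map_consSeq]
      exact hlim
    have h3 : ∀ᵐ z ∂ν.prod I, Tendsto (fun n => backwardIter Φ n z.2) atTop (𝓝 (X z.2)) :=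
      Measure.quasiMeasurePreserving_snd.ae hlim
    filter_upwards [h2, h3] with z hz2 hz3
    refine tendsto_nhds_unique ((tendsto_add_atTop_iff_nat 1).2 hz2) ?_
    simp_rw [backwardIter_succ]
    exact ((h.continuous_left z.1).tendsto _).comp hz3
  have hsw : Measurable fun z : W × (ℕ → W) => (X z.2, z.1) :=
    (hX.comp measurable_snd).prodMk measurable_fst
  rw [pushLaw, map_prod_eq_map_swap hX, Measure.map_map h.measurable hsw]
  calc (ν.prod I).map ((fun z : E × W => Φ z.1 z.2) ∘ fun z : W × (ℕ → W) => (X z.2, z.1))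
      = (ν.prod I).map (X ∘ fun z : W × (ℕ → W) => consSeq z.1 z.2) := by
        refine Measure.map_congr ?_
        filter_upwards [h1] with z hz
        exact hz.symm
    _ = I.map X := by
        rw [← Measure.map_map hX measurable_consSeq, hI, map_consSeq]

/-- The laws of the backward iterates evolve by `pushLaw`. -/
lemma map_backwardIter_succ [IsProbabilityMeasure ν] (h : RandomContraction Φ ν ρ) (n : ℕ) :
    (Measure.infinitePi fun _ : ℕ => ν).map (backwardIter Φ (n + 1)) =
      pushLaw Φ ν ((Measure.infinitePi fun _ : ℕ => ν).map (backwardIter Φ n)) := by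
  set I := Measure.infinitePi fun _ : ℕ => ν with hI
  have hX := h.measurable_backwardIter n
  have hsw : Measurable fun z : W × (ℕ → W) => (backwardIter Φ n z.2, z.1) :=
    (hX.comp measurable_snd).prodMk measurable_fst
  rw [pushLaw, map_prod_eq_map_swap hX, Measure.map_map h.measurable hsw]
  conv_lhs => rw [hI, ← map_consSeq,
    Measure.map_map (h.measurable_backwardIter (n + 1)) measurable_consSeq]
  congr 1

/-! ### Exponential mixing -/

/-- The transition operator on functions. -/
def transitionOp (Φ : E → W → E) (ν : Measure W) (ψ : E → ℝ) (x : E) : ℝ := ∫ w, ψ (Φ x w) ∂ν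

lemma integrable_of_isBoundedLip [OpensMeasurableSpace E] [SecondCountableTopology E]
    {μ : Measure E} [IsFiniteMeasure μ] {C l : ℝ} {ψ : E → ℝ} (hψ : IsBoundedLip C l ψ) :
    Integrable ψ μ :=
  Integrable.of_bound hψ.continuous.aestronglyMeasurable C (Eventually.of_forall hψ.bound)

lemma isProbabilityMeasure_pushLaw [IsProbabilityMeasure ν] (h : RandomContraction Φ ν ρ)
    (μ : Measure E) [IsProbabilityMeasure μ] : IsProbabilityMeasure (pushLaw Φ ν μ) :=
  Measure.isProbabilityMeasure_map h.measurable.aemeasurable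

lemma integrable_comp [OpensMeasurableSpace E] [IsProbabilityMeasure ν]
    (h : RandomContraction Φ ν ρ) {C l : ℝ} {ψ : E → ℝ}
    (hψ : IsBoundedLip C l ψ) (x : E) : Integrable (fun w => ψ (Φ x w)) ν :=
  Integrable.of_bound (hψ.continuous.measurable.comp (h.measurable_right x)).aestronglyMeasurable C
    (Eventually.of_forall fun _ => hψ.bound _)

/-- Synchronous coupling: two starting points receive the same noise, so the Lipschitz constant
shrinks by `ρ` while the sup bound is kept. -/
lemma isBoundedLip_transitionOp [OpensMeasurableSpace E] [IsProbabilityMeasure ν]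
    (h : RandomContraction Φ ν ρ) {C l : ℝ}
    (hl : 0 ≤ l) {ψ : E → ℝ} (hψ : IsBoundedLip C l ψ) :
    IsBoundedLip C (ρ * l) (transitionOp Φ ν ψ) where
  bound x := by
    have := norm_integral_le_of_norm_le_const (μ := ν) (f := fun w => ψ (Φ x w)) (C := C)
      (Eventually.of_forall fun w => hψ.bound _)
    simpa [transitionOp] using this
  lip x y := by
    rw [transitionOp, transitionOp, ← integral_sub (h.integrable_comp hψ x)
      (h.integrable_comp hψ y)]
    have := norm_integral_le_of_norm_le_const (μ := ν) (f := fun w => ψ (Φ x w) - ψ (Φ y w))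
      (C := ρ * l * ‖x - y‖) (Eventually.of_forall fun w => (hψ.lip _ _).trans ?_)
    · simpa using this
    · rw [mul_comm ρ, mul_assoc]
      exact mul_le_mul_of_nonneg_left (h.contraction x y w) hl

lemma isBoundedLip_transitionOp_iterate [OpensMeasurableSpace E] [IsProbabilityMeasure ν]
    (h : RandomContraction Φ ν ρ)
    {C l : ℝ} (hl : 0 ≤ l) {ψ : E → ℝ} (hψ : IsBoundedLip C l ψ) (k : ℕ) :
    IsBoundedLip C (ρ ^ k * l) ((transitionOp Φ ν)^[k] ψ) := by
  induction k with
  | zero => simpa using hψ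
  | succ k ih =>
    rw [Function.iterate_succ_apply', pow_succ', mul_assoc]
    exact h.isBoundedLip_transitionOp (mul_nonneg (pow_nonneg h.nonneg k) hl) ih

variable [BorelSpace E] [SecondCountableTopology E]

lemma integral_pushLaw [IsProbabilityMeasure ν] (h : RandomContraction Φ ν ρ) {C l : ℝ}
    {ψ : E → ℝ} (hψ : IsBoundedLip C l ψ) (μ : Measure E) [IsProbabilityMeasure μ] :
    ∫ x, ψ x ∂pushLaw Φ ν μ = ∫ x, transitionOp Φ ν ψ x ∂μ := by
  rw [pushLaw, integral_map h.measurable.aemeasurable hψ.continuous.aestronglyMeasurable,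
    integral_prod]
  · rfl
  · exact Integrable.of_bound (hψ.continuous.measurable.comp h.measurable).aestronglyMeasurable C
      (Eventually.of_forall fun z => hψ.bound _)

lemma integral_pushLaw_iterate [IsProbabilityMeasure ν] (h : RandomContraction Φ ν ρ) {C l : ℝ}
    (hl : 0 ≤ l) {ψ : E → ℝ} (hψ : IsBoundedLip C l ψ) (μ : Measure E) [IsProbabilityMeasure μ]
    (k : ℕ) : ∫ x, ψ x ∂(pushLaw Φ ν)^[k] μ = ∫ x, (transitionOp Φ ν)^[k] ψ x ∂μ := by
  induction k generalizing μ with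
  | zero => rfl
  | succ k ih =>
    have := h.isProbabilityMeasure_pushLaw μ
    rw [Function.iterate_succ_apply, ih, Function.iterate_succ_apply',
      h.integral_pushLaw (h.isBoundedLip_transitionOp_iterate hl hψ k)]

lemma abs_integral_sub_le [IsProbabilityMeasure ν] (h : RandomContraction Φ ν ρ) {C l : ℝ}
    (hl : 0 ≤ l) {ψ : E → ℝ} (hψ : IsBoundedLip C l ψ) (μ : Measure E) [IsProbabilityMeasure μ]
    (hμ : Integrable (fun x => ‖x‖) μ) (k : ℕ) :
    |∫ x, ψ x ∂(pushLaw Φ ν)^[k] μ - (transitionOp Φ ν)^[k] ψ 0| ≤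
      ρ ^ k * l * ∫ x, ‖x‖ ∂μ := by
  have hk := h.isBoundedLip_transitionOp_iterate hl hψ k
  rw [h.integral_pushLaw_iterate hl hψ μ k, ← integral_const_mul (ρ ^ k * l) fun x : E => ‖x‖]
  have h1 : ∫ x, (transitionOp Φ ν)^[k] ψ x ∂μ - (transitionOp Φ ν)^[k] ψ 0 =
      ∫ x, ((transitionOp Φ ν)^[k] ψ x - (transitionOp Φ ν)^[k] ψ 0) ∂μ := by
    rw [integral_sub (integrable_of_isBoundedLip hk) (integrable_const _)]
    simp
  rw [h1, ← Real.norm_eq_abs]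
  refine norm_integral_le_of_norm_le (hμ.const_mul _) (Eventually.of_forall fun x => ?_)
  have := hk.lip x 0
  rwa [sub_zero] at this

/-- Exponential convergence to an invariant law. -/
lemma abs_integral_sub_integral_le [IsProbabilityMeasure ν] (h : RandomContraction Φ ν ρ)
    {C l : ℝ} (hl : 0 ≤ l) {ψ : E → ℝ} (hψ : IsBoundedLip C l ψ) (μ π : Measure E)
    [IsProbabilityMeasure μ] [IsProbabilityMeasure π] (hμ : Integrable (fun x => ‖x‖) μ)
    (hπ : Integrable (fun x => ‖x‖) π) (hinv : pushLaw Φ ν π = π) (k : ℕ) :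
    |∫ x, ψ x ∂(pushLaw Φ ν)^[k] μ - ∫ x, ψ x ∂π| ≤
      ρ ^ k * l * (∫ x, ‖x‖ ∂μ + ∫ x, ‖x‖ ∂π) := by
  have h1 := h.abs_integral_sub_le hl hψ μ hμ k
  have h2 := h.abs_integral_sub_le hl hψ π hπ k
  rw [Function.iterate_fixed hinv] at h2
  rw [abs_le] at h1 h2 ⊢
  constructor <;> linarith [h1.1, h1.2, h2.1, h2.2]

/-- Dominated convergence with a bounded `ψ` needs no moment of `π`, so uniqueness holds among all
invariant probability laws. -/
lemma tendsto_transitionOp_iterate [IsProbabilityMeasure ν] (h : RandomContraction Φ ν ρ)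
    {C l : ℝ} (hl : 0 ≤ l) {ψ : E → ℝ} (hψ : IsBoundedLip C l ψ) (π : Measure E)
    [IsProbabilityMeasure π] (hinv : pushLaw Φ ν π = π) :
    Tendsto (fun k => (transitionOp Φ ν)^[k] ψ 0) atTop (𝓝 (∫ x, ψ x ∂π)) := by
  have hk := h.isBoundedLip_transitionOp_iterate hl hψ
  have h1 : Tendsto (fun k => ∫ x, ((transitionOp Φ ν)^[k] ψ 0 - (transitionOp Φ ν)^[k] ψ x) ∂π)
      atTop (𝓝 (∫ _, (0 : ℝ) ∂π)) := by
    refine tendsto_integral_of_dominated_convergence (fun _ => C + C) (fun k => ?_)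
      (integrable_const _) (fun k => Eventually.of_forall fun x => ?_)
      (Eventually.of_forall fun x => ?_)
    · exact (continuous_const.sub (hk k).continuous).aestronglyMeasurable
    · exact (norm_sub_le _ _).trans (add_le_add ((hk k).bound 0) ((hk k).bound x))
    · refine squeeze_zero_norm (a := fun k => ρ ^ k * l * ‖0 - x‖)
        (fun k => (hk k).lip 0 x) ?_
      have := ((tendsto_pow_atTop_nhds_zero_of_lt_one h.nonneg h.lt_one).mul_const l).mul_const
        ‖0 - x‖
      simpa using this
  have h2 : ∀ k, ∫ x, ((transitionOp Φ ν)^[k] ψ 0 - (transitionOp Φ ν)^[k] ψ x) ∂π =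
      (transitionOp Φ ν)^[k] ψ 0 - ∫ x, ψ x ∂π := by
    intro k
    rw [integral_sub (integrable_const _) (integrable_of_isBoundedLip (hk k)),
      ← h.integral_pushLaw_iterate hl hψ π k, Function.iterate_fixed hinv]
    simp
  simp_rw [h2, integral_zero] at h1
  simpa using h1.add_const (∫ x, ψ x ∂π)

/-- Uniqueness of the invariant law. -/
lemma eq_of_invariant [IsProbabilityMeasure ν] (h : RandomContraction Φ ν ρ) {π π' : Measure E}
    [IsProbabilityMeasure π] [IsProbabilityMeasure π'] (hinv : pushLaw Φ ν π = π)
    (hinv' : pushLaw Φ ν π' = π') : π' = π := by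
  obtain ⟨m, hm⟩ : ∃ m : ProbabilityMeasure E, (m : Measure E) = π := ⟨⟨π, inferInstance⟩, rfl⟩
  obtain ⟨m', hm'⟩ : ∃ m : ProbabilityMeasure E, (m : Measure E) = π' := ⟨⟨π', inferInstance⟩, rfl⟩
  -- Bounded Lipschitz functions determine weak convergence. Both laws integrate them to the same
  -- limit of iterates at `0`, so the constant sequence `m'` converges to `m`, and limits are
  -- unique.
  have h1 : Tendsto (fun _ : ℕ => m') atTop (𝓝 m) := by
    refine tendsto_iff_forall_lipschitz_integral_tendsto.2 fun ψ ⟨C, hC⟩ ⟨l, hl⟩ => ?_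
    have hψ : IsBoundedLip (C + |ψ 0|) l ψ := by
      refine ⟨fun x => ?_, fun x y => ?_⟩
      · have h2 := hC x 0
        rw [Real.dist_eq] at h2
        have h3 := abs_sub_abs_le_abs_sub (ψ x) (ψ 0)
        linarith
      · have := hl.dist_le_mul x y
        rwa [dist_eq_norm, dist_eq_norm] at this
    have h2 := tendsto_nhds_unique (h.tendsto_transitionOp_iterate l.2 hψ π hinv)
      (h.tendsto_transitionOp_iterate l.2 hψ π' hinv')
    rw [hm, hm', h2]
    exact tendsto_const_nhds
  rw [← hm, ← hm', tendsto_nhds_unique tendsto_const_nhds h1]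

end RandomContraction

end RandomContraction

/-! ### The invariant measure of the scheme -/

lemma schemeStep_mem_galerkinSpace (N : ℕ) (τ : ℝ≥0) (F : H → H) (x w : H) :
    schemeStep N τ F x w ∈ galerkinSpace N := by
  rw [schemeStep_eq, galerkinSemigroup]
  refine Submodule.sum_mem _ fun i hi => Submodule.smul_mem _ _ (Submodule.subset_span ?_)
  exact mem_image_of_mem e (Finset.mem_range.1 hi)

lemma measurableSet_galerkinSpace (N : ℕ) : MeasurableSet (galerkinSpace N : Set H) := by
  have : FiniteDimensional ℝ (galerkinSpace N) :=
    FiniteDimensional.span_of_finite ℝ ((finite_Iio N).image e)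
  exact (Submodule.closed_of_finiteDimensional _).measurableSet

lemma transitionKernel_comp {Ω : Type*} [MeasurableSpace Ω] (P : Measure Ω) [IsFiniteMeasure P]
    (N : ℕ) (τ : ℝ≥0) {F : H → H} (hF : Continuous F) (R : H →L[ℝ] H) (b : ℕ → ℝ≥0 → Ω → ℝ)
    (μ : Measure H) : μ.bind (transitionKernel P N τ F R b) =
      pushLaw (schemeStep N τ F) (P.map (noiseIncrement N τ R b 0)) μ := by
  have hm := measurable_schemeStep N τ hF
  ext s hs
  rw [Measure.bind_apply hs (Kernel.aemeasurable _), pushLaw, Measure.map_apply hm hs,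
    Measure.prod_apply (hm hs)]
  refine lintegral_congr fun x => ?_
  rw [transitionKernel, Kernel.map_apply _ hm, Kernel.prod_apply, Kernel.id_apply,
    Kernel.const_apply, Measure.map_apply hm hs, Measure.dirac_prod,
    Measure.map_apply measurable_prodMk_left (hm hs)]

lemma measurable_section {α γ δ : Type*} [MeasurableSpace α] [MeasurableSpace γ]
    [MeasurableSpace δ] {f : α → γ → δ} (hf : Measurable fun z : α × γ => f z.1 z.2) (x : α) :
    Measurable (f x) := hf.comp measurable_prodMk_left

/-- The increments of all Brownian motions over `[kτ, (k+1)τ]`. -/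
def brownianIncrement (b : ℕ → ℝ≥0 → Ω → ℝ) (τ : ℝ≥0) (k : ℕ) (ω : Ω) (j : ℕ) : ℝ :=
  b j ((k + 1 : ℕ) * τ) ω - b j (k * τ) ω

/-- The noise increment as a function of the Brownian increments. -/
def noiseMap (N : ℕ) (σ : ℕ → ℝ) (y : ℕ → ℝ) : H :=
  ∑ i ∈ Finset.range N, (σ i * y i) • e i

lemma measurable_noiseMap (N : ℕ) (σ : ℕ → ℝ) : Measurable (noiseMap N σ) := by
  unfold noiseMap
  refine Finset.measurable_fun_sum _ fun i _ => ?_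
  have hi : Measurable fun y : ℕ → ℝ => y i := measurable_pi_apply i
  exact (hi.const_mul (σ i)).smul_const (e i)

lemma integrable_norm_of_eLpNorm_two {μ : Measure H} [IsProbabilityMeasure μ]
    (h : eLpNorm id 2 μ < ∞) : Integrable (fun x : H => ‖x‖) μ := by
  have h1 : MemLp id 2 μ := ⟨aestronglyMeasurable_id, h⟩
  exact (h1.integrable one_le_two).norm

lemma IsCb1.isBoundedLip {ψ : H → ℝ} (hψ : IsCb1 ψ) :
    IsBoundedLip (cb1Norm ψ) (cb1Norm ψ) ψ where
  bound x := (le_ciSup hψ.bounded x).trans (le_max_left _ _)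
  lip x y := by
    have := Convex.norm_image_sub_le_of_norm_fderiv_le (𝕜 := ℝ) (f := ψ) (C := cb1Norm ψ)
      (fun x _ => (hψ.contDiff.differentiable one_ne_zero).differentiableAt)
      (fun x _ => (le_ciSup hψ.deriv_bounded x).trans (le_max_right _ _)) convex_univ
      (mem_univ y) (mem_univ x)
    exact this

namespace Setting

variable {Ω : Type*} {mΩ : MeasurableSpace Ω} {K L B M β : ℝ} {F : H → H} {R : H →L[ℝ] H}
  {σ : ℕ → ℝ} {P : Measure Ω} {ℱ : Filtration ℝ≥0 mΩ} {b : ℕ → ℝ≥0 → Ω → ℝ} {N : ℕ} {τ : ℝ≥0}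

/-! ### Stationary noise increments and the Markov property. -/

lemma noiseIncrement_eq (h : Setting K L B M β F R σ P ℱ b N τ) (k : ℕ) :
    noiseIncrement N τ R b k = noiseMap N σ ∘ brownianIncrement b τ k := by
  ext1 ω
  rw [noiseIncrement, galerkinNoise_eq h.diagonal, galerkinNoise_eq h.diagonal,
    ← Finset.sum_sub_distrib]
  refine Finset.sum_congr rfl fun i _ => ?_
  rw [← sub_smul, ← mul_sub, brownianIncrement]

lemma measurable_brownian (h : Setting K L B M β F R σ P ℱ b N τ) (j : ℕ) (t : ℝ≥0) :
    Measurable (b j t) := (h.brownian.adapted j t).mono (ℱ.le t) le_rfl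

lemma measurable_brownianIncrement (h : Setting K L B M β F R σ P ℱ b N τ) (k : ℕ) :
    Measurable (brownianIncrement b τ k) :=
  measurable_pi_iff.2 fun j => (h.measurable_brownian j _).sub (h.measurable_brownian j _)

/-- The joint law of all increments over a grid cell is the same Gaussian product for every cell, so
the chain is time-homogeneous. -/
lemma map_brownianIncrement [IsProbabilityMeasure P] (h : Setting K L B M β F R σ P ℱ b N τ)
    (k : ℕ) : P.map (brownianIncrement b τ k) = Measure.infinitePi fun _ => gaussianReal 0 τ := by
  have hm : ∀ j, Measurable fun ω => b j ((k + 1 : ℕ) * τ) ω - b j (k * τ) ω := fun j =>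
    (h.measurable_brownian j _).sub (h.measurable_brownian j _)
  have hind : iIndepFun (fun j ω => b j ((k + 1 : ℕ) * τ) ω - b j (k * τ) ω) P :=
    h.brownian.iIndep.comp (fun _ f => f ((k + 1 : ℕ) * τ) - f (k * τ)) fun _ =>
      (measurable_pi_apply _).sub (measurable_pi_apply _)
  have h1 := (iIndepFun_iff_map_fun_eq_infinitePi_map hm).1 hind
  refine h1.trans ?_
  congr 1
  ext1 j
  have h2 := ((h.brownian.isBrownian j).toIsPreBrownianReal.hasLaw_sub
    ((k + 1 : ℕ) * τ) (k * τ)).map_eq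
  refine Eq.trans ?_ (h2.trans ?_)
  · rfl
  · congr 1
    ext
    rw [coe_nndist, Real.dist_eq]
    change |((((k + 1 : ℕ) * τ : ℝ≥0) : ℝ)) - ((k * τ : ℝ≥0) : ℝ)| = τ
    push_cast
    rw [show ((k : ℝ) + 1) * τ - k * τ = τ by ring, abs_of_nonneg τ.coe_nonneg]

lemma map_noiseIncrement [IsProbabilityMeasure P] (h : Setting K L B M β F R σ P ℱ b N τ)
    (k : ℕ) : P.map (noiseIncrement N τ R b k) = P.map (noiseIncrement N τ R b 0) := by
  rw [h.noiseIncrement_eq, h.noiseIncrement_eq,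
    ← Measure.map_map (measurable_noiseMap N σ) (h.measurable_brownianIncrement _),
    ← Measure.map_map (measurable_noiseMap N σ) (h.measurable_brownianIncrement _),
    h.map_brownianIncrement, h.map_brownianIncrement]

lemma scheme_succ_eq (N : ℕ) (τ : ℝ≥0) (F : H → H) (R : H →L[ℝ] H) (b : ℕ → ℝ≥0 → Ω → ℝ)
    (X₀ : Ω → H) (k : ℕ) : scheme N τ F R b X₀ (k + 1) =
      (fun z : H × H => schemeStep N τ F z.1 z.2) ∘
        fun ω => (scheme N τ F R b X₀ k ω, noiseIncrement N τ R b k ω) := by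
  ext1 ω
  rw [scheme, Function.comp_apply]

lemma measurable_scheme_filtration (h : Setting K L B M β F R σ P ℱ b N τ) {X₀ : Ω → H}
    (hX : Measurable[ℱ 0] X₀) (k : ℕ) : Measurable[ℱ (k * τ)] (scheme N τ F R b X₀ k) := by
  induction k with
  | zero =>
    have : scheme N τ F R b X₀ 0 = galerkinProj N ∘ X₀ := by ext1 ω; rw [scheme]; rfl
    rw [this]
    exact (measurable_galerkinProj N).comp (hX.mono (ℱ.mono (zero_le)) le_rfl)
  | succ k ih =>
    have hle : k * τ ≤ (k + 1 : ℕ) * τ := by gcongr; simp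
    have h1 := h.measurable_galerkinNoise_filtration ((k + 1 : ℕ) * τ)
    have h2 := (h.measurable_galerkinNoise_filtration (k * τ)).mono (ℱ.mono hle) le_rfl
    have h3 : Measurable[ℱ ((k + 1 : ℕ) * τ)] (noiseIncrement N τ R b k) := h1.sub h2
    rw [scheme_succ_eq]
    exact (measurable_schemeStep N τ h.drift.continuous).comp
      ((ih.mono (ℱ.mono hle) le_rfl).prodMk h3)

/-- The state at step `k` is known at time `kτ`, and the noise is a function of the joint Brownian
increments after `kτ`. -/
lemma indepFun_scheme_noiseIncrement [IsProbabilityMeasure P]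
    (h : Setting K L B M β F R σ P ℱ b N τ) {X₀ : Ω → H} (hX : Measurable[ℱ 0] X₀) (k : ℕ) :
    IndepFun (scheme N τ F R b X₀ k) (noiseIncrement N τ R b k) P := by
  rw [IndepFun_iff_Indep]
  have hle : k * τ ≤ (k + 1 : ℕ) * τ := by gcongr; simp
  refine indep_of_indep_of_le_left (indep_of_indep_of_le_right
    (h.brownian.indep_increments _ _ hle).symm ?_)
    (h.measurable_scheme_filtration hX k).comap_le
  rw [h.noiseIncrement_eq, ← MeasurableSpace.comap_comp]
  exact MeasurableSpace.comap_mono (measurable_noiseMap N σ).comap_le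

/-- The Markov property of the scheme. -/
lemma map_scheme_succ [IsProbabilityMeasure P] (h : Setting K L B M β F R σ P ℱ b N τ)
    {X₀ : Ω → H} (hX : Measurable[ℱ 0] X₀) (k : ℕ) :
    P.map (scheme N τ F R b X₀ (k + 1)) =
      pushLaw (schemeStep N τ F) (P.map (noiseIncrement N τ R b 0))
        (P.map (scheme N τ F R b X₀ k)) := by
  have hm := h.measurable_scheme (hX.mono (ℱ.le 0) le_rfl) k
  have hn := h.measurable_noiseIncrement k
  rw [pushLaw, ← h.map_noiseIncrement k, ← (indepFun_iff_map_prod_eq_prod_map_map hm.aemeasurable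
    hn.aemeasurable).1 (h.indepFun_scheme_noiseIncrement hX k),
    Measure.map_map (measurable_schemeStep N τ h.drift.continuous) (hm.prodMk hn), scheme_succ_eq]

lemma map_scheme [IsProbabilityMeasure P] (h : Setting K L B M β F R σ P ℱ b N τ)
    {X₀ : Ω → H} (hX : Measurable[ℱ 0] X₀) (k : ℕ) :
    P.map (scheme N τ F R b X₀ k) =
      (pushLaw (schemeStep N τ F) (P.map (noiseIncrement N τ R b 0)))^[k]
        (P.map fun ω => galerkinProj N (X₀ ω)) := by
  induction k with
  | zero =>
    have : scheme N τ F R b X₀ 0 = fun ω => galerkinProj N (X₀ ω) := by ext1 ω; rw [scheme]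
    rw [this, Function.iterate_zero, id]
  | succ k ih => rw [h.map_scheme_succ hX, ih, Function.iterate_succ_apply']

lemma eLpNorm_scheme_zero_le [IsProbabilityMeasure P] (h : Setting K L B M β F R σ P ℱ b N τ)
    {p : ℝ≥0∞} (hp : 1 ≤ p) (k : ℕ) :
    eLpNorm (scheme N τ F R b (fun _ => 0) k) (2 * p) P ≤ schemeBound K L B M p := by
  refine (h.eLpNorm_scheme_le measurable_const hp k).trans ?_
  simp [galerkinProj]

lemma randomContraction [IsProbabilityMeasure P] (h : Setting K L B M β F R σ P ℱ b N τ) :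
    RandomContraction (schemeStep N τ F) (P.map (noiseIncrement N τ R b 0))
      (Real.exp (-(1 / 2) * (eigval 0 - K) * τ)) where
  measurable := measurable_schemeStep N τ h.drift.continuous
  nonneg := (Real.exp_pos _).le
  lt_one := by
    rw [Real.exp_lt_one_iff]
    have := mul_pos h.drift.gap_pos (NNReal.coe_pos.2 h.step_pos)
    linarith
  contraction := norm_schemeStep_sub_le h.drift N h.step_le
  integrable := by
    have hm : Measurable (schemeStep N τ F 0) :=
      measurable_section (measurable_schemeStep N τ h.drift.continuous) 0
    rw [lintegral_map hm.enorm (h.measurable_noiseIncrement 0)]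
    -- The random map at `0` is the first step of the scheme started from zero, so its first moment
    -- is already bounded.
    have h1 : ∀ ω, schemeStep N τ F 0 (noiseIncrement N τ R b 0 ω) =
        scheme N τ F R b (fun _ => 0) 1 ω := fun ω => by
      rw [scheme, scheme]
      simp [galerkinProj]
    simp_rw [h1]
    rw [← eLpNorm_one_eq_lintegral_enorm]
    refine (eLpNorm_le_eLpNorm_of_exponent_le (one_le_two.trans_eq (mul_one 2).symm)
      (h.measurable_scheme measurable_const 1).aestronglyMeasurable).trans_lt ?_
    exact (h.eLpNorm_scheme_zero_le le_rfl 1).trans_lt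
      (schemeBound_ne_top K L B M ENNReal.one_ne_top).lt_top

/-- Existence of an invariant law with finite moments. -/
lemma exists_invariant [IsProbabilityMeasure P] (h : Setting K L B M β F R σ P ℱ b N τ) :
    ∃ π : Measure H, IsProbabilityMeasure π ∧
      pushLaw (schemeStep N τ F) (P.map (noiseIncrement N τ R b 0)) π = π ∧
      ∀ p : ℝ≥0∞, 1 ≤ p → eLpNorm id (2 * p) π ≤ schemeBound K L B M p := by
  have hν : IsProbabilityMeasure (P.map (noiseIncrement N τ R b 0)) :=
    Measure.isProbabilityMeasure_map (h.measurable_noiseIncrement 0).aemeasurable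
  have hc := h.randomContraction
  obtain ⟨X, hX, hlim, hinv⟩ := hc.exists_invariant
  set I := Measure.infinitePi fun _ : ℕ => P.map (noiseIncrement N τ R b 0) with hI
  refine ⟨I.map X, Measure.isProbabilityMeasure_map hX.aemeasurable, hinv, fun p hp => ?_⟩
  -- Backward iterates and the chain from `0` differ as processes but agree in law at each `n`, so
  -- the uniform moment bounds of the scheme carry over and Fatou passes them to the limit.
  have hlaw : ∀ n, I.map (backwardIter (schemeStep N τ F) n) =
      P.map (scheme N τ F R b (fun _ => 0) n) := by
    intro n
    induction n with
    | zero =>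
      have h1 : backwardIter (schemeStep N τ F) 0 = fun _ => (0 : H) := by
        ext1 ξ; rw [backwardIter]
      have h2 : scheme N τ F R b (fun _ => 0) 0 = fun _ => (0 : H) := by
        ext1 ω; rw [scheme]; simp [galerkinProj]
      rw [h1, h2, Measure.map_const, Measure.map_const, measure_univ, measure_univ]
    | succ n ih => rw [hc.map_backwardIter_succ, ih, h.map_scheme_succ measurable_const]
  have hbound : ∀ n, eLpNorm (backwardIter (schemeStep N τ F) n) (2 * p) I ≤
      schemeBound K L B M p := fun n => by
    have h1 : eLpNorm (backwardIter (schemeStep N τ F) n) (2 * p) I =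
        eLpNorm id (2 * p) (I.map (backwardIter (schemeStep N τ F) n)) :=
      (eLpNorm_map_measure aestronglyMeasurable_id
        (hc.measurable_backwardIter n).aemeasurable).symm
    rw [h1, hlaw, eLpNorm_map_measure aestronglyMeasurable_id
      (h.measurable_scheme measurable_const n).aemeasurable]
    exact h.eLpNorm_scheme_zero_le hp n
  rw [eLpNorm_map_measure aestronglyMeasurable_id hX.aemeasurable]
  refine (Lp.eLpNorm_lim_le_liminf_eLpNorm
    (fun n => (hc.measurable_backwardIter n).aestronglyMeasurable) X hlim).trans ?_
  exact (liminf_le_liminf (Eventually.of_forall hbound)).trans_eq (by simp)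

end Setting

/-- Constants for the setting are uniform in the covariance operator. -/
lemma CovarianceAssumption.exists_setting {Ω : Type*} [mΩ : MeasurableSpace Ω] {K L B M β : ℝ}
    {F : H → H} {Q R : H →L[ℝ] H} {P : Measure Ω} {ℱ : Filtration ℝ≥0 mΩ} {b : ℕ → ℝ≥0 → Ω → ℝ}
    (hQ : CovarianceAssumption Q R β) (hM : hsNorm (β - 1) R ≤ ENNReal.ofReal M)
    (hF : DriftAssumption F K L) (hB : ‖F 0‖ ≤ B) (hb : IsBrownianFamily P ℱ b) (N : ℕ) {τ : ℝ≥0}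
    (h0 : 0 < τ) (h1 : (τ : ℝ) < 1 / 2) (h2 : (τ : ℝ) ≤ (eigval 0 - K) / (4 * L ^ 2)) :
    ∃ σ, Setting K L B M β F R σ P ℱ b N τ := by
  obtain ⟨σ, hσ⟩ := hQ.exists_sqrt_apply_e
  exact ⟨σ, hF, hB, hQ.pos, hQ.le_one, hσ, sum_le_of_hsNorm_le hσ hM N, hb, h0, h1, h2⟩

lemma norm_galerkinProj_le (N : ℕ) (x : H) : ‖galerkinProj N x‖ ≤ ‖x‖ :=
  (galerkinProj_eq N x).symm ▸ norm_multiplier_one_le N x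

/-! ### Moments of the initial datum. -/

section Initial

variable {Ω : Type*} [mΩ : MeasurableSpace Ω] {P : Measure Ω} {ℱ : Filtration ℝ≥0 mΩ} {β : ℝ}
  {X₀ : Ω → H}

lemma InitialAssumption.measurable_ambient (h : InitialAssumption P ℱ β X₀) : Measurable X₀ :=
  h.measurable.mono (ℱ.le 0) le_rfl

lemma InitialAssumption.integrable_norm_sq (h : InitialAssumption P ℱ β X₀) (N : ℕ) :
    Integrable (fun ω => ‖galerkinProj N (X₀ ω)‖ ^ 2) P := by
  obtain ⟨θ, hθ, hint⟩ := h.exp_moment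
  refine (hint.const_mul θ⁻¹).mono'
    (((measurable_galerkinProj N).comp h.measurable_ambient).norm.pow_const 2).aestronglyMeasurable
    (Eventually.of_forall fun ω => ?_)
  rw [Real.norm_of_nonneg (by positivity), inv_mul_eq_div, le_div_iff₀' hθ]
  have h1 : ‖galerkinProj N (X₀ ω)‖ ^ 2 ≤ ‖X₀ ω‖ ^ 2 := by
    gcongr
    exact norm_galerkinProj_le N _
  have h2 := Real.add_one_le_exp (θ * ‖X₀ ω‖ ^ 2)
  have h3 := mul_le_mul_of_nonneg_left h1 hθ.le
  linarith

lemma InitialAssumption.integrable_norm [IsProbabilityMeasure P] (h : InitialAssumption P ℱ β X₀)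
    (N : ℕ) : Integrable (fun ω => ‖galerkinProj N (X₀ ω)‖) P := by
  refine ((integrable_const (1 : ℝ)).add (h.integrable_norm_sq N)).mono'
    ((measurable_galerkinProj N).comp h.measurable_ambient).norm.aestronglyMeasurable
    (Eventually.of_forall fun ω => ?_)
  rw [Pi.add_apply, norm_norm]
  nlinarith [sq_nonneg (‖galerkinProj N (X₀ ω)‖ - 1), norm_nonneg (galerkinProj N (X₀ ω))]

lemma InitialAssumption.integral_norm_le [IsProbabilityMeasure P] (h : InitialAssumption P ℱ β X₀)
    (N : ℕ) :
    ∫ ω, ‖galerkinProj N (X₀ ω)‖ ∂P ≤ 1 + ∫ ω, ‖galerkinProj N (X₀ ω)‖ ^ 2 ∂P := by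
  have h1 : 1 + ∫ ω, ‖galerkinProj N (X₀ ω)‖ ^ 2 ∂P =
      ∫ ω, (1 + ‖galerkinProj N (X₀ ω)‖ ^ 2) ∂P := by
    rw [integral_add (integrable_const _) (h.integrable_norm_sq N)]
    simp
  rw [h1]
  refine integral_mono (h.integrable_norm N) ((integrable_const _).add (h.integrable_norm_sq N))
    fun ω => ?_
  nlinarith [sq_nonneg (‖galerkinProj N (X₀ ω)‖ - 1), norm_nonneg (galerkinProj N (X₀ ω))]

end Initial

lemma integral_norm_le_of_eLpNorm_two {μ : Measure H} [IsProbabilityMeasure μ] {c : ℝ≥0∞}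
    (hc : c ≠ ∞) (h : eLpNorm id 2 μ ≤ c) : ∫ x, ‖x‖ ∂μ ≤ c.toReal := by
  have h1 : ∫⁻ x, ‖x‖ₑ ∂μ ≤ c := by
    have := eLpNorm_le_eLpNorm_of_exponent_le (μ := μ) (f := (id : H → H)) one_le_two
      aestronglyMeasurable_id
    rw [eLpNorm_one_eq_lintegral_enorm] at this
    exact this.trans h
  rw [integral_norm_eq_lintegral_enorm (f := fun x : H => x) aestronglyMeasurable_id]
  exact ENNReal.toReal_mono hc h1

lemma lintegral_enorm_rpow_lt_top {μ : Measure H} [IsProbabilityMeasure μ] {p : ℝ} (hp : 1 ≤ p)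
    (h : eLpNorm id (2 * ENNReal.ofReal p) μ < ∞) : ∫⁻ x, ‖x‖ₑ ^ p ∂μ < ∞ := by
  have h1 : ∫⁻ x : H, ‖x‖ₑ ^ (2 * p) ∂μ < ∞ := by
    have := lintegral_enorm_rpow_eq (μ := μ) (id : H → H) hp
    simp only [id] at this
    rw [this]
    exact ENNReal.rpow_lt_top_of_nonneg (by linarith) h.ne
  calc ∫⁻ x, ‖x‖ₑ ^ p ∂μ ≤ ∫⁻ x, (1 + ‖x‖ₑ ^ (2 * p)) ∂μ := by
        refine lintegral_mono fun x => ?_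
        rcases le_total ‖x‖ₑ 1 with hx | hx
        · exact (ENNReal.rpow_le_one hx (by linarith)).trans le_self_add
        · exact (ENNReal.rpow_le_rpow_of_exponent_le hx (by linarith)).trans le_add_self
    _ = 1 + ∫⁻ x, ‖x‖ₑ ^ (2 * p) ∂μ := by
        rw [lintegral_add_left measurable_const]; simp
    _ < ∞ := ENNReal.add_lt_top.2 ⟨ENNReal.one_lt_top, h1⟩

lemma cb1Norm_nonneg (ψ : H → ℝ) : 0 ≤ cb1Norm ψ :=
  (Real.iSup_nonneg fun _ => abs_nonneg _).trans (le_max_left _ _)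

namespace Setting

variable {Ω : Type*} {mΩ : MeasurableSpace Ω} {K L B M β : ℝ} {F : H → H} {R : H →L[ℝ] H}
  {σ : ℕ → ℝ} {P : Measure Ω} {ℱ : Filtration ℝ≥0 mΩ} {b : ℕ → ℝ≥0 → Ω → ℝ} {N : ℕ} {τ : ℝ≥0}
  [IsProbabilityMeasure P]

/-- Every step lands in `H_N`, so a law invariant under the step on all of `H` is automatically
carried by `H_N`. -/
lemma isInvariantMeasure_iff (h : Setting K L B M β F R σ P ℱ b N τ) {π : Measure H} :
    IsInvariantMeasure P N τ F R b π ↔ IsProbabilityMeasure π ∧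
      pushLaw (schemeStep N τ F) (P.map (noiseIncrement N τ R b 0)) π = π := by
  have hcomp := transitionKernel_comp P N τ h.drift.continuous R b π
  refine ⟨fun hπ => ⟨hπ.isProbability, hcomp.symm.trans hπ.invariant⟩, fun ⟨h1, h2⟩ =>
    ⟨h1, ?_, hcomp.trans h2⟩⟩
  have hempty : (fun z : H × H => schemeStep N τ F z.1 z.2) ⁻¹' (galerkinSpace N : Set H)ᶜ = ∅ :=
    eq_empty_of_forall_notMem fun z hz => hz (schemeStep_mem_galerkinSpace N τ F z.1 z.2)
  rw [← h2, pushLaw, Measure.map_apply (measurable_schemeStep N τ h.drift.continuous)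
    (measurableSet_galerkinSpace N).compl, hempty, measure_empty]

/-- The exponential rate of convergence to an invariant law. -/
lemma abs_integral_scheme_sub_le (h : Setting K L B M β F R σ P ℱ b N τ) {π : Measure H}
    [IsProbabilityMeasure π]
    (hinv : pushLaw (schemeStep N τ F) (P.map (noiseIncrement N τ R b 0)) π = π)
    (hmom : eLpNorm id 2 π ≤ schemeBound K L B M 1) {X₀ : Ω → H}
    (hX : InitialAssumption P ℱ β X₀) {ψ : H → ℝ} (hψ : IsCb1 ψ) (k : ℕ) :
    |∫ ω, ψ (scheme N τ F R b X₀ k ω) ∂P - ∫ x, ψ x ∂π| ≤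
      (1 + (schemeBound K L B M 1).toReal) * cb1Norm ψ *
        (1 + ∫ ω, ‖galerkinProj N (X₀ ω)‖ ^ 2 ∂P) *
        Real.exp (-(1 / 2) * (eigval 0 - K) * (k * τ)) := by
  have hν : IsProbabilityMeasure (P.map (noiseIncrement N τ R b 0)) :=
    Measure.isProbabilityMeasure_map (h.measurable_noiseIncrement 0).aemeasurable
  have hproj : Measurable fun ω => galerkinProj N (X₀ ω) :=
    (measurable_galerkinProj N).comp hX.measurable_ambient
  have hμ : IsProbabilityMeasure (P.map fun ω => galerkinProj N (X₀ ω)) :=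
    Measure.isProbabilityMeasure_map hproj.aemeasurable
  have hbl := hψ.isBoundedLip
  have hfin := schemeBound_ne_top K L B M ENNReal.one_ne_top
  have hnorm : ∫ x, ‖x‖ ∂(P.map fun ω => galerkinProj N (X₀ ω)) =
      ∫ ω, ‖galerkinProj N (X₀ ω)‖ ∂P :=
    integral_map hproj.aemeasurable continuous_norm.aestronglyMeasurable
  have hint : Integrable (fun x : H => ‖x‖) (P.map fun ω => galerkinProj N (X₀ ω)) :=
    (integrable_map_measure continuous_norm.aestronglyMeasurable hproj.aemeasurable).2
      (hX.integrable_norm N)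
  have key := h.randomContraction.abs_integral_sub_integral_le (cb1Norm_nonneg ψ) hbl
    (P.map fun ω => galerkinProj N (X₀ ω)) π hint
    (integrable_norm_of_eLpNorm_two (hmom.trans_lt hfin.lt_top)) hinv k
  rw [← h.map_scheme hX.measurable,
    integral_map (h.measurable_scheme hX.measurable_ambient k).aemeasurable
      hbl.continuous.aestronglyMeasurable, hnorm, ← Real.exp_nat_mul] at key
  refine key.trans ?_
  have hexp : (k : ℝ) * (-(1 / 2) * (eigval 0 - K) * τ) =
      -(1 / 2) * (eigval 0 - K) * (k * τ) := by ring
  rw [hexp]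
  have h1 := hX.integral_norm_le N
  have h2 := integral_norm_le_of_eLpNorm_two hfin hmom
  have h3 : 0 ≤ ∫ ω, ‖galerkinProj N (X₀ ω)‖ ^ 2 ∂P := integral_nonneg fun _ => by positivity
  have h4 : (0 : ℝ) ≤ (schemeBound K L B M 1).toReal := ENNReal.toReal_nonneg
  have h5 : ∫ ω, ‖galerkinProj N (X₀ ω)‖ ∂P + ∫ x, ‖x‖ ∂π ≤
      (1 + (schemeBound K L B M 1).toReal) * (1 + ∫ ω, ‖galerkinProj N (X₀ ω)‖ ^ 2 ∂P) := by
    nlinarith [mul_nonneg h4 h3]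
  have h6 := mul_le_mul_of_nonneg_left h5 (mul_nonneg
    (Real.exp_pos (-(1 / 2) * (eigval 0 - K) * (k * τ))).le (cb1Norm_nonneg ψ))
  linarith

end Setting

end SPDE

end

theorem proposition2p4 (K L B M : ℝ) :
    ∃ (C₁ : ℝ → ℝ≥0) (C₂ : ℝ≥0 → ℝ≥0) (C₃ : ℝ≥0),
      ∀ (F : SPDE.H → SPDE.H), SPDE.DriftAssumption F K L → ‖F 0‖ ≤ B →
      ∀ (Q R : SPDE.H →L[ℝ] SPDE.H) (β : ℝ), SPDE.CovarianceAssumption Q R β →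
        SPDE.hsNorm (β - 1) R ≤ ENNReal.ofReal M →
      ∀ {Ω : Type*} [mΩ : MeasurableSpace Ω] (P : Measure Ω) [IsProbabilityMeasure P]
        (ℱ : Filtration ℝ≥0 mΩ) (b : ℕ → ℝ≥0 → Ω → ℝ), SPDE.IsBrownianFamily P ℱ b →
      ∀ (N : ℕ) (τ : ℝ≥0), 0 < τ → (τ : ℝ) < 1 / 2 →
        (τ : ℝ) ≤ (SPDE.eigval 0 - K) / (4 * L ^ 2) →
      (∀ X₀ : Ω → SPDE.H, SPDE.InitialAssumption P ℱ β X₀ →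
        (∀ p : ℝ, 1 ≤ p → ∀ t : ℝ≥0,
          ∫⁻ ω, SPDE.hdotNorm β (SPDE.contScheme N τ F R b X₀ t ω) ^ (2 * p) ∂P ≤
            C₁ p * (1 + ∫⁻ ω, SPDE.hdotNorm β (SPDE.galerkinProj N (X₀ ω)) ^ (2 * p) ∂P)) ∧
        (∀ r : ℝ≥0, ∫⁻ ω, SPDE.hdotNorm β (SPDE.galerkinProj N (X₀ ω)) ^ 2 ∂P ≤ (r : ℝ≥0∞) ^ 2 →
          ∀ s t : ℝ≥0, s ≤ t →
            ∫⁻ ω, ‖SPDE.contScheme N τ F R b X₀ t ω - SPDE.contScheme N τ F R b X₀ s ω‖ₑ ^ 2 ∂P ≤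
              C₂ r * ENNReal.ofReal (((t : ℝ) - s) ^ β))) ∧
      (∀ X₀ X₀' : Ω → SPDE.H, SPDE.InitialAssumption P ℱ β X₀ →
        SPDE.InitialAssumption P ℱ β X₀' → ∀ p : ℝ, 1 ≤ p → ∀ k : ℕ,
          ∫⁻ ω, ‖SPDE.scheme N τ F R b X₀ k ω - SPDE.scheme N τ F R b X₀' k ω‖ₑ ^ (2 * p) ∂P ≤
            (∫⁻ ω, ‖SPDE.galerkinProj N (X₀ ω) - SPDE.galerkinProj N (X₀' ω)‖ₑ ^ (2 * p) ∂P) *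
              ENNReal.ofReal (Real.exp (-(SPDE.eigval 0 - K) * p * (k * τ)))) ∧
      ∃ π : Measure SPDE.H, SPDE.IsInvariantMeasure P N τ F R b π ∧
        (∀ π' : Measure SPDE.H, SPDE.IsInvariantMeasure P N τ F R b π' → π' = π) ∧
        (∀ X₀ : Ω → SPDE.H, SPDE.InitialAssumption P ℱ β X₀ →
          ∀ ψ : SPDE.H → ℝ, SPDE.IsCb1 ψ → ∀ k : ℕ,
            |∫ ω, ψ (SPDE.scheme N τ F R b X₀ k ω) ∂P - ∫ x, ψ x ∂π| ≤
              C₃ * SPDE.cb1Norm ψ * (1 + ∫ ω, ‖SPDE.galerkinProj N (X₀ ω)‖ ^ 2 ∂P) *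
                Real.exp (-(1 / 2) * (SPDE.eigval 0 - K) * (k * τ))) ∧
        (∀ p : ℝ, 1 ≤ p → ∫⁻ x, ‖x‖ₑ ^ p ∂π < ∞) := by
  -- The constants are fixed before drift, noise and discretization, from `K`, `L`, `B`, `M` alone;
  -- not even `β` enters, since the smoothing estimate uses only `β ≤ 1`. Finiteness justifies
  -- `toNNReal`.
  refine ⟨fun p => ((ENNReal.ofReal (1 + 4 * L) +
      SPDE.contBound K L B M (ENNReal.ofReal p)) ^ (2 * p)).toNNReal,
    fun r => ((2 * (ENNReal.ofReal (1 + 4 * L) * r + SPDE.contBound K L B M 1) +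
      (ENNReal.ofReal B + ENNReal.ofReal L * (r + SPDE.schemeBound K L B M 1)) +
      SPDE.noiseBound M 1) ^ 2).toNNReal,
    1 + (SPDE.schemeBound K L B M 1).toNNReal, ?_⟩
  intro F hF hB Q R β hQ hM Ω mΩ P _ ℱ b hb N τ h0 h1 h2
  obtain ⟨σ, h⟩ := hQ.exists_setting hM hF hB hb N h0 h1 h2
  have hs1 := SPDE.schemeBound_ne_top K L B M ENNReal.one_ne_top
  refine ⟨fun X₀ hX => ⟨fun p hp t => ?_, fun r hr s t hst => ?_⟩,
    fun X₀ X₀' _ _ p hp k => h.lintegral_scheme_sub_le X₀ X₀' hp k, ?_⟩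
  · rw [ENNReal.coe_toNNReal (ENNReal.rpow_ne_top_of_nonneg (by linarith) (ENNReal.add_ne_top.2
      ⟨ENNReal.ofReal_ne_top, SPDE.contBound_ne_top K L B M ENNReal.ofReal_ne_top⟩))]
    exact h.lintegral_hdotNorm_contScheme_le hX.measurable_ambient hp t
  · rw [ENNReal.coe_toNNReal]
    · exact h.lintegral_contScheme_sub_le hX.measurable_ambient hst hr
    · have hc1 := SPDE.contBound_ne_top K L B M ENNReal.one_ne_top
      have hn1 := SPDE.noiseBound_ne_top M ENNReal.one_ne_top
      finiteness
  · obtain ⟨π, hπ, hinv, hmom⟩ := h.exists_invariant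
    have hν : IsProbabilityMeasure (P.map (SPDE.noiseIncrement N τ R b 0)) :=
      Measure.isProbabilityMeasure_map (h.measurable_noiseIncrement 0).aemeasurable
    refine ⟨π, h.isInvariantMeasure_iff.2 ⟨hπ, hinv⟩, fun π' hπ' => ?_, fun X₀ hX ψ hψ k => ?_,
      fun p hp => ?_⟩
    · obtain ⟨_, hinv'⟩ := h.isInvariantMeasure_iff.1 hπ'
      exact h.randomContraction.eq_of_invariant hinv hinv'
    · have := hmom 1 le_rfl
      rw [mul_one] at this
      exact h.abs_integral_scheme_sub_le hinv this hX hψ k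
    · exact SPDE.lintegral_enorm_rpow_lt_top hp ((hmom _ (by simpa using hp)).trans_lt
        (SPDE.schemeBound_ne_top K L B M ENNReal.ofReal_ne_top).lt_top)
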